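/- Let $A=\mathbb{R}[x,y,z]/(x^2+y^2+z^2)$, let $C=\mathrm{Proj}(A)=V(x^2+y^2+z^2)\subset\mathbb{P}^2_{\mathbb{R}}$ be the real anisotropic conic, and let $\Omega_C$ be its sheaf of Kähler differentials over $\mathbb{R}$. Put $U_1=D_+(z)$, $U_2=D_+(y)$, $R_1=\Gamma(U_1,\mathcal{O}_C)$, $R_2=\Gamma(U_2,\mathcal{O}_C)$, $R_{12}=\Gamma(U_1\cap U_2,\mathcal{O}_C)$. A vector bundle on $C$ is an $\mathcal{O}_C$-module that is locally free of finite rank. A matrix $M$ over $R_{12}$ is a transition matrix (from $U_1$ to $U_2$) of a vector bundle $\mathcal{V}$ if $\mathcal{V}$ has trivialisations over $U_1$ and over $U_2$ such that $M$ sends the $U_1$-coordinates of each section over $U_1\cap U_2$ to its $U_2$-coordinates. For $i\in\mathbb{Z}$ let $$M_i=\begin{bmatrix}(-y/z)^{i/2}\end{bmatrix}\ (i \text{ even}),\qquad M_i=\begin{bmatrix}(-y/z)^{(i+1)/2} & (x/z)(-y/z)^{(i-1)/2}\\ 0 & (-y/z)^{(i-1)/2}\end{bmatrix}\ (i\text{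 odd}).$$ Let $\mathcal{Q}$ be the bundle obtained by gluing $\mathcal{O}_{U_1}^2$ and $\mathcal{O}_{U_2}^2$ along $M_1=\begin{bmatrix}-y/z & x/z\\ 0&1\end{bmatrix}$ (the Quillen bundle). Then: 1. $\mathcal{Q}$ is an indecomposable vector bundle of rank $2$ with transition matrix $M_1$. 2. For every vector bundle $\mathcal{V}$ on $C$ there is a family of integers $m_i\ge 0$ $(i\in\mathbb{Z})$, almost all zero, such that $$\mathcal{V}\;\cong\;\Big(\bigoplus_{r\in\mathbb{Z}}(\Omega_C^{\otimes r})^{\oplus m_{2r}}\Big)\oplus\Big(\bigoplus_{s\in\mathbb{Z}}(\mathcal{Q}\otimes\Omega_C^{\otimes s})^{\oplus m_{2s+1}}\Big),$$ and such that the block sum $\bigoplus_{i\in\mathbb{Z}}M_i^{\oplus m_i}$ is a transition matrix of $\mathcal{V}$. Each of these two properties alone determines the family $(m_i)$ uniquely. 3. For every $n\ge 0$ and every $M\in \mathrm{GL}_n(R_{12})$ there is exactly one family of integers $m_i\ge 0$ $(i\in\mathbb{Z})$, almost all zero, such that $\bigoplus_{i\in\mathbb{Z}} M_i^{\oplus m_i}$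 is an $n\times n$ matrix and, for some ordering of its rows and columns (the same for both), equals $LMR$ for some $L\in \mathrm{GL}_n(R_2)$ and $R\in \mathrm{GL}_n(R_1)$. -/

import Mathlib

open CategoryTheory CategoryTheory.Limits AlgebraicGeometry TopologicalSpace Opposite

noncomputable section

namespace AnisotropicConic

/-! ### Generalities on modules over a scheme -/

section General

variable {X : Scheme.{0}}

/-- Restriction of functions from an open `U` to a smaller open `V`. -/
def res {U V : X.Opens} (h : V ≤ U) : Γ(X, U) →+* Γ(X, V) :=
  (X.presheaf.map (homOfLE h).op).hom

/-- Restriction of sections of an `𝒪_X`-module from an open `U` to a smaller open `V`. -/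
def resM (F : X.Modules) {U V : X.Opens} (h : V ≤ U) : Γ(F, U) →+ Γ(F, V) :=
  (F.presheaf.map (homOfLE h).op).hom

/-- The finite family `v` of sections of `F` over `U` is a frame: the morphism
`𝒪_U^κ ⟶ F|_U` with components `v` is an isomorphism, i.e. it is bijective on the sections over
every open `W ≤ U`. -/
def IsFrame {κ : Type} [Fintype κ] (F : X.Modules) (U : X.Opens) (v : κ → Γ(F, U)) : Prop :=
  ∀ (W : X.Opens) (h : W ≤ U),
    Function.Bijective fun f : κ → Γ(X, W) => ∑ k, f k • resM F h (v k)

/-- A vector bundle: an `𝒪_X`-module which is locally free of finite rank. -/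
def IsVectorBundle (F : X.Modules) : Prop :=
  ∀ x : X, ∃ U : X.Opens, x ∈ U ∧ ∃ (n : ℕ) (v : Fin n → Γ(F, U)), IsFrame F U v

/-- `M` is a transition matrix, from `U₁` to `U₂`, of the bundle `F`: there are trivialisations of
`F` over `U₁` and `U₂` such that `M` maps the coordinates over `U₁` of a section over `U₁ ⊓ U₂` to
its coordinates over `U₂`. -/
def IsTransitionMatrix {κ : Type} [Fintype κ] (U₁ U₂ : X.Opens) (F : X.Modules)
    (M : Matrix κ κ Γ(X, U₁ ⊓ U₂)) : Prop :=
  ∃ (v : κ → Γ(F, U₁)) (w : κ → Γ(F, U₂)), IsFrame F U₁ v ∧ IsFrame F U₂ w ∧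
    ∀ j, resM F inf_le_left (v j) = ∑ i, M i j • resM F inf_le_right (w i)

/-- The sheaf of `𝒪_X`-modules associated to a presheaf of modules. -/
def sheafify (P : X.PresheafOfModules) : X.Modules :=
  (PresheafOfModules.sheafification (𝟙 X.ringCatSheaf.obj)).obj P

/-- The structure sheaf, as an `𝒪_X`-module. -/
def structureSheaf (X : Scheme.{0}) : X.Modules :=
  SheafOfModules.unit X.ringCatSheaf

/-- The tensor product `F ⊗ G` of `𝒪_X`-modules: the sheaf associated to
`U ↦ F(U) ⊗_{𝒪(U)} G(U)`. -/
def tensor (F G : X.Modules) : X.Modules :=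
  sheafify (PresheafOfModules.Monoidal.tensorObj (R := X.presheaf) F.val G.val)

/-- The sheaf of Kähler differentials `Ω_{X/k}`: the sheaf associated to `U ↦ Ω_{𝒪(U)/k}`. -/
def kaehler {k : Type} [CommRing k] (f : X ⟶ Spec (.of k)) : X.Modules :=
  sheafify (PresheafOfModules.DifferentialsConstruction.relativeDifferentials'
    (S' := (Functor.const _).obj (CommRingCat.of k)) (R := X.presheaf)
    { app := fun U => (Scheme.ΓSpecIso (.of k)).inv ≫ f.appTop ≫
        X.presheaf.map (homOfLE le_top : U.unop ⟶ ⊤).op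
      naturality := by
        intro U V g
        simp only [Functor.const_obj_map, Category.assoc, ← Functor.map_comp]
        rfl })

end General

section Dual

variable {X : Scheme.{0}}

lemma res_res {U V W : X.Opens} (h : V ≤ U) (h' : W ≤ V) (s : Γ(X, U)) :
    res h' (res h s) = res (h'.trans h) s := by
  simp only [res, ← CommRingCat.comp_apply, ← Functor.map_comp]
  rfl

lemma res_self {U : X.Opens} (s : Γ(X, U)) : res le_rfl s = s := by
  simp [res]

lemma resM_smul (F : X.Modules) {U V : X.Opens} (h : V ≤ U) (r : Γ(X, U)) (s : Γ(F, U)) :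
    resM F h (r • s) = res h r • resM F h s :=
  Scheme.Modules.map_smul F (homOfLE h) r s

/-- The sections over `U` of the dual `Hom(F, 𝒪_X)`: the morphisms `F|_U ⟶ 𝒪_U`. -/
def dualSections (F : X.Modules) (U : X.Opens) :
    AddSubgroup (∀ W : {W : X.Opens // W ≤ U}, Γ(F, W.1) →ₗ[Γ(X, W.1)] Γ(X, W.1)) where
  carrier := {φ | ∀ (W W' : {W : X.Opens // W ≤ U}) (h : W'.1 ≤ W.1) (s : Γ(F, W.1)),
    res h (φ W s) = φ W' (resM F h s)}
  add_mem' := by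
    intro φ ψ hφ hψ W W' h s
    simp [hφ W W' h s, hψ W W' h s]
  zero_mem' := by
    intro W W' h s
    simp
  neg_mem' := by
    intro φ hφ W W' h s
    simp [hφ W W' h s]

instance (F : X.Modules) (U : X.Opens) : SMul Γ(X, U) (dualSections F U) where
  smul r φ := ⟨fun W => (res W.2 r : Γ(X, W.1)) • (φ.1 W : Γ(F, W.1) →ₗ[Γ(X, W.1)] Γ(X, W.1)), by
    intro W W' h s
    simp only [LinearMap.smul_apply, smul_eq_mul, map_mul, res_res, φ.2 W W' h s]⟩

lemma dual_smul_val (F : X.Modules) (U : X.Opens) (r : Γ(X, U)) (φ : dualSections F U)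
    (W : {W : X.Opens // W ≤ U}) :
    (r • φ).1 W = (res W.2 r : Γ(X, W.1)) • (φ.1 W : Γ(F, W.1) →ₗ[Γ(X, W.1)] Γ(X, W.1)) := rfl

instance (F : X.Modules) (U : X.Opens) : Module Γ(X, U) (dualSections F U) where
  one_smul φ := by ext W : 2; simp [dual_smul_val]
  mul_smul r r' φ := by ext W : 2; simp [dual_smul_val, mul_smul]
  smul_zero r := by ext W : 2; simp [dual_smul_val]
  smul_add r φ ψ := by ext W : 2; simp [dual_smul_val]
  add_smul r r' φ := by ext W : 2; simp [dual_smul_val, add_smul]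
  zero_smul φ := by ext W : 2; simp [dual_smul_val]

/-- Restriction of morphisms `F|_U ⟶ 𝒪_U` to a smaller open. -/
def dualRes (F : X.Modules) {U V : X.Opens} (h : V ≤ U) :
    dualSections F U →+ dualSections F V where
  toFun φ := ⟨fun W => φ.1 ⟨W.1, W.2.trans h⟩, fun W W' h' s =>
    φ.2 ⟨W.1, W.2.trans h⟩ ⟨W'.1, W'.2.trans h⟩ h' s⟩
  map_zero' := rfl
  map_add' _ _ := rfl

lemma dualRes_smul (F : X.Modules) {U V : X.Opens} (h : V ≤ U) (r : Γ(X, U))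
    (φ : dualSections F U) : dualRes F h (r • φ) = res h r • dualRes F h φ := by
  refine Subtype.ext (funext fun W => ?_)
  rw [dual_smul_val, res_res]
  rfl

/-- The presheaf of modules `U ↦ Hom(F|_U, 𝒪_U)`. -/
def dualPresheaf (F : X.Modules) : X.PresheafOfModules :=
  letI P : (X.Opens)ᵒᵖ ⥤ Ab.{0} :=
    { obj := fun U => AddCommGrpCat.of (dualSections F U.unop)
      map := fun f => AddCommGrpCat.ofHom (dualRes F f.unop.le) }
  letI (U : (X.Opens)ᵒᵖ) : Module (X.ringCatSheaf.obj.obj U) (P.obj U) :=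
    inferInstanceAs (Module Γ(X, U.unop) (dualSections F U.unop))
  PresheafOfModules.ofPresheaf P fun _ _ f r φ => dualRes_smul F f.unop.le r φ

/-- The dual `Hom(F, 𝒪_X)` of an `𝒪_X`-module.  (The presheaf `U ↦ Hom(F|_U, 𝒪_U)` is already a
sheaf, so that passing to the associated sheaf does not change it.) -/
def dual (F : X.Modules) : X.Modules := sheafify (dualPresheaf F)

/-- `n`-fold tensor power, `n ∈ ℕ`. -/
def tensorPow (L : X.Modules) : ℕ → X.Modules
  | 0 => structureSheaf X
  | n + 1 => tensor (tensorPow L n) L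

/-- The tensor power `L^{⊗ r}`, `r ∈ ℤ`, of a line bundle; negative powers are powers of the
dual. -/
def tensorZPow (L : X.Modules) : ℤ → X.Modules
  | .ofNat n => tensorPow L n
  | .negSucc n => tensorPow (dual L) (n + 1)

end Dual

section Clutching

variable {X : Scheme.{0}} {κ : Type} [Fintype κ] {U₁ U₂ : X.Opens}

/-- Sections over `W` of the bundle glued from `𝒪^κ` on `U₁` and `𝒪^κ` on `U₂` along `M`: pairs
`(f, g)` of vectors of functions on `W ⊓ U₁` and on `W ⊓ U₂` with `g = M f` on
`W ⊓ (U₁ ⊓ U₂)`. -/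
def clutchSections (M : Matrix κ κ Γ(X, U₁ ⊓ U₂)) (W : X.Opens) :
    AddSubgroup ((κ → Γ(X, W ⊓ U₁)) × (κ → Γ(X, W ⊓ U₂))) where
  carrier := {s | ∀ i, res (inf_le_inf_left W inf_le_right) (s.2 i) =
    ∑ j, res (inf_le_right : W ⊓ (U₁ ⊓ U₂) ≤ U₁ ⊓ U₂) (M i j) *
      res (inf_le_inf_left W inf_le_left) (s.1 j)}
  add_mem' := by
    intro s t hs ht i
    simp [hs i, ht i, mul_add, Finset.sum_add_distrib]
  zero_mem' := by intro i; simp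
  neg_mem' := by
    intro s hs i
    simp [hs i]

lemma clutch_ext (M : Matrix κ κ Γ(X, U₁ ⊓ U₂)) {W : X.Opens} {s t : clutchSections M W}
    (h₁ : ∀ i, s.1.1 i = t.1.1 i) (h₂ : ∀ i, s.1.2 i = t.1.2 i) : s = t :=
  Subtype.ext (Prod.ext (funext h₁) (funext h₂))

instance (M : Matrix κ κ Γ(X, U₁ ⊓ U₂)) (W : X.Opens) :
    SMul Γ(X, W) (clutchSections M W) where
  smul r s := ⟨(fun i => res inf_le_left r * s.1.1 i, fun i => res inf_le_left r * s.1.2 i), by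
    intro i
    simp only [map_mul, res_res, s.2 i, Finset.mul_sum]
    exact Finset.sum_congr rfl fun j _ => by ring⟩

lemma clutch_smul_val (M : Matrix κ κ Γ(X, U₁ ⊓ U₂)) (W : X.Opens) (r : Γ(X, W))
    (s : clutchSections M W) : (r • s).1 =
      (fun i => res inf_le_left r * s.1.1 i, fun i => res inf_le_left r * s.1.2 i) := rfl

instance (M : Matrix κ κ Γ(X, U₁ ⊓ U₂)) (W : X.Opens) :
    Module Γ(X, W) (clutchSections M W) where
  one_smul s := by ext <;> simp [clutch_smul_val]
  mul_smul r r' s := by ext <;> simp [clutch_smul_val, mul_assoc]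
  smul_zero r := by ext <;> simp [clutch_smul_val]
  smul_add r s t := by ext <;> simp [clutch_smul_val, mul_add]
  add_smul r r' s := by ext <;> simp [clutch_smul_val, add_mul]
  zero_smul s := by ext <;> simp [clutch_smul_val]

/-- Restriction of sections of a glued bundle. -/
def clutchRes (M : Matrix κ κ Γ(X, U₁ ⊓ U₂)) {W W' : X.Opens} (h : W' ≤ W) :
    clutchSections M W →+ clutchSections M W' where
  toFun s := ⟨(fun i => res (inf_le_inf_right U₁ h) (s.1.1 i),
      fun i => res (inf_le_inf_right U₂ h) (s.1.2 i)), by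
    intro i
    have := congrArg (res (inf_le_inf_right (U₁ ⊓ U₂) h)) (s.2 i)
    simpa only [map_sum, map_mul, res_res] using this⟩
  map_zero' := by ext <;> simp
  map_add' s t := by ext <;> simp

lemma clutchRes_smul (M : Matrix κ κ Γ(X, U₁ ⊓ U₂)) {W W' : X.Opens} (h : W' ≤ W) (r : Γ(X, W))
    (s : clutchSections M W) : clutchRes M h (r • s) = res h r • clutchRes M h s := by
  refine clutch_ext M (fun k => ?_) (fun k => ?_)
  · change res _ (res _ r * s.1.1 k) = res _ (res _ r) * res _ (s.1.1 k)
    rw [map_mul, res_res, res_res]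
  · change res _ (res _ r * s.1.2 k) = res _ (res _ r) * res _ (s.1.2 k)
    rw [map_mul, res_res, res_res]

/-- The presheaf of abelian groups underlying a glued bundle. -/
def clutchAb (M : Matrix κ κ Γ(X, U₁ ⊓ U₂)) : (X.Opens)ᵒᵖ ⥤ Ab.{0} where
  obj W := AddCommGrpCat.of (clutchSections M W.unop)
  map f := AddCommGrpCat.ofHom (clutchRes M f.unop.le)
  map_id W := by
    refine AddCommGrpCat.hom_ext (AddMonoidHom.ext fun s => ?_)
    exact clutch_ext M (s := clutchRes M le_rfl s) (t := s) (fun i => res_self _) (fun i => res_self _)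
  map_comp f g := by
    refine AddCommGrpCat.hom_ext (AddMonoidHom.ext fun s => ?_)
    exact clutch_ext M (s := clutchRes M (f ≫ g).unop.le s) (t := clutchRes M g.unop.le (clutchRes M f.unop.le s))
      (fun i => (res_res _ _ _).symm) (fun i => (res_res _ _ _).symm)

lemma exists_glue {ι : Type} (U : ι → X.Opens) (O : X.Opens)
    (sf : ∀ i, Γ(X, U i ⊓ O))
    (h : ∀ i j, res (inf_le_inf_right O inf_le_left) (sf i) =
      res (inf_le_inf_right O (inf_le_right : U i ⊓ U j ≤ U j)) (sf j)) :
    ∃! s : Γ(X, iSup U ⊓ O), ∀ i, res (inf_le_inf_right O (le_iSup U i)) s = sf i := by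
  refine X.sheaf.existsUnique_gluing' (fun i => U i ⊓ O) (iSup U ⊓ O)
    (fun i => homOfLE (inf_le_inf_right O (le_iSup U i))) (by rw [iSup_inf_eq]) sf ?_
  intro i j
  have h1 : (U i ⊓ O) ⊓ (U j ⊓ O) ≤ (U i ⊓ U j) ⊓ O := by
    exact le_inf (inf_le_inf inf_le_left inf_le_left) (inf_le_left.trans inf_le_right)
  have := congrArg (res h1) (h i j)
  simp only [res_res] at this
  exact this

lemma clutchAb_isSheaf (M : Matrix κ κ Γ(X, U₁ ⊓ U₂)) :
    TopCat.Presheaf.IsSheaf (clutchAb M) := by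
  rw [TopCat.Presheaf.isSheaf_iff_isSheafUniqueGluing]
  intro ι U sf hsf
  let sf' : ∀ i, clutchSections M (U i) := sf
  have hc : ∀ i j, clutchRes M inf_le_left (sf' i) =
    clutchRes M (inf_le_right : U i ⊓ U j ≤ U j) (sf' j) := hsf
  choose f hf hf' using fun k => exists_glue U U₁ (fun i => (sf' i).1.1 k)
    (fun i j => congrFun (congrArg (fun s => s.1.1) (hc i j)) k)
  choose g hg hg' using fun k => exists_glue U U₂ (fun i => (sf' i).1.2 k)
    (fun i j => congrFun (congrArg (fun s => s.1.2) (hc i j)) k)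
  have hfg : (f, g) ∈ clutchSections M (iSup U) := by
    intro k
    refine X.sheaf.eq_of_locally_eq' (fun i => U i ⊓ (U₁ ⊓ U₂)) (iSup U ⊓ (U₁ ⊓ U₂))
      (fun i => homOfLE (inf_le_inf_right _ (le_iSup U i))) (by rw [iSup_inf_eq]) _ _ ?_
    intro i
    have h0 := (sf' i).2 k
    simp only [← hf, ← hg, res_res] at h0
    change res _ (res _ _) = res (inf_le_inf_right _ (le_iSup U i)) _
    simpa only [map_sum, map_mul, res_res] using h0
  refine ⟨(⟨(f, g), hfg⟩ : clutchSections M (iSup U)), ?_, ?_⟩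
  · intro i
    exact clutch_ext M (fun k => hf k i) (fun k => hg k i)
  · intro t ht
    let t' : clutchSections M (iSup U) := t
    have ht' : ∀ i, clutchRes M (le_iSup U i) t' = sf' i := ht
    exact clutch_ext M
      (fun k => hf' k (t'.1.1 k) fun i => congrFun (congrArg (fun s => s.1.1) (ht' i)) k)
      (fun k => hg' k (t'.1.2 k) fun i => congrFun (congrArg (fun s => s.1.2) (ht' i)) k)

/-- The bundle glued from the trivial bundles `𝒪^κ` on `U₁` and `𝒪^κ` on `U₂` along the matrix `M`
on `U₁ ⊓ U₂`. -/
def clutch (M : Matrix κ κ Γ(X, U₁ ⊓ U₂)) : X.Modules where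
  val :=
    letI (W : (X.Opens)ᵒᵖ) : Module (X.ringCatSheaf.obj.obj W) ((clutchAb M).obj W) :=
      inferInstanceAs (Module Γ(X, W.unop) (clutchSections M W.unop))
    PresheafOfModules.ofPresheaf (clutchAb M) fun _ _ f r s => clutchRes_smul M f.unop.le r s
  isSheaf := clutchAb_isSheaf M

end Clutching

/-! ### Homogeneous coordinate rings of hypersurfaces -/

section Grading

variable {A : Type} [CommRing A] [Algebra ℝ A] (𝒜 : ℕ → Submodule ℝ A) [GradedAlgebra 𝒜]
  (I : Ideal A)

/-- The grading of `A ⧸ I` by the images of the graded pieces of `A`. -/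
def quotientGrading (i : ℕ) : Submodule ℝ (A ⧸ I) :=
  (𝒜 i).map (Ideal.Quotient.mkₐ ℝ I).toLinearMap

instance quotientGrading_gradedMonoid : SetLike.GradedMonoid (quotientGrading 𝒜 I) where
  one_mem := ⟨1, SetLike.GradedOne.one_mem, map_one (Ideal.Quotient.mkₐ ℝ I)⟩
  mul_mem := by
    rintro i j _ _ ⟨a, ha, rfl⟩ ⟨b, hb, rfl⟩
    exact ⟨a * b, SetLike.GradedMul.mul_mem ha hb, map_mul (Ideal.Quotient.mkₐ ℝ I) a b⟩

/-- The graded pieces of `A` map to those of `A ⧸ I`. -/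
def toQuotientPiece (i : ℕ) : 𝒜 i →ₗ[ℝ] quotientGrading 𝒜 I i :=
  ((Ideal.Quotient.mkₐ ℝ I).toLinearMap.restrict fun _ ha => ⟨_, ha, rfl⟩)

lemma preDecompose_one :
    ((DirectSum.lof ℝ ℕ (fun i => quotientGrading 𝒜 I i) 0) ∘ₗ toQuotientPiece 𝒜 I 0)
      (GradedMonoid.GOne.one (A := fun i => 𝒜 i)) = 1 := by
  rfl

lemma preDecompose_mul {i j : ℕ} (a : 𝒜 i) (b : 𝒜 j) :
    ((DirectSum.lof ℝ ℕ (fun i => quotientGrading 𝒜 I i) (i + j)) ∘ₗ toQuotientPiece 𝒜 I (i + j))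
        (GradedMonoid.GMul.mul (A := fun i => 𝒜 i) a b) =
      ((DirectSum.lof ℝ ℕ (fun i => quotientGrading 𝒜 I i) i) ∘ₗ toQuotientPiece 𝒜 I i) a *
      ((DirectSum.lof ℝ ℕ (fun i => quotientGrading 𝒜 I i) j) ∘ₗ toQuotientPiece 𝒜 I j) b := by
  simp only [LinearMap.comp_apply, DirectSum.lof_eq_of]
  rw [DirectSum.of_mul_of]
  rfl

/-- The decomposition of an element of `A`, reduced modulo `I` degree by degree. -/
def preDecompose : A →ₐ[ℝ] DirectSum ℕ fun i => quotientGrading 𝒜 I i :=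
  (DirectSum.toAlgebra ℝ (fun i => 𝒜 i)
    (fun i => (DirectSum.lof ℝ ℕ (fun i => quotientGrading 𝒜 I i) i) ∘ₗ toQuotientPiece 𝒜 I i)
    (preDecompose_one 𝒜 I) (preDecompose_mul 𝒜 I)).comp (DirectSum.decomposeAlgEquiv 𝒜).toAlgHom

lemma preDecompose_of_mem {i : ℕ} (a : A) (ha : a ∈ 𝒜 i) :
    preDecompose 𝒜 I a = DirectSum.of (fun i => quotientGrading 𝒜 I i) i
      ⟨Ideal.Quotient.mkₐ ℝ I a, ⟨a, ha, rfl⟩⟩ := by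
  rw [preDecompose, AlgHom.comp_apply]
  have h : (DirectSum.decomposeAlgEquiv 𝒜).toAlgHom a = DirectSum.of (fun i => 𝒜 i) i ⟨a, ha⟩ :=
    DirectSum.decompose_of_mem 𝒜 ha
  rw [h, DirectSum.toAlgebra_apply]
  erw [DirectSum.toSemiring_of]
  rfl

lemma preDecompose_eq_zero (hI : I.IsHomogeneous 𝒜) (a : A) (ha : a ∈ I) :
    preDecompose 𝒜 I a = 0 := by
  classical
  rw [← DirectSum.sum_support_decompose 𝒜 a, map_sum]
  refine Finset.sum_eq_zero fun i _ => ?_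
  rw [preDecompose_of_mem 𝒜 I _ (DirectSum.decompose 𝒜 a i).2]
  have : (⟨Ideal.Quotient.mkₐ ℝ I (DirectSum.decompose 𝒜 a i),
      ⟨_, (DirectSum.decompose 𝒜 a i).2, rfl⟩⟩ : quotientGrading 𝒜 I i) = 0 :=
    Subtype.ext (Ideal.Quotient.eq_zero_iff_mem.mpr (hI i ha))
  rw [this, map_zero]

/-- The quotient of a graded algebra by a homogeneous ideal is graded. -/
abbrev quotientGradedAlgebra (hI : I.IsHomogeneous 𝒜) : GradedAlgebra (quotientGrading 𝒜 I) :=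
  GradedAlgebra.ofAlgHom _
    (Ideal.Quotient.liftₐ I (preDecompose 𝒜 I) fun a ha => preDecompose_eq_zero 𝒜 I hI a ha)
    (by
      classical
      refine Ideal.Quotient.algHom_ext ℝ (AlgHom.ext fun a => ?_)
      change DirectSum.coeAlgHom _ (preDecompose 𝒜 I a) = Ideal.Quotient.mk I a
      conv_lhs => rw [← DirectSum.sum_support_decompose 𝒜 a]
      conv_rhs => rw [← DirectSum.sum_support_decompose 𝒜 a]
      rw [map_sum, map_sum, map_sum]
      refine Finset.sum_congr rfl fun i _ => ?_
      rw [preDecompose_of_mem 𝒜 I _ (DirectSum.decompose 𝒜 a i).2, DirectSum.coeAlgHom_of]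
      rfl)
    (by
      rintro i ⟨_, a, ha, rfl⟩
      exact preDecompose_of_mem 𝒜 I a ha)

end Grading

/-! ### The real anisotropic conic -/

/-- The quadratic form `x² + y² + z²`; the variables `x`, `y`, `z` have the indices `0`, `1`,
`2`. -/
def quadric : MvPolynomial (Fin 3) ℝ :=
  MvPolynomial.X 0 ^ 2 + MvPolynomial.X 1 ^ 2 + MvPolynomial.X 2 ^ 2

/-- The homogeneous coordinate ring `ℝ[x, y, z] / (x² + y² + z²)`. -/
abbrev CoordRing : Type := MvPolynomial (Fin 3) ℝ ⧸ Ideal.span {quadric}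

/-- The grading of the homogeneous coordinate ring by degree. -/
abbrev grading : ℕ → Submodule ℝ CoordRing :=
  quotientGrading (MvPolynomial.homogeneousSubmodule (Fin 3) ℝ) (Ideal.span {quadric})

lemma quadric_mem : quadric ∈ MvPolynomial.homogeneousSubmodule (Fin 3) ℝ 2 :=
  (((MvPolynomial.isHomogeneous_X_pow 0 2).add (MvPolynomial.isHomogeneous_X_pow 1 2)).add
    (MvPolynomial.isHomogeneous_X_pow 2 2))

instance : GradedAlgebra (MvPolynomial.homogeneousSubmodule (Fin 3) ℝ) :=
  MvPolynomial.gradedAlgebra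

instance : GradedAlgebra grading :=
  quotientGradedAlgebra _ _ (Ideal.homogeneous_span _ _ (by
    rintro _ rfl
    exact ⟨2, quadric_mem⟩))

/-- The conic `C = V(x² + y² + z²) ⊆ ℙ²` over `ℝ`. -/
abbrev conic : Scheme.{0} := Proj grading

/-- The structure morphism `C ⟶ Spec ℝ`. -/
def conicToSpec : conic ⟶ Spec (.of ℝ) :=
  Proj.toSpecZero grading ≫ Spec.map (CommRingCat.ofHom (algebraMap ℝ (grading 0)))

/-- The homogeneous coordinates of the conic. -/
def coord (i : Fin 3) : CoordRing := Ideal.Quotient.mk _ (MvPolynomial.X i)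

lemma coord_mem (i : Fin 3) : coord i ∈ grading 1 :=
  ⟨MvPolynomial.X i, MvPolynomial.isHomogeneous_X ℝ i, rfl⟩

/-- The function `x_i / x_j` on the open subset `x_j ≠ 0` of the conic. -/
def coordDiv (i j : Fin 3) : Γ(conic, Proj.basicOpen grading (coord j)) :=
  Proj.awayToSection grading (coord j)
    (HomogeneousLocalization.Away.mk grading (coord_mem j) 1 (coord i)
      (by simpa using coord_mem i))

/-- The open subset `z ≠ 0` of the conic. -/
abbrev U₁ : conic.Opens := Proj.basicOpen grading (coord 2)

/-- The open subset `y ≠ 0` of the conic. -/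
abbrev U₂ : conic.Opens := Proj.basicOpen grading (coord 1)

/-- The ring of functions on `U₁`. -/
abbrev R₁ : Type := Γ(conic, U₁)

/-- The ring of functions on `U₂`. -/
abbrev R₂ : Type := Γ(conic, U₂)

/-- The ring of functions on `U₁ ∩ U₂`. -/
abbrev R₁₂ : Type := Γ(conic, U₁ ⊓ U₂)

/-- The inclusion `R₁ ⟶ R₁₂`. -/
def ι₁ : R₁ →+* R₁₂ := res inf_le_left

/-- The inclusion `R₂ ⟶ R₁₂`. -/
def ι₂ : R₂ →+* R₁₂ := res inf_le_right

/-- The function `x / z` on `U₁ ∩ U₂`. -/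
def xz : R₁₂ := ι₁ (coordDiv 0 2)

lemma yz_mul_zy : ι₁ (coordDiv 1 2) * ι₂ (coordDiv 2 1) = 1 := by
  refine Subtype.ext (funext fun p => ?_)
  apply HomogeneousLocalization.val_injective
  have h₁ : coord 1 ∉ p.1.asHomogeneousIdeal := p.2.2
  have h₂ : coord 2 ∉ p.1.asHomogeneousIdeal := p.2.1
  have e₁ : ((ι₁ (coordDiv 1 2)).1 p).val = Localization.mk (coord 1) ⟨coord 2 ^ 1, by
    rw [pow_one]; exact h₂⟩ := rfl
  have e₂ : ((ι₂ (coordDiv 2 1)).1 p).val = Localization.mk (coord 2) ⟨coord 1 ^ 1, by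
    rw [pow_one]; exact h₁⟩ := rfl
  erw [HomogeneousLocalization.val_mul]
  rw [e₁, e₂]
  erw [HomogeneousLocalization.val_one]
  rw [Localization.mk_mul, ← Localization.mk_one, Localization.mk_eq_mk_iff]
  refine Localization.r_of_eq ?_
  simp [mul_comm]

/-- The invertible function `-y / z` on `U₁ ∩ U₂`, with inverse `-z / y`. -/
def t : R₁₂ˣ where
  val := -ι₁ (coordDiv 1 2)
  inv := -ι₂ (coordDiv 2 1)
  val_inv := by rw [neg_mul_neg, yz_mul_zy]
  inv_val := by rw [neg_mul_neg, mul_comm, yz_mul_zy]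

/-- The transition matrix of the Quillen bundle. -/
def quillenMatrix : Matrix (Fin 2) (Fin 2) R₁₂ := !![(t : R₁₂), xz; 0, 1]

/-- The Quillen bundle, glued along the matrix with rows `(-y/z, x/z)` and `(0, 1)`. -/
def quillen : conic.Modules := clutch (U₁ := U₁) (U₂ := U₂) quillenMatrix

/-- The cotangent bundle of the conic over `ℝ`. -/
def Omega : conic.Modules := kaehler conicToSpec

/-! ### Canonical forms

A family of multiplicities is a finitely supported function `m : ℤ →₀ ℕ`; the value `m (2 * r)` is
the multiplicity of the `1 × 1` block `M_{2r}`, and `m (2 * s + 1)` that of the `2 × 2` block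
`M_{2s+1}`. -/

/-- The index type of the `1 × 1` blocks. -/
abbrev LineIdx (m : ℤ →₀ ℕ) : Type := Σ r : ℤ, Fin (m (2 * r))

/-- The index type of the `2 × 2` blocks. -/
abbrev QuillenIdx (m : ℤ →₀ ℕ) : Type := Σ s : ℤ, Fin (m (2 * s + 1))

lemma finite_sigma (m : ℤ →₀ ℕ) (g : ℤ → ℤ) (hg : Function.Injective g) :
    Finite (Σ r : ℤ, Fin (m (g r))) := by
  refine Finite.of_injective
    (β := Σ i : m.support, Fin (m i))
    (fun p => ⟨⟨g p.1, Finsupp.mem_support_iff.mpr fun h => (Fin.cast h p.2).elim0⟩, p.2⟩) ?_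
  rintro ⟨r, k⟩ ⟨r', k'⟩ h
  obtain rfl : r = r' := hg (congrArg (fun p => p.1.1) h)
  simpa using h

instance (m : ℤ →₀ ℕ) : Fintype (LineIdx m) :=
  @Fintype.ofFinite _ (finite_sigma m (fun r => 2 * r) fun a b h => by
    simp only at h; omega)

instance (m : ℤ →₀ ℕ) : Fintype (QuillenIdx m) :=
  @Fintype.ofFinite _ (finite_sigma m (fun s => 2 * s + 1) fun a b h => by
    simp only at h; omega)

/-- The index type of the rows and columns of the canonical matrix with multiplicities `m`. -/
abbrev MatIdx (m : ℤ →₀ ℕ) : Type := LineIdx m ⊕ Fin 2 × QuillenIdx m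

/-- The block `M_i` for `i = 2 r`: the `1 × 1` matrix `(-y/z)^r`. -/
def evenBlock (r : ℤ) : R₁₂ := ((t ^ r : R₁₂ˣ) : R₁₂)

/-- The block `M_i` for `i = 2 s + 1`, so that `(i + 1) / 2 = s + 1` and `(i - 1) / 2 = s`. -/
def oddBlock (s : ℤ) : Matrix (Fin 2) (Fin 2) R₁₂ :=
  !![((t ^ (s + 1) : R₁₂ˣ) : R₁₂), xz * ((t ^ s : R₁₂ˣ) : R₁₂); 0, ((t ^ s : R₁₂ˣ) : R₁₂)]

/-- The canonical matrix: the block sum, over all `i : ℤ`, of `m i` copies of `M_i`. -/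
def canonicalMatrix (m : ℤ →₀ ℕ) : Matrix (MatIdx m) (MatIdx m) R₁₂ :=
  Matrix.fromBlocks (Matrix.diagonal fun p => evenBlock p.1) 0 0
    (Matrix.blockDiagonal fun p => oddBlock p.1)

instance : HasFiniteBiproducts conic.Modules := Abelian.hasFiniteBiproducts

/-- The canonical bundle: the direct sum of `m (2 * r)` copies of `Ω^{⊗ r}`, for all `r : ℤ`, and
of `m (2 * s + 1)` copies of `Q ⊗ Ω^{⊗ s}`, for all `s : ℤ`. -/
def canonicalBundle (m : ℤ →₀ ℕ) : conic.Modules :=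
  (⨁ fun p : LineIdx m => tensorZPow Omega p.1) ⊞
    (⨁ fun p : QuillenIdx m => tensor quillen (tensorZPow Omega p.1))

/-- The matrices `M` and `D` over `R₁₂` are equivalent: `L M R = D`, up to a common enumeration of
the rows and columns of `D`, with `L ∈ GL_n(R₂)` and `R ∈ GL_n(R₁)`. -/
def ClutchEquiv {n : ℕ} {κ : Type} (M : Matrix (Fin n) (Fin n) R₁₂) (D : Matrix κ κ R₁₂) : Prop :=
  ∃ (e : Fin n ≃ κ) (L : GL (Fin n) R₂) (R : GL (Fin n) R₁),
    (L : Matrix (Fin n) (Fin n) R₂).map ι₂ * M * (R : Matrix (Fin n) (Fin n) R₁).map ι₁ =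
      D.submatrix e e

end AnisotropicConic

end

noncomputable section

namespace AnisotropicConic

/-! ### Local sections and frames -/

section Sections

variable {X : Scheme.{0}}

/-! The charts `U₁` and `U₂` have rings of functions of the form ℝ[a, b]/(a² + b² + 1). Such a ring
is a principal ideal domain: the quotient by a nonzero prime embeds in ℂ, the image point is not
real because a² + b² + 1 has no real zero, and the prime is generated by the real linear polynomial
vanishing at that point (`IsConicRing.exists_prime_eq_span`). Hence every bundle is trivial on both
charts (`exists_isFrame_of_isPrincipalIdealRing`) and is described by a transition matrix, unique up
to `TransEquiv`; conversely, bundles with the same transition matrix are isomorphic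
(`nonempty_iso_of_isTransitionMatrix`). The classification becomes a problem about matrices over
`R₁₂`.

With t = -y/z, the ring `R₁₂` is free over ℝ[t, t⁻¹] on 1 and x/z (`expand_bijective`). In this
expansion `R₁` has the exponents ≥ 0 in both components, and `R₂` has the exponents ≤ 0 in the first
and < 0 in the second. All cohomology needed is read off from this: R₁₂ = R₁ + tʳR₂ for r ≥ 0, while
for r = -1 the only obstruction is the coefficient of (x/z)t⁻¹ (`exists_split`).

Existence follows Grothendieck's argument on the projective line. Multiplication by t lowers
degrees; take the largest twist having a nonzero section (`exists_twist`). That section vanishes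
nowhere: at a zero it would be divisible by a linear form, which on `U₁` is t times a linear form on
`U₂`, and the quotient would be a section of the next twist (`span_eq_top_of_section`). Over
principal ideal domains it can be completed to frames, so the matrix becomes block triangular with
corner 1. By induction the complementary block is in normal form. The absence of sections in the
next twist bounds its exponents below by -1 and allows at most one line t⁻¹. The extension class
then clears away, except possibly along that line, where a nonzero class fuses 1 and t⁻¹ into the
indecomposable block `oddBlock (-1)` (`exists_transEquiv_of_not_hasSection`).

Uniqueness: there are no nonzero maps from a block to one of larger index
(`eq_zero_of_blockDeg_lt`), so an equivalence of normal forms is triangular with respect to the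
index, and counting ranks recovers the multiplicities.

Finally, Ω has transition matrix (t), computed from the frames a db - b da
(`isTransitionMatrix_Omega`), and tensor products and direct sums turn this into the canonical
matrices. An endomorphism of the Quillen bundle is a quaternion whose determinant is a sum of four
real squares (`eq_zero_of_det_eq_zero`); so there are no zero divisors among them and the bundle is
indecomposable. -/

lemma resM_resM (F : X.Modules) {U V W : X.Opens} (h : V ≤ U) (h' : W ≤ V) (s : Γ(F, U)) :
    resM F h' (resM F h s) = resM F (h'.trans h) s := by
  have : F.presheaf.map (homOfLE (h'.trans h)).op =
      F.presheaf.map (homOfLE h).op ≫ F.presheaf.map (homOfLE h').op := by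
    rw [← Functor.map_comp]; rfl
  simp only [resM, this]
  rfl

lemma resM_self (F : X.Modules) {U : X.Opens} (s : Γ(F, U)) : resM F le_rfl s = s := by
  have : F.presheaf.map (homOfLE (le_refl U)).op = 𝟙 _ := by
    rw [← F.presheaf.map_id]; rfl
  simp only [resM, this]
  rfl

lemma section_ext (F : X.Modules) {U : X.Opens} {s s' : Γ(F, U)}
    (H : ∀ x ∈ U, ∃ (V : X.Opens) (h : V ≤ U), x ∈ V ∧ resM F h s = resM F h s') : s = s' := by
  choose! V h hx hs using H
  let 𝓕 : TopCat.Sheaf Ab X := ⟨F.presheaf, F.isSheaf⟩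
  refine 𝓕.eq_of_locally_eq' (fun x : U => V x.1) U (fun x => homOfLE (h x.1 x.2)) ?_ s s' ?_
  · intro x hxU
    exact Opens.mem_iSup.mpr ⟨⟨x, hxU⟩, hx x hxU⟩
  · intro x
    exact hs x.1 x.2

/-- Sections which exist locally and are characterised by a local property glue. -/
lemma exists_section_of_local (F : X.Modules) {U : X.Opens}
    (P : ∀ V : X.Opens, Γ(F, V) → Prop)
    (hres : ∀ {V W : X.Opens} (h : W ≤ V), V ≤ U → ∀ s, P V s → P W (resM F h s))
    (huniq : ∀ V ≤ U, ∀ s s', P V s → P V s' → s = s')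
    (hex : ∀ x ∈ U, ∃ V ≤ U, x ∈ V ∧ ∃ s, P V s) :
    ∃ s : Γ(F, U), ∀ x ∈ U, ∃ (V : X.Opens) (h : V ≤ U), x ∈ V ∧ P V (resM F h s) := by
  choose! V h hx hs using hex
  let 𝓕 : TopCat.Sheaf Ab X := ⟨F.presheaf, F.isSheaf⟩
  choose sf hsf using fun x : U => hs x.1 x.2
  obtain ⟨s, hs, -⟩ := 𝓕.existsUnique_gluing' (fun x : U => V x.1) U
    (fun x => homOfLE (h x.1 x.2)) (fun x hxU => Opens.mem_iSup.mpr ⟨⟨x, hxU⟩, hx x hxU⟩) sf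
    (fun x y => huniq (V x.1 ⊓ V y.1) (inf_le_left.trans (h x.1 x.2)) _ _
      (hres inf_le_left (h x.1 x.2) _ (hsf x)) (hres inf_le_right (h y.1 y.2) _ (hsf y)))
  refine ⟨s, fun x hxU => ⟨V x, h x hxU, hx x hxU, ?_⟩⟩
  have := hs ⟨x, hxU⟩
  change resM F (h x hxU) s = _ at this
  rw [this]
  exact hsf ⟨x, hxU⟩

lemma function_ext {U : X.Opens} {s s' : Γ(X, U)}
    (H : ∀ x ∈ U, ∃ (V : X.Opens) (h : V ≤ U), x ∈ V ∧ res h s = res h s') : s = s' :=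
  section_ext (structureSheaf X) (s := s) (s' := s') H

lemma exists_function_of_local {U : X.Opens} (P : ∀ V : X.Opens, Γ(X, V) → Prop)
    (hres : ∀ {V W : X.Opens} (h : W ≤ V), V ≤ U → ∀ s, P V s → P W (res h s))
    (huniq : ∀ V ≤ U, ∀ s s', P V s → P V s' → s = s')
    (hex : ∀ x ∈ U, ∃ V ≤ U, x ∈ V ∧ ∃ s, P V s) :
    ∃ s : Γ(X, U), ∀ x ∈ U, ∃ (V : X.Opens) (h : V ≤ U), x ∈ V ∧ P V (res h s) :=
  exists_section_of_local (structureSheaf X) P hres huniq hex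

end Sections

section Frames

variable {X : Scheme.{0}} {κ : Type} [Fintype κ] {F : X.Modules} {U : X.Opens}

lemma resM_sum_smul {κ : Type} [Fintype κ] (F : X.Modules) {W V : X.Opens} (hV : V ≤ W)
    (f : κ → Γ(X, W)) (v : κ → Γ(F, W)) :
    resM F hV (∑ k, f k • v k) = ∑ k, res hV (f k) • resM F hV (v k) := by
  simp [map_sum, resM_smul]

lemma IsFrame.mono {v : κ → Γ(F, U)} (hv : IsFrame F U v) {V : X.Opens} (h : V ≤ U) :
    IsFrame F V fun k => resM F h (v k) := by
  intro W hW
  simp only [resM_resM]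
  exact hv W (hW.trans h)

/-- Injectivity over every smaller open makes local coefficients unique, so they agree on overlaps
and glue to global ones, one index at a time. -/
lemma isFrame_of_injective_of_locally_surjective {v : κ → Γ(F, U)}
    (inj : ∀ (W : X.Opens) (h : W ≤ U),
      Function.Injective fun f : κ → Γ(X, W) => ∑ k, f k • resM F h (v k))
    (surj : ∀ (W : X.Opens) (h : W ≤ U) (s : Γ(F, W)), ∀ x ∈ W, ∃ (V : X.Opens) (hV : V ≤ W),
      x ∈ V ∧ ∃ f : κ → Γ(X, V), ∑ k, f k • resM F (hV.trans h) (v k) = resM F hV s) :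
    IsFrame F U v := by
  intro W hW
  refine ⟨inj W hW, fun s => ?_⟩
  have key : ∀ k, ∃ c : Γ(X, W), ∀ x ∈ W, ∃ (V : X.Opens) (h : V ≤ W), x ∈ V ∧
      ∃ f : κ → Γ(X, V), ∑ k, f k • resM F (h.trans hW) (v k) = resM F h s ∧ f k = res h c := by
    intro k
    have := exists_function_of_local (U := W) (fun V c => ∃ (h : V ≤ W) (f : κ → Γ(X, V)),
      ∑ k, f k • resM F (h.trans hW) (v k) = resM F h s ∧ f k = c) ?_ ?_ ?_
    · obtain ⟨c, hc⟩ := this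
      refine ⟨c, fun x hx => ?_⟩
      obtain ⟨V, h, hxV, _, hf⟩ := hc x hx
      exact ⟨V, h, hxV, hf⟩
    · rintro V V' h - c ⟨hV, f, hf, rfl⟩
      refine ⟨h.trans hV, fun k => res h (f k), ?_, rfl⟩
      have := congrArg (resM F h) hf
      simpa only [resM_sum_smul, resM_resM] using this
    · rintro V hV c c' ⟨h, f, hf, rfl⟩ ⟨h', f', hf', rfl⟩
      rw [inj V (h.trans hW) (hf.trans hf'.symm)]
    · intro x hx
      obtain ⟨V, hV, hxV, f, hf⟩ := surj W hW s x hx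
      exact ⟨V, hV, hxV, f k, hV, f, hf, rfl⟩
  choose c hc using key
  refine ⟨c, section_ext F fun x hx => ?_⟩
  choose V h hxV f hf hfc using fun k => hc k x hx
  obtain ⟨W', hW', hxW', g, hg⟩ := surj W hW s x hx
  -- The coefficients were glued separately for each index, so the neighbourhoods depend on `k`;
  -- finiteness of the index type gives a common one.
  let V' : X.Opens := W' ⊓ Finset.univ.inf V
  have hV' : ∀ k, V' ≤ V k := fun k => inf_le_right.trans (Finset.inf_le (Finset.mem_univ k))
  have hVW : V' ≤ W' := inf_le_left
  have hx' : x ∈ V' := by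
    refine ⟨hxW', ?_⟩
    rw [SetLike.mem_coe, ← SetLike.mem_coe, Opens.coe_finset_inf]
    simpa using hxV
  have hg' := congrArg (resM F hVW) hg
  simp only [resM_sum_smul, resM_resM] at hg'
  refine ⟨V', hVW.trans hW', hx', ?_⟩
  rw [← hg']
  simp only [resM_sum_smul, resM_resM]
  refine Finset.sum_congr rfl fun k _ => ?_
  have h1 : (fun j => res (hV' k) (f k j)) = fun j => res hVW (g j) := by
    refine inj V' (hVW.trans (hW'.trans hW)) ?_
    have := congrArg (resM F (hV' k)) (hf k)
    simp only [resM_sum_smul, resM_resM] at this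
    exact this.trans hg'.symm
  have h2 := congrFun h1 k
  simp only [hfc k, res_res] at h2
  rw [h2]

/-- Being a frame is a local property. -/
lemma isFrame_of_local {v : κ → Γ(F, U)}
    (H : ∀ x ∈ U, ∃ (V : X.Opens) (h : V ≤ U), x ∈ V ∧ IsFrame F V fun k => resM F h (v k)) :
    IsFrame F U v := by
  refine isFrame_of_injective_of_locally_surjective ?_ ?_
  · intro W hW f f' hf
    funext k
    refine function_ext fun x hx => ?_
    obtain ⟨V, hV, hxV, hfr⟩ := H x (hW hx)
    refine ⟨W ⊓ V, inf_le_left, ⟨hx, hxV⟩, ?_⟩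
    have h2 := (hfr (W ⊓ V) inf_le_right).1
    have h3 := congrArg (resM F (inf_le_left : W ⊓ V ≤ W)) hf
    simp only [resM_sum_smul, resM_resM] at h3 h2
    exact congrFun (h2 (a₁ := fun k => res inf_le_left (f k))
      (a₂ := fun k => res inf_le_left (f' k)) h3) k
  · intro W hW s x hx
    obtain ⟨V, hV, hxV, hfr⟩ := H x (hW hx)
    obtain ⟨f, hf⟩ := (hfr (W ⊓ V) inf_le_right).2 (resM F inf_le_left s)
    simp only [resM_resM] at hf
    exact ⟨W ⊓ V, inf_le_left, ⟨hx, hxV⟩, f, hf⟩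

end Frames

/-! ### Frames of associated sheaves -/

section Sheafify

variable {X : Scheme.{0}}

/-- The sections over `U` of a presheaf of modules. -/
def PSec (P : X.PresheafOfModules) (U : X.Opens) : Type := P.obj (op U)

instance (P : X.PresheafOfModules) (U : X.Opens) : AddCommGroup (PSec P U) :=
  (P.obj (op U)).isAddCommGroup

instance (P : X.PresheafOfModules) (U : X.Opens) : Module Γ(X, U) (PSec P U) :=
  (P.obj (op U)).isModule

/-- Restriction of sections of a presheaf of modules. -/
def resP (P : X.PresheafOfModules) {U V : X.Opens} (h : V ≤ U) : PSec P U →+ PSec P V :=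
  (P.presheaf.map (homOfLE h).op).hom

/-- The image in the associated sheaf of a section of a presheaf of modules. -/
def toShf (P : X.PresheafOfModules) (U : X.Opens) : PSec P U →+ Γ(sheafify P, U) :=
  ((CategoryTheory.toSheafify (Opens.grothendieckTopology X) P.presheaf).app (op U)).hom

/-- Sheafification of modules has the same underlying map as sheafification of abelian groups, so
linearity is inherited from the unit of the module adjunction. -/
lemma toShf_smul (P : X.PresheafOfModules) (U : X.Opens) (r : Γ(X, U)) (s : PSec P U) :
    toShf P U (r • s) = r • toShf P U s :=
  (((PresheafOfModules.sheafificationAdjunction (𝟙 X.ringCatSheaf.obj)).unit.app P).app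
    (op U)).hom.map_smul (r : X.ringCatSheaf.obj.obj (op U)) (s : P.obj (op U))

lemma resM_toShf (P : X.PresheafOfModules) {U V : X.Opens} (h : V ≤ U) (s : PSec P U) :
    resM (sheafify P) h (toShf P U s) = toShf P V (resP P h s) := by
  exact (NatTrans.naturality_apply (CategoryTheory.toSheafify (Opens.grothendieckTopology X) P.presheaf) (homOfLE h).op s).symm

lemma toShf_locally_injective (P : X.PresheafOfModules) {U : X.Opens} (s : PSec P U)
    (hs : toShf P U s = 0) (x : X) (hx : x ∈ U) :
    ∃ (V : X.Opens) (h : V ≤ U), x ∈ V ∧ resP P h s = 0 := by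
  have := Presheaf.equalizerSieve_mem (Opens.grothendieckTopology X)
    (CategoryTheory.toSheafify (Opens.grothendieckTopology X) P.presheaf) (X := op U) s 0
    (hs.trans (map_zero _).symm)
  obtain ⟨V, f, hf, hx⟩ := this x hx
  refine ⟨V, f.le, hx, ?_⟩
  exact hf.trans (map_zero _)

lemma toShf_locally_surjective (P : X.PresheafOfModules) {U : X.Opens} (s : Γ(sheafify P, U))
    (x : X) (hx : x ∈ U) :
    ∃ (V : X.Opens) (h : V ≤ U), x ∈ V ∧ ∃ s', toShf P V s' = resM (sheafify P) h s := by
  have := Presheaf.imageSieve_mem (Opens.grothendieckTopology X)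
    (CategoryTheory.toSheafify (Opens.grothendieckTopology X) P.presheaf) (U := op U) s
  obtain ⟨V, f, ⟨s', hf⟩, hx⟩ := this x hx
  exact ⟨V, f.le, hx, s', hf⟩

lemma resP_smul (P : X.PresheafOfModules) {U V : X.Opens} (h : V ≤ U) (r : Γ(X, U))
    (s : PSec P U) : resP P h (r • s) = res h r • resP P h s :=
  P.map_smul (homOfLE h).op r s

lemma resP_resP (P : X.PresheafOfModules) {U V W : X.Opens} (h : V ≤ U) (h' : W ≤ V)
    (s : PSec P U) : resP P h' (resP P h s) = resP P (h'.trans h) s := by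
  have : P.presheaf.map (homOfLE (h'.trans h)).op =
      P.presheaf.map (homOfLE h).op ≫ P.presheaf.map (homOfLE h').op := by
    rw [← Functor.map_comp]; rfl
  simp only [resP, this]
  rfl

lemma resP_sum_smul (P : X.PresheafOfModules) {κ : Type} [Fintype κ] {W V : X.Opens} (hV : V ≤ W)
    (f : κ → Γ(X, W)) (v : κ → PSec P W) :
    resP P hV (∑ k, f k • v k) = ∑ k, res hV (f k) • resP P hV (v k) := by
  rw [map_sum]
  exact Finset.sum_congr rfl fun k _ => resP_smul P hV _ _

lemma toShf_sum_smul (P : X.PresheafOfModules) {κ : Type} [Fintype κ] {W : X.Opens}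
    (f : κ → Γ(X, W)) (v : κ → PSec P W) :
    toShf P W (∑ k, f k • v k) = ∑ k, f k • toShf P W (v k) := by
  rw [map_sum]
  exact Finset.sum_congr rfl fun k _ => toShf_smul P W _ _

/-- If a presheaf of modules is free on `v` over a basis of opens, then `v` is a frame of the
associated sheaf. -/
lemma isFrame_sheafify (P : X.PresheafOfModules) {κ : Type} [Fintype κ] {U : X.Opens}
    (v : κ → PSec P U)
    (H : ∀ W ≤ U, ∀ x ∈ W, ∃ (V : X.Opens) (_ : V ≤ W) (h : V ≤ U), x ∈ V ∧
      Function.Bijective fun f : κ → Γ(X, V) => ∑ k, f k • resP P h (v k)) :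
    IsFrame (sheafify P) U fun k => toShf P U (v k) := by
  refine isFrame_of_injective_of_locally_surjective ?_ ?_
  · intro W hW f f' hf
    funext k
    refine function_ext fun x hx => ?_
    simp only [resM_toShf, ← toShf_sum_smul] at hf
    obtain ⟨V, hV, hxV, hs⟩ := toShf_locally_injective P
      (∑ k, f k • resP P hW (v k) - ∑ k, f' k • resP P hW (v k))
      (by rw [map_sub, hf, sub_self]) x hx
    obtain ⟨V', hV', hVU, hxV', hbij⟩ := H V (hV.trans hW) x hxV
    refine ⟨V', hV'.trans hV, hxV', ?_⟩
    have := congrArg (resP P hV') hs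
    simp only [resP_resP, map_sub, resP_sum_smul, map_zero, sub_eq_zero, res_res] at this
    exact congrFun (hbij.1 (a₁ := fun k => res (hV'.trans hV) (f k))
      (a₂ := fun k => res (hV'.trans hV) (f' k)) this) k
  · intro W hW s x hx
    obtain ⟨V, hV, hxV, s', hs'⟩ := toShf_locally_surjective P s x hx
    obtain ⟨V', hV', hVU, hxV', hbij⟩ := H V (hV.trans hW) x hxV
    obtain ⟨f, hf⟩ := hbij.2 (resP P hV' s')
    refine ⟨V', hV'.trans hV, hxV', f, ?_⟩
    simp only [resM_toShf, ← toShf_sum_smul]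
    have := congrArg (toShf P V') hf
    rw [← resM_toShf, hs', resM_resM] at this
    exact this

/-- If a presheaf of modules is free on `v`, then `v` is a frame of the associated sheaf. -/
lemma isFrame_sheafify_of_bijective (P : X.PresheafOfModules) {κ : Type} [Fintype κ] {U : X.Opens}
    (v : κ → PSec P U)
    (H : ∀ (V : X.Opens) (h : V ≤ U),
      Function.Bijective fun f : κ → Γ(X, V) => ∑ k, f k • resP P h (v k)) :
    IsFrame (sheafify P) U fun k => toShf P U (v k) :=
  isFrame_sheafify P v fun W hW _ hx => ⟨W, le_rfl, hW, hx, H W hW⟩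

end Sheafify

/-! ### Tensor products -/

section Algebra

variable {R : Type*} [CommRing R] {κ κ' : Type*} [Fintype κ] [Fintype κ']
  {M N : Type*} [AddCommGroup M] [Module R M] [AddCommGroup N] [Module R N]

/-- Translates the condition in `IsFrame` into bases, so that the basis of a tensor product becomes
available. -/
lemma bijective_sum_smul_iff {v : κ → M} :
    (Function.Bijective fun f : κ → R => ∑ k, f k • v k) ↔
      ∃ b : Module.Basis κ R M, ∀ k, b k = v k := by
  classical
  constructor
  · intro h
    have h' : Function.Bijective (Fintype.linearCombination R v) := h
    refine ⟨Module.Basis.ofEquivFun (LinearEquiv.ofBijective _ h').symm, fun k => ?_⟩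
    simp [Fintype.linearCombination_apply]
  · rintro ⟨b, hb⟩
    obtain rfl : (fun k => b k) = v := funext hb
    have : (fun f : κ → R => ∑ k, f k • b k) = b.equivFun.symm := by
      funext f
      simp [Module.Basis.equivFun_symm_apply]
    rw [this]
    exact b.equivFun.symm.bijective

open TensorProduct in
lemma bijective_sum_smul_tmul {v : κ → M} {w : κ' → N}
    (hv : Function.Bijective fun f : κ → R => ∑ k, f k • v k)
    (hw : Function.Bijective fun f : κ' → R => ∑ k, f k • w k) :
    Function.Bijective fun f : κ × κ' → R => ∑ k, f k • (v k.1 ⊗ₜ[R] w k.2) := by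
  obtain ⟨b, hb⟩ := bijective_sum_smul_iff.1 hv
  obtain ⟨c, hc⟩ := bijective_sum_smul_iff.1 hw
  refine bijective_sum_smul_iff.2 ⟨b.tensorProduct c, fun k => ?_⟩
  rw [Module.Basis.tensorProduct_apply, hb, hc]

end Algebra

section Tensor

variable {X : Scheme.{0}} {κ κ' : Type} [Fintype κ] [Fintype κ'] {U : X.Opens}

/-- The tensor product of the presheaves of modules underlying `F` and `G`. -/
def tensorPresheaf (F G : X.Modules) : X.PresheafOfModules :=
  PresheafOfModules.Monoidal.tensorObj (R := X.presheaf) F.val G.val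

/-- The section `s ⊗ s'` of a tensor product, before sheafification. -/
def tmulP (F G : X.Modules) (U : X.Opens) (s : Γ(F, U)) (s' : Γ(G, U)) :
    PSec (tensorPresheaf F G) U :=
  TensorProduct.tmul Γ(X, U) s s'

lemma resP_tmulP (F G : X.Modules) {U V : X.Opens} (h : V ≤ U) (s : Γ(F, U)) (s' : Γ(G, U)) :
    resP (tensorPresheaf F G) h (tmulP F G U s s') = tmulP F G V (resM F h s) (resM G h s') := rfl

def tmul (F G : X.Modules) (U : X.Opens) (s : Γ(F, U)) (s' : Γ(G, U)) : Γ(tensor F G, U) :=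
  toShf (tensorPresheaf F G) U (tmulP F G U s s')

lemma bijective_tmulP {F G : X.Modules} {v : κ → Γ(F, U)} {w : κ' → Γ(G, U)}
    (hv : Function.Bijective fun f : κ → Γ(X, U) => ∑ k, f k • v k)
    (hw : Function.Bijective fun f : κ' → Γ(X, U) => ∑ k, f k • w k) :
    Function.Bijective fun f : κ × κ' → Γ(X, U) =>
      ∑ k, f k • tmulP F G U (v k.1) (w k.2) :=
  bijective_sum_smul_tmul hv hw

lemma bijective_resP_tmulP {F G : X.Modules} {v : κ → Γ(F, U)} {w : κ' → Γ(G, U)}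
    {V : X.Opens} (h : V ≤ U)
    (hv : Function.Bijective fun f : κ → Γ(X, V) => ∑ k, f k • resM F h (v k))
    (hw : Function.Bijective fun f : κ' → Γ(X, V) => ∑ k, f k • resM G h (w k)) :
    Function.Bijective fun f : κ × κ' → Γ(X, V) =>
      ∑ k, f k • resP (tensorPresheaf F G) h (tmulP F G U (v k.1) (w k.2)) := by
  have e : (fun f : κ × κ' → Γ(X, V) => ∑ k, f k •
      resP (tensorPresheaf F G) h (tmulP F G U (v k.1) (w k.2))) =
      fun f => ∑ k, f k • tmulP F G V (resM F h (v k.1)) (resM G h (w k.2)) :=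
    funext fun f => Finset.sum_congr rfl fun k _ =>
      congrArg (f k • ·) (resP_tmulP F G h (v k.1) (w k.2))
  rw [e]
  exact bijective_tmulP (v := fun k => resM F h (v k)) (w := fun k => resM G h (w k)) hv hw

lemma isFrame_toShf_tmulP {F G : X.Modules} {v : κ → Γ(F, U)} {w : κ' → Γ(G, U)}
    (hv : IsFrame F U v) (hw : IsFrame G U w) : IsFrame (sheafify (tensorPresheaf F G)) U
      fun k : κ × κ' => toShf _ U (tmulP F G U (v k.1) (w k.2)) :=
  isFrame_sheafify_of_bijective (tensorPresheaf F G)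
    (fun k : κ × κ' => tmulP F G U (v k.1) (w k.2))
    fun V h => bijective_resP_tmulP h (hv V h) (hw V h)

lemma isFrame_tmul {F G : X.Modules} {v : κ → Γ(F, U)} {w : κ' → Γ(G, U)} (hv : IsFrame F U v)
    (hw : IsFrame G U w) : IsFrame (tensor F G) U fun k : κ × κ' => tmul F G U (v k.1) (w k.2) :=
  isFrame_toShf_tmulP hv hw

lemma resM_tmul (F G : X.Modules) {U V : X.Opens} (h : V ≤ U) (s : Γ(F, U)) (s' : Γ(G, U)) :
    resM (tensor F G) h (tmul F G U s s') = tmul F G V (resM F h s) (resM G h s') :=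
  resM_toShf (tensorPresheaf F G) h (tmulP F G U s s')

open TensorProduct in
lemma tmulP_sum_smul (F G : X.Modules) (a : κ → Γ(X, U)) (s : κ → Γ(F, U))
    (b : κ' → Γ(X, U)) (s' : κ' → Γ(G, U)) :
    tmulP F G U (∑ k, a k • s k) (∑ k, b k • s' k) =
      ∑ k : κ × κ', (a k.1 * b k.2) • tmulP F G U (s k.1) (s' k.2) := by
  have h1 : (∑ k, a k • s k) ⊗ₜ[Γ(X, U)] (∑ k, b k • s' k) =
      ∑ k : κ × κ', (a k.1 * b k.2) • (s k.1 ⊗ₜ[Γ(X, U)] s' k.2) := by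
    rw [TensorProduct.sum_tmul, Fintype.sum_prod_type]
    simp only [TensorProduct.tmul_sum, TensorProduct.smul_tmul_smul]
  exact h1

lemma tmul_sum_smul (F G : X.Modules) (a : κ → Γ(X, U)) (s : κ → Γ(F, U))
    (b : κ' → Γ(X, U)) (s' : κ' → Γ(G, U)) :
    tmul F G U (∑ k, a k • s k) (∑ k, b k • s' k) =
      ∑ k : κ × κ', (a k.1 * b k.2) • tmul F G U (s k.1) (s' k.2) := by
  have := congrArg (toShf (tensorPresheaf F G) U) (tmulP_sum_smul F G a s b s')
  rw [toShf_sum_smul] at this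
  exact this

variable {U₁ U₂ : X.Opens}

lemma isTransitionMatrix_tensor {F G : X.Modules} {M : Matrix κ κ Γ(X, U₁ ⊓ U₂)}
    {N : Matrix κ' κ' Γ(X, U₁ ⊓ U₂)} (hF : IsTransitionMatrix U₁ U₂ F M)
    (hG : IsTransitionMatrix U₁ U₂ G N) :
    IsTransitionMatrix U₁ U₂ (tensor F G) (Matrix.kroneckerMap (· * ·) M N) := by
  obtain ⟨v, w, hv, hw, h⟩ := hF
  obtain ⟨v', w', hv', hw', h'⟩ := hG
  refine ⟨_, _, isFrame_tmul hv hv', isFrame_tmul hw hw', fun j => ?_⟩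
  rw [resM_tmul, h, h', tmul_sum_smul]
  simp only [resM_tmul]
  rfl

end Tensor

/-! ### The structure sheaf. -/

section Dual

variable {X : Scheme.{0}} {κ : Type} [Fintype κ] {U : X.Opens}

lemma isFrame_structureSheaf (U : X.Opens) :
    IsFrame (structureSheaf X) U fun _ : Unit => (1 : Γ(X, U)) := by
  intro V h
  have : (fun f : Unit → Γ(X, V) => ∑ k, f k • resM (structureSheaf X) h (1 : Γ(X, U))) =
      fun f => f () := by
    funext f
    rw [Finset.univ_unique, Finset.sum_singleton]
    change f () * res h 1 = f ()
    rw [map_one, mul_one]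
  rw [this]
  exact (Equiv.funUnique Unit Γ(X, V)).bijective

lemma isTransitionMatrix_structureSheaf (U₁ U₂ : X.Opens) :
    IsTransitionMatrix U₁ U₂ (structureSheaf X) (1 : Matrix Unit Unit Γ(X, U₁ ⊓ U₂)) := by
  refine ⟨_, _, isFrame_structureSheaf U₁, isFrame_structureSheaf U₂, fun j => ?_⟩
  rw [Finset.univ_unique, Finset.sum_singleton]
  change res _ 1 = (1 : Matrix Unit Unit Γ(X, U₁ ⊓ U₂)) _ _ * res _ 1
  rw [map_one, map_one]
  exact ((mul_one _).trans (Matrix.one_apply_eq j)).symm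

end Dual

/-! ### Duals -/

section Coordinates

variable {X : Scheme.{0}} {κ : Type} [Fintype κ] {F : X.Modules} {U : X.Opens} {v : κ → Γ(F, U)}

/-- Coordinates with respect to a frame. -/
def IsFrame.coords (hv : IsFrame F U v) (W : X.Opens) (h : W ≤ U) :
    Γ(F, W) ≃ₗ[Γ(X, W)] (κ → Γ(X, W)) :=
  (LinearEquiv.ofBijective (Fintype.linearCombination Γ(X, W) fun k => resM F h (v k))
    (hv W h)).symm

lemma IsFrame.sum_coords (hv : IsFrame F U v) {W : X.Opens} (h : W ≤ U) (s : Γ(F, W)) :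
    ∑ k, hv.coords W h s k • resM F h (v k) = s :=
  LinearEquiv.apply_symm_apply (LinearEquiv.ofBijective
    (Fintype.linearCombination Γ(X, W) fun k => resM F h (v k)) (hv W h)) s

lemma IsFrame.coords_sum (hv : IsFrame F U v) {W : X.Opens} (h : W ≤ U) (f : κ → Γ(X, W)) :
    hv.coords W h (∑ k, f k • resM F h (v k)) = f :=
  LinearEquiv.symm_apply_apply (LinearEquiv.ofBijective
    (Fintype.linearCombination Γ(X, W) fun k => resM F h (v k)) (hv W h)) f

lemma IsFrame.coords_eq_iff (hv : IsFrame F U v) {W : X.Opens} (h : W ≤ U) (s : Γ(F, W))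
    (f : κ → Γ(X, W)) : hv.coords W h s = f ↔ s = ∑ k, f k • resM F h (v k) := by
  constructor
  · rintro rfl
    exact (hv.sum_coords h s).symm
  · rintro rfl
    exact hv.coords_sum h f

lemma IsFrame.res_coords (hv : IsFrame F U v) {W W' : X.Opens} (h : W ≤ U) (h' : W' ≤ W)
    (s : Γ(F, W)) (k : κ) :
    res h' (hv.coords W h s k) = hv.coords W' (h'.trans h) (resM F h' s) k := by
  have := (hv.coords_eq_iff (h'.trans h) (resM F h' s) fun k => res h' (hv.coords W h s k)).2 ?_
  · rw [this]
  · conv_lhs => rw [← hv.sum_coords h s]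
    simp only [resM_sum_smul, resM_resM]

lemma IsFrame.coords_self [DecidableEq κ] (hv : IsFrame F U v) {W : X.Opens} (h : W ≤ U) (k : κ) :
    hv.coords W h (resM F h (v k)) = Pi.single k 1 := by
  rw [hv.coords_eq_iff]
  rw [Finset.sum_eq_single k]
  · rw [Pi.single_eq_same, one_smul]
  · intro l _ hl
    rw [Pi.single_eq_of_ne hl, zero_smul]
  · simp

end Coordinates

section Dual

variable {X : Scheme.{0}} {κ : Type} [Fintype κ] {F : X.Modules} {U : X.Opens} {v : κ → Γ(F, U)}

lemma dual_ext {φ ψ : dualSections F U} (hv : IsFrame F U v)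
    (h : ∀ (W : X.Opens) (hW : W ≤ U) (k : κ),
      φ.1 ⟨W, hW⟩ (resM F hW (v k)) = ψ.1 ⟨W, hW⟩ (resM F hW (v k))) : φ = ψ := by
  refine Subtype.ext (funext fun W => LinearMap.ext fun s => ?_)
  rw [← hv.sum_coords W.2 s]
  simp only [map_sum, map_smul]
  exact Finset.sum_congr rfl fun k _ => congrArg _ (h W.1 W.2 k)

/-- The elements of the dual frame. -/
def IsFrame.dualSection (hv : IsFrame F U v) (k : κ) : dualSections F U :=
  ⟨fun W => LinearMap.proj k ∘ₗ (hv.coords W.1 W.2).toLinearMap, fun W _ h s =>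
    hv.res_coords W.2 h s k⟩

lemma IsFrame.dualSection_apply (hv : IsFrame F U v) (k : κ) (W : {W : X.Opens // W ≤ U})
    (s : Γ(F, W.1)) : (hv.dualSection k).1 W s = hv.coords W.1 W.2 s k := rfl

lemma dual_sum_val {κ : Type} [Fintype κ] (f : κ → Γ(X, U)) (φ : κ → dualSections F U)
    (W : {W : X.Opens // W ≤ U}) (s : Γ(F, W.1)) :
    (∑ k, f k • φ k).1 W s = ∑ k, res W.2 (f k) * (φ k).1 W s := by
  rw [AddSubgroup.val_finsetSum, Finset.sum_apply, LinearMap.sum_apply]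
  rfl

/-- The coefficients of a functional in the dual frame are its values on the frame; its values over
smaller opens follow by compatibility with restriction. -/
lemma IsFrame.bijective_dual (hv : IsFrame F U v) {V : X.Opens} (h : V ≤ U) :
    Function.Bijective fun f : κ → Γ(X, V) => ∑ k, f k • dualRes F h (hv.dualSection k) := by
  classical
  have key : ∀ (f : κ → Γ(X, V)) (W : X.Opens) (hW : W ≤ V) (l : κ),
      (∑ k, f k • dualRes F h (hv.dualSection k)).1 ⟨W, hW⟩ (resM F (hW.trans h) (v l)) =
        res hW (f l) := by
    intro f W hW l
    rw [dual_sum_val, Finset.sum_eq_single l]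
    · change _ * (hv.dualSection l).1 ⟨W, hW.trans h⟩ _ = _
      rw [hv.dualSection_apply, hv.coords_self, Pi.single_eq_same, mul_one]
    · intro k _ hk
      change _ * (hv.dualSection k).1 ⟨W, hW.trans h⟩ _ = _
      rw [hv.dualSection_apply, hv.coords_self, Pi.single_eq_of_ne hk, mul_zero]
    · simp
  constructor
  · intro f f' hf
    funext l
    have h1 := key f V le_rfl l
    have h2 := key f' V le_rfl l
    change ∑ k, f k • dualRes F h (hv.dualSection k) = ∑ k, f' k • dualRes F h (hv.dualSection k) at hf
    rw [hf, h2, res_self, res_self] at h1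
    exact h1.symm
  · intro φ
    refine ⟨fun k => φ.1 ⟨V, le_rfl⟩ (resM F h (v k)), ?_⟩
    refine dual_ext (hv.mono h) fun W hW k => ?_
    rw [resM_resM]
    refine (key _ W hW k).trans ?_
    rw [φ.2 ⟨V, le_rfl⟩ ⟨W, hW⟩ hW, resM_resM]

/-- A morphism `F|_U ⟶ 𝒪_U` as a section of the dual, before sheafification. -/
def dualP (F : X.Modules) (U : X.Opens) : dualSections F U →+ PSec (dualPresheaf F) U :=
  AddMonoidHom.id _

lemma dualP_smul (r : Γ(X, U)) (φ : dualSections F U) : dualP F U (r • φ) = r • dualP F U φ := rfl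

/-- A morphism `F|_U ⟶ 𝒪_U` as a section of the dual. -/
def dualS (F : X.Modules) (U : X.Opens) (φ : dualSections F U) : Γ(dual F, U) :=
  toShf (dualPresheaf F) U (dualP F U φ)

lemma IsFrame.dual (hv : IsFrame F U v) :
    IsFrame (dual F) U fun k => dualS F U (hv.dualSection k) := by
  refine isFrame_sheafify_of_bijective (dualPresheaf F)
    (fun k => dualP F U (hv.dualSection k)) fun V h => ?_
  exact hv.bijective_dual h

lemma resM_dualS {V : X.Opens} (h : V ≤ U) (φ : dualSections F U) :
    resM (AnisotropicConic.dual F) h (dualS F U φ) = dualS F V (dualRes F h φ) :=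
  resM_toShf (dualPresheaf F) h (dualP F U φ)

lemma dualS_sum_smul (f : κ → Γ(X, U)) (φ : κ → dualSections F U) :
    dualS F U (∑ k, f k • φ k) = ∑ k, f k • dualS F U (φ k) := by
  have := toShf_sum_smul (dualPresheaf F) f fun k => dualP F U (φ k)
  simp only [← dualP_smul, ← map_sum] at this
  exact this

/-- Evaluating both sides on the frame `v`, rewritten in terms of `w`, turns the claim into the
entries of `N * M = 1`. -/
lemma isTransitionMatrix_dual [DecidableEq κ] {U₁ U₂ : X.Opens}
    {M N : Matrix κ κ Γ(X, U₁ ⊓ U₂)}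
    (hF : IsTransitionMatrix U₁ U₂ F M) (hN : N * M = 1) :
    IsTransitionMatrix U₁ U₂ (dual F) N.transpose := by
  obtain ⟨v, w, hv, hw, h⟩ := hF
  refine ⟨_, _, hv.dual, hw.dual, fun j => ?_⟩
  simp only [resM_dualS, ← dualS_sum_smul]
  congr 1
  refine dual_ext (hv.mono inf_le_left) fun W hW k => ?_
  rw [resM_resM, dual_sum_val]
  change hv.coords W _ _ j = ∑ i, _ * hw.coords W (hW.trans inf_le_right) _ i
  rw [hv.coords_self]
  have h1 : resM F (hW.trans inf_le_left) (v k) =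
      ∑ i, res hW (M i k) • resM F (hW.trans inf_le_right) (w i) := by
    have := congrArg (resM F hW) (h k)
    simpa only [resM_sum_smul, resM_resM] using this
  rw [h1, hw.coords_sum]
  have h2 := congrArg (res hW) (congrFun (congrFun hN j) k)
  rw [Matrix.mul_apply, map_sum] at h2
  simp only [map_mul] at h2
  refine Eq.trans ?_ h2.symm
  rw [Matrix.one_apply, Pi.single_apply, apply_ite (res hW), map_one, map_zero]

end Dual

/-! ### Morphisms and biproducts -/

section Morphisms

variable {X : Scheme.{0}} {κ κ' : Type} [Fintype κ] [Fintype κ'] {F G : X.Modules}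
  {U U₁ U₂ : X.Opens}

/-- The action of a morphism on sections, as a linear map. -/
def appL (φ : F ⟶ G) (U : X.Opens) : Γ(F, U) →ₗ[Γ(X, U)] Γ(G, U) where
  toFun s := φ.app U s
  map_add' := map_add (φ.app U).hom
  map_smul' r s := φ.app_smul r s

lemma appL_resM (φ : F ⟶ G) {U V : X.Opens} (h : V ≤ U) (s : Γ(F, U)) :
    appL φ V (resM F h s) = resM G h (appL φ U s) :=
  NatTrans.naturality_apply φ.mapPresheaf (homOfLE h).op s

lemma appL_comp {H : X.Modules} (φ : F ⟶ G) (ψ : G ⟶ H) (U : X.Opens) (s : Γ(F, U)) :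
    appL (φ ≫ ψ) U s = appL ψ U (appL φ U s) := rfl

lemma appL_id (U : X.Opens) (s : Γ(F, U)) : appL (𝟙 F) U s = s := rfl

lemma appL_zero (U : X.Opens) (s : Γ(F, U)) : appL (0 : F ⟶ G) U s = 0 := rfl

lemma appL_add (φ ψ : F ⟶ G) (U : X.Opens) (s : Γ(F, U)) :
    appL (φ + ψ) U s = appL φ U s + appL ψ U s := rfl

lemma appL_sum {ι : Type} (T : Finset ι) (φ : ι → (F ⟶ G)) (U : X.Opens) (s : Γ(F, U)) :
    appL (∑ i ∈ T, φ i) U s = ∑ i ∈ T, appL (φ i) U s := by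
  classical
  induction T using Finset.induction_on with
  | empty => rfl
  | insert i T hi ih => rw [Finset.sum_insert hi, Finset.sum_insert hi, appL_add, ih]

lemma hom_ext_appL {φ ψ : F ⟶ G} (h : ∀ U s, appL φ U s = appL ψ U s) : φ = ψ := by
  refine Scheme.Modules.hom_ext _ _ fun U => ?_
  ext s
  exact h U s

lemma isFrame_of_iso (e : F ≅ G) {v : κ → Γ(F, U)} (hv : IsFrame F U v) :
    IsFrame G U fun k => appL e.hom U (v k) := by
  intro W h
  have e1 : (fun f : κ → Γ(X, W) => ∑ k, f k • resM G h (appL e.hom U (v k))) =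
      appL e.hom W ∘ fun f => ∑ k, f k • resM F h (v k) := by
    funext f
    simp only [Function.comp_apply, map_sum, map_smul, appL_resM]
  rw [e1]
  refine Function.Bijective.comp ?_ (hv W h)
  refine Function.bijective_iff_has_inverse.2 ⟨appL e.inv W, fun s => ?_, fun s => ?_⟩
  · rw [← appL_comp, e.hom_inv_id, appL_id]
  · rw [← appL_comp, e.inv_hom_id, appL_id]

lemma IsTransitionMatrix.of_iso (e : F ≅ G) {M : Matrix κ κ Γ(X, U₁ ⊓ U₂)}
    (h : IsTransitionMatrix U₁ U₂ F M) : IsTransitionMatrix U₁ U₂ G M := by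
  obtain ⟨v, w, hv, hw, h⟩ := h
  refine ⟨_, _, isFrame_of_iso e hv, isFrame_of_iso e hw, fun j => ?_⟩
  simp only [← appL_resM, h, map_sum, map_smul]

lemma isFrame_reindex (e : κ' ≃ κ) {v : κ → Γ(F, U)} (hv : IsFrame F U v) :
    IsFrame F U fun k => v (e k) := by
  intro W h
  have e1 : (fun f : κ' → Γ(X, W) => ∑ k, f k • resM F h (v (e k))) =
      (fun f : κ → Γ(X, W) => ∑ k, f k • resM F h (v k)) ∘ (e.arrowCongr (Equiv.refl _)) := by
    funext f
    simp only [Function.comp_apply, Equiv.arrowCongr_apply, Equiv.coe_refl, id]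
    exact Fintype.sum_equiv e _ _ fun k => by simp
  rw [e1]
  exact (hv W h).comp (Equiv.bijective _)

lemma IsTransitionMatrix.reindex (e : κ' ≃ κ) {M : Matrix κ κ Γ(X, U₁ ⊓ U₂)}
    (h : IsTransitionMatrix U₁ U₂ F M) : IsTransitionMatrix U₁ U₂ F (M.submatrix e e) := by
  obtain ⟨v, w, hv, hw, h⟩ := h
  refine ⟨_, _, isFrame_reindex e hv, isFrame_reindex e hw, fun j => ?_⟩
  rw [h]
  exact (Fintype.sum_equiv e _ _ fun k => rfl).symm

end Morphisms

/-! ### Frames and transition matrices of direct sums. -/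

section Sums

variable {X : Scheme.{0}} {κ κ' : Type} [Fintype κ] [Fintype κ'] {U U₁ U₂ : X.Opens}

/-- The summand is the second component of the index, to match the indexing of
`Matrix.blockDiagonal`. -/
lemma isFrame_biproduct {P : Type} [Fintype P] (F : P → X.Modules) [HasBiproduct F]
    {v : ∀ p, κ → Γ(F p, U)} (hv : ∀ p, IsFrame (F p) U (v p)) :
    IsFrame (⨁ F) U fun k : κ × P => appL (biproduct.ι F k.2) U (v k.2 k.1) := by
  classical
  intro W h
  let A : (κ × P → Γ(X, W)) → ∀ p, Γ(F p, W) := fun f p => ∑ k, f (k, p) • resM (F p) h (v p k)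
  let B : (∀ p, Γ(F p, W)) → Γ(⨁ F, W) := fun s => ∑ p, appL (biproduct.ι F p) W (s p)
  have e : (fun f : κ × P → Γ(X, W) =>
      ∑ k, f k • resM (⨁ F) h (appL (biproduct.ι F k.2) U (v k.2 k.1))) = B ∘ A := by
    funext f
    rw [Fintype.sum_prod_type_right]
    simp only [A, B, Function.comp_apply, map_sum, map_smul, appL_resM]
  rw [e]
  refine Function.Bijective.comp ?_ ?_
  · refine Function.bijective_iff_has_inverse.2
      ⟨fun s p => appL (biproduct.π F p) W s, fun s => ?_, fun s => ?_⟩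
    · funext p
      simp only [B, map_sum, ← appL_comp]
      rw [Finset.sum_eq_single p]
      · rw [biproduct.ι_π_self, appL_id]
      · intro q _ hq
        rw [biproduct.ι_π_ne _ hq, appL_zero]
      · simp
    · simp only [B, ← appL_comp, ← appL_sum, biproduct.total, appL_id]
  · have : A = (Equiv.piCongrRight fun p => Equiv.ofBijective _ (hv p W h)) ∘
        (fun f p k => f (k, p)) := rfl
    rw [this]
    refine (Equiv.bijective _).comp (Function.bijective_iff_has_inverse.2
      ⟨fun g k => g k.2 k.1, fun _ => rfl, fun _ => rfl⟩)

lemma isTransitionMatrix_biproduct {P : Type} [Fintype P] [DecidableEq P] (F : P → X.Modules)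
    [HasBiproduct F] {M : P → Matrix κ κ Γ(X, U₁ ⊓ U₂)}
    (h : ∀ p, IsTransitionMatrix U₁ U₂ (F p) (M p)) :
    IsTransitionMatrix U₁ U₂ (⨁ F) (Matrix.blockDiagonal M) := by
  choose v w hv hw h using h
  refine ⟨_, _, isFrame_biproduct F hv, isFrame_biproduct F hw, fun j => ?_⟩
  rw [← appL_resM, h, map_sum, Fintype.sum_prod_type_right, Finset.sum_eq_single j.2]
  · refine Finset.sum_congr rfl fun i _ => ?_
    rw [map_smul, appL_resM, Matrix.blockDiagonal_apply, if_pos rfl]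
  · intro p _ hp
    refine Finset.sum_eq_zero fun i _ => ?_
    rw [Matrix.blockDiagonal_apply, if_neg hp, zero_smul]
  · simp

lemma isFrame_biprod {F G : X.Modules} [HasBinaryBiproduct F G]
    {v : κ → Γ(F, U)} (hv : IsFrame F U v) {w : κ' → Γ(G, U)} (hw : IsFrame G U w) :
    IsFrame (F ⊞ G) U (Sum.elim (fun k => appL (biprod.inl : F ⟶ F ⊞ G) U (v k))
      fun k => appL (biprod.inr : G ⟶ F ⊞ G) U (w k)) := by
  intro W h
  let B : Γ(F, W) × Γ(G, W) → Γ(F ⊞ G, W) := fun s =>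
    appL (biprod.inl : F ⟶ F ⊞ G) W s.1 + appL (biprod.inr : G ⟶ F ⊞ G) W s.2
  have e : (fun f : κ ⊕ κ' → Γ(X, W) => ∑ k, f k • resM (F ⊞ G) h
      (Sum.elim (fun k => appL (biprod.inl : F ⟶ F ⊞ G) U (v k))
      (fun k => appL (biprod.inr : G ⟶ F ⊞ G) U (w k)) k)) =
      B ∘ (Prod.map (fun f => ∑ k, f k • resM F h (v k)) (fun f => ∑ k, f k • resM G h (w k))) ∘
        (Equiv.sumArrowEquivProdArrow _ _ _) := by
    funext f
    rw [Fintype.sum_sum_type]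
    simp only [B, Function.comp_apply, Prod.map, map_sum, map_smul, appL_resM, Sum.elim_inl,
      Sum.elim_inr]
    rfl
  rw [e]
  refine Function.Bijective.comp ?_ (Function.Bijective.comp ?_ (Equiv.bijective _))
  · refine Function.bijective_iff_has_inverse.2
      ⟨fun s => (appL (biprod.fst : F ⊞ G ⟶ F) W s, appL (biprod.snd : F ⊞ G ⟶ G) W s),
        fun s => ?_, fun s => ?_⟩
    · simp only [B, map_add, ← appL_comp, biprod.inl_fst, biprod.inr_fst, biprod.inl_snd,
        biprod.inr_snd, appL_id, appL_zero, add_zero, zero_add]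
    · simp only [B, ← appL_comp, ← appL_add, biprod.total, appL_id]
  · exact (hv W h).prodMap (hw W h)

lemma isTransitionMatrix_biprod {F G : X.Modules} [HasBinaryBiproduct F G]
    {M : Matrix κ κ Γ(X, U₁ ⊓ U₂)} {N : Matrix κ' κ' Γ(X, U₁ ⊓ U₂)}
    (hF : IsTransitionMatrix U₁ U₂ F M) (hG : IsTransitionMatrix U₁ U₂ G N) :
    IsTransitionMatrix U₁ U₂ (F ⊞ G) (Matrix.fromBlocks M 0 0 N) := by
  obtain ⟨v, w, hv, hw, h⟩ := hF
  obtain ⟨v', w', hv', hw', h'⟩ := hG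
  refine ⟨_, _, isFrame_biprod hv hv', isFrame_biprod hw hw', ?_⟩
  rintro (j | j)
  · rw [Fintype.sum_sum_type]
    simp only [Sum.elim_inl, Sum.elim_inr, ← appL_resM, h, map_sum, map_smul,
      Matrix.fromBlocks_apply₁₁, Matrix.fromBlocks_apply₂₁, Matrix.zero_apply, zero_smul,
      Finset.sum_const_zero, add_zero]
  · rw [Fintype.sum_sum_type]
    simp only [Sum.elim_inl, Sum.elim_inr, ← appL_resM, h', map_sum, map_smul,
      Matrix.fromBlocks_apply₁₂, Matrix.fromBlocks_apply₂₂, Matrix.zero_apply, zero_smul,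
      Finset.sum_const_zero, zero_add]

end Sums

/-! ### Change of frame and gluing -/

section ChangeOfFrame

variable {X : Scheme.{0}} {κ κ' : Type} [Fintype κ] [Fintype κ'] {F G : X.Modules}
  {U U₁ U₂ : X.Opens}

lemma IsFrame.eq_of_sum_eq {v : κ → Γ(F, U)} (hv : IsFrame F U v) {f g : κ → Γ(X, U)}
    (h : ∑ k, f k • v k = ∑ k, g k • v k) : f = g := by
  refine (hv U le_rfl).1 ?_
  simp only [resM_self]
  exact h

lemma sum_smul_sum {R M : Type*} [CommRing R] [AddCommGroup M] [Module R M]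
    (A : Matrix κ' κ R) (f : κ → R) (v : κ' → M) :
    ∑ j, f j • ∑ i, A i j • v i = ∑ i, (A.mulVec f) i • v i := by
  simp only [Finset.smul_sum, Matrix.mulVec, dotProduct, Finset.sum_smul, smul_smul]
  rw [Finset.sum_comm]
  exact Finset.sum_congr rfl fun i _ => Finset.sum_congr rfl fun j _ => by rw [mul_comm]

/-- The matrix expressing the sections `s` in the frame `v`. -/
lemma IsFrame.exists_matrix {κ' : Type} {v : κ → Γ(F, U)} (hv : IsFrame F U v)
    (s : κ' → Γ(F, U)) :
    ∃ A : Matrix κ κ' Γ(X, U), ∀ j, s j = ∑ i, A i j • v i := by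
  choose f hf using fun j => (hv U le_rfl).2 (s j)
  refine ⟨fun i j => f j i, fun j => ?_⟩
  rw [← hf j]
  simp only [resM_self]

lemma eq_one_of_sum_eq [DecidableEq κ] {v : κ → Γ(F, U)} (hv : IsFrame F U v)
    {A : Matrix κ κ Γ(X, U)} (h : ∀ j, v j = ∑ i, A i j • v i) : A = 1 := by
  ext i j
  have := hv.eq_of_sum_eq (f := fun i => A i j) (g := Pi.single j 1) ?_
  · rw [Matrix.one_apply, congrFun this i, Pi.single_apply]
  · rw [← h j, Finset.sum_eq_single j]
    · rw [Pi.single_eq_same, one_smul]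
    · intro l _ hl
      rw [Pi.single_eq_of_ne hl, zero_smul]
    · simp

lemma exists_change_of_frame [DecidableEq κ] [DecidableEq κ'] {v : κ → Γ(F, U)} {w : κ' → Γ(F, U)}
    (hv : IsFrame F U v) (hw : IsFrame F U w) :
    ∃ (A : Matrix κ' κ Γ(X, U)) (B : Matrix κ κ' Γ(X, U)), A * B = 1 ∧ B * A = 1 ∧
      ∀ j, v j = ∑ i, A i j • w i := by
  obtain ⟨A, hA⟩ := hw.exists_matrix v
  obtain ⟨B, hB⟩ := hv.exists_matrix w
  refine ⟨A, B, eq_one_of_sum_eq hw fun j => ?_, eq_one_of_sum_eq hv fun j => ?_, hA⟩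
  · conv_lhs => rw [hB j]
    simp only [hA]
    exact sum_smul_sum A (fun i => B i j) w
  · conv_lhs => rw [hA j]
    simp only [hB]
    exact sum_smul_sum B (fun i => A i j) v

lemma isFrame_of_matrix [DecidableEq κ] [DecidableEq κ'] {v : κ → Γ(F, U)} (hv : IsFrame F U v)
    {A : Matrix κ κ' Γ(X, U)} {B : Matrix κ' κ Γ(X, U)} (hAB : A * B = 1) (hBA : B * A = 1) :
    IsFrame F U fun j => ∑ i, A i j • v i := by
  intro W h
  have e : (fun f : κ' → Γ(X, W) => ∑ k, f k • resM F h (∑ i, A i k • v i)) =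
      (fun f : κ → Γ(X, W) => ∑ k, f k • resM F h (v k)) ∘ (A.map (res h)).mulVec := by
    funext f
    simp only [resM_sum_smul]
    exact sum_smul_sum (A.map (res h)) f _
  rw [e]
  refine (hv W h).comp (Function.bijective_iff_has_inverse.2
    ⟨(B.map (res h)).mulVec, fun f => ?_, fun f => ?_⟩)
  · rw [Matrix.mulVec_mulVec, ← Matrix.map_mul, hBA, Matrix.map_one _ (map_zero _) (map_one _),
      Matrix.one_mulVec]
  · rw [Matrix.mulVec_mulVec, ← Matrix.map_mul, hAB, Matrix.map_one _ (map_zero _) (map_one _),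
      Matrix.one_mulVec]

/-- Two transition matrices are equivalent if they differ by changes of frames on `U₁` and `U₂`. -/
def TransEquiv {R₁ R₂ R : Type} [CommRing R₁] [CommRing R₂] [CommRing R] (i₁ : R₁ →+* R)
    (i₂ : R₂ →+* R) {κ κ' : Type} [Fintype κ] [Fintype κ'] [DecidableEq κ] [DecidableEq κ']
    (M : Matrix κ κ R) (N : Matrix κ' κ' R) : Prop :=
  ∃ (L : Matrix κ' κ R₂) (L' : Matrix κ κ' R₂) (S : Matrix κ κ' R₁) (S' : Matrix κ' κ R₁),
    L * L' = 1 ∧ L' * L = 1 ∧ S * S' = 1 ∧ S' * S = 1 ∧ L.map i₂ * M * S.map i₁ = N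

/-- The equivalence consists of the changes of frame on the two charts; over the overlap, the two
ways of writing `v j` in the frame `w'` give the matrix identity. -/
lemma transEquiv_of_isTransitionMatrix [DecidableEq κ] [DecidableEq κ']
    {M : Matrix κ κ Γ(X, U₁ ⊓ U₂)} {N : Matrix κ' κ' Γ(X, U₁ ⊓ U₂)}
    (hM : IsTransitionMatrix U₁ U₂ F M) (hN : IsTransitionMatrix U₁ U₂ F N) :
    TransEquiv (res inf_le_left) (res inf_le_right) M N := by
  obtain ⟨v, w, hv, hw, h⟩ := hM
  obtain ⟨v', w', hv', hw', h'⟩ := hN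
  obtain ⟨A, A', hA, hA', hvA⟩ := exists_change_of_frame hv hv'
  obtain ⟨B, B', hB, hB', hwB⟩ := exists_change_of_frame hw hw'
  refine ⟨B, B', A', A, hB, hB', hA', hA, ?_⟩
  have key : B.map (res (inf_le_right : U₁ ⊓ U₂ ≤ U₂)) * M = N * A.map (res (inf_le_left : U₁ ⊓ U₂ ≤ U₁)) := by
    ext i j
    refine congrFun ((hw'.mono inf_le_right).eq_of_sum_eq
      (f := fun i => (B.map (res (inf_le_right : U₁ ⊓ U₂ ≤ U₂)) * M) i j)
      (g := fun i => (N * A.map (res (inf_le_left : U₁ ⊓ U₂ ≤ U₁))) i j) ?_) i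
    have e1 := h j
    rw [hvA j] at e1
    simp only [resM_sum_smul, h', hwB] at e1
    refine ((sum_smul_sum (B.map (res (inf_le_right : U₁ ⊓ U₂ ≤ U₂))) (fun i => M i j) _).symm.trans
      (e1.symm.trans ?_))
    exact sum_smul_sum N (fun i => A.map (res (inf_le_left : U₁ ⊓ U₂ ≤ U₁)) i j) _
  rw [key, Matrix.mul_assoc, ← Matrix.map_mul, hA, Matrix.map_one _ (map_zero _) (map_one _),
    Matrix.mul_one]

lemma IsTransitionMatrix.of_transEquiv [DecidableEq κ] [DecidableEq κ']
    {M : Matrix κ κ Γ(X, U₁ ⊓ U₂)} {N : Matrix κ' κ' Γ(X, U₁ ⊓ U₂)}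
    (hM : IsTransitionMatrix U₁ U₂ F M)
    (h : TransEquiv (res inf_le_left) (res inf_le_right) M N) : IsTransitionMatrix U₁ U₂ F N := by
  obtain ⟨v, w, hv, hw, hvw⟩ := hM
  obtain ⟨L, L', S, S', hL, hL', hS, hS', rfl⟩ := h
  refine ⟨_, _, isFrame_of_matrix hv hS hS', isFrame_of_matrix hw hL' hL, fun j => ?_⟩
  simp only [resM_sum_smul, hvw]
  rw [sum_smul_sum M (fun i => res inf_le_left (S i j))]
  refine Eq.trans ?_ (sum_smul_sum (L'.map (res (inf_le_right : U₁ ⊓ U₂ ≤ U₂)))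
    (fun i => (L.map (res (inf_le_right : U₁ ⊓ U₂ ≤ U₂)) * M * S.map (res (inf_le_left : U₁ ⊓ U₂ ≤ U₁))) i j) _).symm
  refine Finset.sum_congr rfl fun i _ => congrArg (· • _) ?_
  have : L'.map (res (inf_le_right : U₁ ⊓ U₂ ≤ U₂)) * (L.map (res (inf_le_right : U₁ ⊓ U₂ ≤ U₂)) * M * S.map (res (inf_le_left : U₁ ⊓ U₂ ≤ U₁))) =
      M * S.map (res (inf_le_left : U₁ ⊓ U₂ ≤ U₁)) := by
    rw [← Matrix.mul_assoc, ← Matrix.mul_assoc, ← Matrix.map_mul, hL',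
      Matrix.map_one _ (map_zero _) (map_one _), Matrix.one_mul]
  exact (congrFun (congrFun this i) j).symm

lemma isVectorBundle_of_isFrame {v : κ → Γ(F, U₁)} {w : κ' → Γ(F, U₂)} (hv : IsFrame F U₁ v)
    (hw : IsFrame F U₂ w) (hU : U₁ ⊔ U₂ = ⊤) : IsVectorBundle F := by
  intro x
  have hx : x ∈ U₁ ⊔ U₂ := by rw [hU]; trivial
  rcases hx with hx | hx
  · exact ⟨U₁, hx, _, _, isFrame_reindex (Fintype.equivFin κ).symm hv⟩
  · exact ⟨U₂, hx, _, _, isFrame_reindex (Fintype.equivFin κ').symm hw⟩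

end ChangeOfFrame

/-! ### Recovering a bundle from its transition matrix. -/

section Gluing

variable {X : Scheme.{0}} {κ : Type} [Fintype κ] {F G : X.Modules} {U₁ U₂ : X.Opens}

lemma exists_glue_pair (F : X.Modules) {W W₁ W₂ : X.Opens} (h₁ : W₁ ≤ W) (h₂ : W₂ ≤ W)
    (hW : W ≤ W₁ ⊔ W₂) (s₁ : Γ(F, W₁)) (s₂ : Γ(F, W₂))
    (h : resM F (inf_le_left : W₁ ⊓ W₂ ≤ W₁) s₁ = resM F inf_le_right s₂) :
    ∃ s : Γ(F, W), resM F h₁ s = s₁ ∧ resM F h₂ s = s₂ := by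
  let 𝓕 : TopCat.Sheaf Ab X := ⟨F.presheaf, F.isSheaf⟩
  let U : Bool → X.Opens := fun b => bif b then W₁ else W₂
  let sf : ∀ b, Γ(F, U b) := Bool.rec s₂ s₁
  obtain ⟨s, hs, -⟩ := 𝓕.existsUnique_gluing' U W (fun b => homOfLE (by cases b <;> assumption))
    (by rw [iSup_bool_eq]; exact hW) sf (by
      have h' : resM F (inf_le_left : W₂ ⊓ W₁ ≤ W₂) s₂ = resM F inf_le_right s₁ := by
        have := congrArg (resM F (le_of_eq (inf_comm _ _) : W₂ ⊓ W₁ ≤ W₁ ⊓ W₂)) h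
        simp only [resM_resM] at this
        exact this.symm
      rintro (b | b) (c | c)
      · rfl
      · exact h'
      · exact h
      · rfl)
  exact ⟨s, hs true, hs false⟩

lemma ext_pair (F : X.Modules) {W W₁ W₂ : X.Opens} (h₁ : W₁ ≤ W) (h₂ : W₂ ≤ W)
    (hW : W ≤ W₁ ⊔ W₂) {s s' : Γ(F, W)} (e₁ : resM F h₁ s = resM F h₁ s')
    (e₂ : resM F h₂ s = resM F h₂ s') : s = s' := by
  refine section_ext F fun x hx => ?_
  rcases hW hx with hx | hx
  · exact ⟨W₁, h₁, hx, e₁⟩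
  · exact ⟨W₂, h₂, hx, e₂⟩

/-- A morphism of modules from a compatible family of linear maps. -/
def homOfLinear (f : ∀ U : X.Opens, Γ(F, U) →ₗ[Γ(X, U)] Γ(G, U))
    (h : ∀ {U V : X.Opens} (h : V ≤ U) (s : Γ(F, U)), f V (resM F h s) = resM G h (f U s)) :
    F ⟶ G where
  val := PresheafOfModules.homMk
    { app := fun U => AddCommGrpCat.ofHom (f U.unop).toAddMonoidHom
      naturality := fun U V i => by
        ext s
        exact h i.unop.le s }
    fun U r s => (f U.unop).map_smul r s

lemma isIso_of_bijective (φ : F ⟶ G) (h : ∀ U, Function.Bijective (appL φ U)) : IsIso φ := by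
  rw [Scheme.Modules.Hom.isIso_iff_isIso_app]
  intro U
  rw [ConcreteCategory.isIso_iff_bijective]
  exact h U

/-- A section of a glued bundle. -/
def clutchMk (M : Matrix κ κ Γ(X, U₁ ⊓ U₂)) (W : X.Opens) :
    clutchSections M W ≃ₗ[Γ(X, W)] Γ(clutch M, W) where
  toFun s := s
  invFun s := s
  map_add' _ _ := rfl
  map_smul' _ _ := rfl

lemma resM_clutchMk (M : Matrix κ κ Γ(X, U₁ ⊓ U₂)) {W W' : X.Opens} (h : W' ≤ W)
    (s : clutchSections M W) :
    resM (clutch M) h (clutchMk M W s) = clutchMk M W' (clutchRes M h s) := rfl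

lemma sum_smul_eq_of_transition {M : Matrix κ κ Γ(X, U₁ ⊓ U₂)} {v : κ → Γ(F, U₁)}
    {w : κ → Γ(F, U₂)}
    (h : ∀ j, resM F inf_le_left (v j) = ∑ i, M i j • resM F inf_le_right (w i)) {W : X.Opens}
    (hW : W ≤ U₁ ⊓ U₂) (f : κ → Γ(X, W)) :
    ∑ j, f j • resM F (hW.trans inf_le_left) (v j) =
      ∑ i, (∑ j, res hW (M i j) * f j) • resM F (hW.trans inf_le_right) (w i) := by
  have : ∀ j, resM F (hW.trans inf_le_left) (v j) =
      ∑ i, M.map (res hW) i j • resM F (hW.trans inf_le_right) (w i) := fun j => by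
    have := congrArg (resM F hW) (h j)
    simp only [resM_sum_smul, resM_resM] at this
    exact this
  simp only [this]
  exact sum_smul_sum (M.map (res hW)) f _

/-- A section is sent to its coordinates in the two frames. These form a compatible pair because `M`
is the transition matrix, and bijectivity over `W` is the sheaf property for the cover by `W ⊓ U₁`
and `W ⊓ U₂`. -/
lemma nonempty_iso_clutch (hU : U₁ ⊔ U₂ = ⊤) {M : Matrix κ κ Γ(X, U₁ ⊓ U₂)}
    (hM : IsTransitionMatrix U₁ U₂ F M) : Nonempty (F ≅ clutch M) := by
  obtain ⟨v, w, hv, hw, h⟩ := hM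
  let φ : ∀ W : X.Opens, Γ(F, W) →ₗ[Γ(X, W)] clutchSections M W := fun W =>
    { toFun := fun s => ⟨(hv.coords (W ⊓ U₁) inf_le_right (resM F inf_le_left s),
        hw.coords (W ⊓ U₂) inf_le_right (resM F inf_le_left s)), by
          intro i
          rw [hw.res_coords]
          simp only [hv.res_coords, resM_resM]
          have e1 := hv.sum_coords (inf_le_right.trans inf_le_left : W ⊓ (U₁ ⊓ U₂) ≤ U₁)
            (resM F inf_le_left s)
          rw [sum_smul_eq_of_transition h inf_le_right] at e1
          exact congrFun ((hw.coords_eq_iff _ _ _).2 e1.symm) i⟩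
      map_add' := fun s s' => by
        refine clutch_ext M (fun k => ?_) (fun k => ?_)
        · change hv.coords _ _ (resM F _ (s + s')) k = hv.coords _ _ _ k + hv.coords _ _ _ k
          rw [map_add, map_add]
          rfl
        · change hw.coords _ _ (resM F _ (s + s')) k = hw.coords _ _ _ k + hw.coords _ _ _ k
          rw [map_add, map_add]
          rfl
      map_smul' := fun r s => by
        refine clutch_ext M (fun k => ?_) (fun k => ?_)
        · change hv.coords _ _ (resM F _ (r • s)) k = res _ r * hv.coords _ _ _ k
          rw [resM_smul, map_smul]
          rfl
        · change hw.coords _ _ (resM F _ (r • s)) k = res _ r * hw.coords _ _ _ k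
          rw [resM_smul, map_smul]
          rfl }
  have cover : ∀ W : X.Opens, W ≤ W ⊓ U₁ ⊔ W ⊓ U₂ := fun W => by
    rw [← inf_sup_left, hU, inf_top_eq]
  let Φ : F ⟶ clutch M := homOfLinear (fun W => (clutchMk M W).toLinearMap ∘ₗ φ W) (by
    intro W V hVW s
    refine clutch_ext M (s := φ V (resM F hVW s)) (t := clutchRes M hVW (φ W s))
      (fun k => ?_) (fun k => ?_)
    · change hv.coords _ _ _ k = res _ (hv.coords _ _ _ k)
      rw [hv.res_coords]
      simp only [resM_resM]
    · change hw.coords _ _ _ k = res _ (hw.coords _ _ _ k)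
      rw [hw.res_coords]
      simp only [resM_resM])
  have : IsIso Φ := by
    refine isIso_of_bijective Φ fun W => ?_
    change Function.Bijective (φ W)
    constructor
    · intro s s' e
      have e1 : hv.coords (W ⊓ U₁) inf_le_right (resM F inf_le_left s) =
        hv.coords (W ⊓ U₁) inf_le_right (resM F inf_le_left s') := congrArg (fun t => t.1.1) e
      have e2 : hw.coords (W ⊓ U₂) inf_le_right (resM F inf_le_left s) =
        hw.coords (W ⊓ U₂) inf_le_right (resM F inf_le_left s') := congrArg (fun t => t.1.2) e
      exact ext_pair F inf_le_left inf_le_left (cover W) ((hv.coords _ _).injective e1)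
        ((hw.coords _ _).injective e2)
    · rintro ⟨⟨f, g⟩, hfg⟩
      obtain ⟨s, hs1, hs2⟩ := exists_glue_pair F inf_le_left inf_le_left (cover W)
        (∑ k, f k • resM F inf_le_right (v k)) (∑ k, g k • resM F inf_le_right (w k)) (by
          have hle : (W ⊓ U₁) ⊓ (W ⊓ U₂) ≤ W ⊓ (U₁ ⊓ U₂) :=
            le_inf (inf_le_left.trans inf_le_left)
              (inf_le_inf inf_le_right inf_le_right)
          simp only [resM_sum_smul, resM_resM]
          rw [sum_smul_eq_of_transition h (hle.trans inf_le_right)]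
          refine Finset.sum_congr rfl fun i _ => congrArg (· • _) ?_
          have := congrArg (res hle) (hfg i)
          simpa only [map_sum, map_mul, res_res] using this.symm)
      refine ⟨s, clutch_ext M (fun k => ?_) (fun k => ?_)⟩
      · change hv.coords _ _ _ k = f k
        rw [hs1, hv.coords_sum]
      · change hw.coords _ _ _ k = g k
        rw [hs2, hw.coords_sum]
  exact ⟨asIso Φ⟩

lemma nonempty_iso_of_isTransitionMatrix (hU : U₁ ⊔ U₂ = ⊤) {M : Matrix κ κ Γ(X, U₁ ⊓ U₂)}
    (hF : IsTransitionMatrix U₁ U₂ F M) (hG : IsTransitionMatrix U₁ U₂ G M) :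
    Nonempty (F ≅ G) :=
  (nonempty_iso_clutch hU hF).elim fun e => (nonempty_iso_clutch hU hG).elim fun e' =>
    ⟨e ≪≫ e'.symm⟩

end Gluing

/-! ### Frames of glued bundles -/

section ClutchFrames

variable {X : Scheme.{0}} {κ : Type} [Fintype κ] {U₁ U₂ : X.Opens}

lemma clutch_sum_fst {ι : Type} [Fintype ι] (M : Matrix κ κ Γ(X, U₁ ⊓ U₂)) {W : X.Opens}
    (f : ι → Γ(X, W)) (s : ι → clutchSections M W) (i : κ) :
    (∑ k, f k • s k).1.1 i = ∑ k, res inf_le_left (f k) * (s k).1.1 i := by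
  rw [AddSubgroup.val_finsetSum, Prod.fst_sum, Finset.sum_apply]
  rfl

lemma clutch_sum_snd {ι : Type} [Fintype ι] (M : Matrix κ κ Γ(X, U₁ ⊓ U₂)) {W : X.Opens}
    (f : ι → Γ(X, W)) (s : ι → clutchSections M W) (i : κ) :
    (∑ k, f k • s k).1.2 i = ∑ k, res inf_le_left (f k) * (s k).1.2 i := by
  rw [AddSubgroup.val_finsetSum, Prod.snd_sum, Finset.sum_apply]
  rfl

lemma res_injective_of_le {U V : X.Opens} (h : V ≤ U) (h' : U ≤ V) {s s' : Γ(X, U)}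
    (e : res h s = res h s') : s = s' := by
  have := congrArg (res h') e
  simpa only [res_res, res_self] using this

variable [DecidableEq κ]

/-- The tautological sections over `U₁` of a glued bundle. -/
def clutchLeft (M : Matrix κ κ Γ(X, U₁ ⊓ U₂)) (j : κ) : clutchSections M U₁ :=
  ⟨(Pi.single j 1, fun i => M i j), fun i => by
    rw [Finset.sum_eq_single j]
    · simp only [Pi.single_eq_same, map_one, mul_one]
    · intro l _ hl
      simp only [Pi.single_eq_of_ne hl, map_zero, mul_zero]
    · simp⟩

/-- The tautological sections over `U₂` of a glued bundle. -/
def clutchRight {M N : Matrix κ κ Γ(X, U₁ ⊓ U₂)} (h : M * N = 1) (j : κ) : clutchSections M U₂ :=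
  ⟨(fun i => res (le_of_eq (inf_comm _ _)) (N i j), Pi.single j 1), fun i => by
    have := congrArg (res (inf_le_right : U₂ ⊓ (U₁ ⊓ U₂) ≤ U₁ ⊓ U₂)) (congrFun (congrFun h i) j)
    rw [Matrix.mul_apply, map_sum] at this
    simp only [map_mul] at this
    simp only [res_res]
    refine Eq.trans ?_ this.symm
    rw [Matrix.one_apply]
    by_cases hij : i = j
    · subst hij
      simp only [Pi.single_eq_same, map_one, if_true]
    · simp only [Pi.single_eq_of_ne hij, map_zero, if_neg hij]⟩

lemma isFrame_clutchLeft (M : Matrix κ κ Γ(X, U₁ ⊓ U₂)) :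
    IsFrame (clutch M) U₁ fun j => clutchMk M U₁ (clutchLeft M j) := by
  intro W hW
  have hfst : ∀ (f : κ → Γ(X, W)) (i : κ),
      (∑ k, f k • clutchRes M hW (clutchLeft M k)).1.1 i = res inf_le_left (f i) := by
    intro f i
    rw [clutch_sum_fst, Finset.sum_eq_single i]
    · change _ * res _ ((Pi.single i 1 : κ → Γ(X, U₁ ⊓ U₁)) i) = _
      rw [Pi.single_eq_same, map_one, mul_one]
    · intro l _ hl
      change _ * res _ ((Pi.single l 1 : κ → Γ(X, U₁ ⊓ U₁)) i) = _
      rw [Pi.single_eq_of_ne hl.symm, map_zero, mul_zero]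
    · simp
  have e : (fun f : κ → Γ(X, W) =>
      ∑ k, f k • resM (clutch M) hW (clutchMk M U₁ (clutchLeft M k))) =
      fun f => clutchMk M W (∑ k, f k • clutchRes M hW (clutchLeft M k)) := by
    funext f
    simp only [resM_clutchMk, map_sum, map_smul]
  rw [e]
  refine (clutchMk M W).bijective.comp ⟨fun f f' hf => ?_, fun s => ?_⟩
  · funext i
    have h1 := hfst f i
    change ∑ k, f k • clutchRes M hW (clutchLeft M k) =
      ∑ k, f' k • clutchRes M hW (clutchLeft M k) at hf
    rw [hf, hfst] at h1
    exact (res_injective_of_le inf_le_left (le_inf le_rfl hW) h1).symm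
  · refine ⟨fun k => res (le_inf le_rfl hW) (s.1.1 k), clutch_ext M (fun i => ?_) (fun i => ?_)⟩
    · refine (hfst _ i).trans ?_
      rw [res_res, res_self]
    · refine (clutch_sum_snd M _ _ i).trans ?_
      have hle : W ⊓ U₂ ≤ W ⊓ (U₁ ⊓ U₂) := le_inf inf_le_left (inf_le_inf_right _ hW)
      have := congrArg (res hle) (s.2 i)
      simp only [map_sum, map_mul, res_res, res_self] at this
      rw [this]
      refine Finset.sum_congr rfl fun k _ => ?_
      rw [res_res, mul_comm]
      rfl

lemma isFrame_clutchRight {M N : Matrix κ κ Γ(X, U₁ ⊓ U₂)} (h : M * N = 1) :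
    IsFrame (clutch M) U₂ fun j => clutchMk M U₂ (clutchRight h j) := by
  intro W hW
  have hsnd : ∀ (f : κ → Γ(X, W)) (i : κ),
      (∑ k, f k • clutchRes M hW (clutchRight h k)).1.2 i = res inf_le_left (f i) := by
    intro f i
    rw [clutch_sum_snd, Finset.sum_eq_single i]
    · change _ * res _ ((Pi.single i 1 : κ → Γ(X, U₂ ⊓ U₂)) i) = _
      rw [Pi.single_eq_same, map_one, mul_one]
    · intro l _ hl
      change _ * res _ ((Pi.single l 1 : κ → Γ(X, U₂ ⊓ U₂)) i) = _
      rw [Pi.single_eq_of_ne hl.symm, map_zero, mul_zero]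
    · simp
  have e : (fun f : κ → Γ(X, W) =>
      ∑ k, f k • resM (clutch M) hW (clutchMk M U₂ (clutchRight h k))) =
      fun f => clutchMk M W (∑ k, f k • clutchRes M hW (clutchRight h k)) := by
    funext f
    simp only [resM_clutchMk, map_sum, map_smul]
  rw [e]
  have h' : N * M = 1 := mul_eq_one_comm.1 h
  refine (clutchMk M W).bijective.comp ⟨fun f f' hf => ?_, fun s => ?_⟩
  · funext i
    have h1 := hsnd f i
    change ∑ k, f k • clutchRes M hW (clutchRight h k) =
      ∑ k, f' k • clutchRes M hW (clutchRight h k) at hf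
    rw [hf, hsnd] at h1
    exact (res_injective_of_le inf_le_left (le_inf le_rfl hW) h1).symm
  · refine ⟨fun k => res (le_inf le_rfl hW) (s.1.2 k), clutch_ext M (fun i => ?_) (fun i => ?_)⟩
    · refine (clutch_sum_fst M _ _ i).trans ?_
      have hle : W ⊓ U₁ ≤ W ⊓ (U₁ ⊓ U₂) :=
        le_inf inf_le_left (le_inf inf_le_right (inf_le_left.trans hW))
      let ρ : Γ(X, U₁ ⊓ U₂) →+* Γ(X, W ⊓ U₁) := res (hle.trans inf_le_right)
      let a : κ → Γ(X, W ⊓ U₁) := s.1.1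
      let b : κ → Γ(X, W ⊓ U₁) := fun k => res (hle.trans (inf_le_inf_left _ inf_le_right)) (s.1.2 k)
      have hab : b = (M.map ρ).mulVec a := by
        funext k
        have := congrArg (res hle) (s.2 k)
        simp only [map_sum, map_mul, res_res, res_self] at this
        exact this
      have hba : (N.map ρ).mulVec b = a := by
        rw [hab, Matrix.mulVec_mulVec, ← Matrix.map_mul, h',
          Matrix.map_one _ (map_zero _) (map_one _), Matrix.one_mulVec]
      refine Eq.trans ?_ (congrFun hba i)
      refine Finset.sum_congr rfl fun k _ => ?_
      change res _ (res _ (s.1.2 k)) * res _ (res _ (N i k)) = ρ (N i k) * res _ (s.1.2 k)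
      rw [res_res, res_res, mul_comm]
    · refine (hsnd _ i).trans ?_
      rw [res_res, res_self]

lemma isTransitionMatrix_clutch {M N : Matrix κ κ Γ(X, U₁ ⊓ U₂)} (h : M * N = 1) :
    IsTransitionMatrix U₁ U₂ (clutch M) M := by
  refine ⟨_, _, isFrame_clutchLeft M, isFrame_clutchRight h, fun j => ?_⟩
  simp only [resM_clutchMk, ← map_smul, ← map_sum]
  congr 1
  refine clutch_ext M (fun i => ?_) (fun i => ?_)
  · rw [clutch_sum_fst]
    have h' : N * M = 1 := mul_eq_one_comm.1 h
    have := congrArg (res (inf_le_left : (U₁ ⊓ U₂) ⊓ U₁ ≤ U₁ ⊓ U₂)) (congrFun (congrFun h' i) j)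
    rw [Matrix.mul_apply, map_sum] at this
    simp only [map_mul] at this
    change res _ ((Pi.single j 1 : κ → Γ(X, U₁ ⊓ U₁)) i) = ∑ k, res _ (M k j) * res _ (res _ (N i k))
    have e : res (inf_le_inf_right U₁ inf_le_left) ((Pi.single j 1 : κ → Γ(X, U₁ ⊓ U₁)) i) =
        res (inf_le_left : (U₁ ⊓ U₂) ⊓ U₁ ≤ U₁ ⊓ U₂) ((1 : Matrix κ κ Γ(X, U₁ ⊓ U₂)) i j) := by
      rw [Matrix.one_apply]
      by_cases hij : i = j
      · subst hij
        simp only [Pi.single_eq_same, map_one, if_true]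
      · simp only [Pi.single_eq_of_ne hij, map_zero, if_neg hij]
    rw [e, ← this]
    refine Finset.sum_congr rfl fun k _ => ?_
    rw [res_res, mul_comm]
  · rw [clutch_sum_snd, Finset.sum_eq_single i]
    · change res _ (M i j) = res _ (M i j) * res _ ((Pi.single i 1 : κ → Γ(X, U₂ ⊓ U₂)) i)
      rw [Pi.single_eq_same, map_one, mul_one]
    · intro l _ hl
      change _ * res _ ((Pi.single l 1 : κ → Γ(X, U₂ ⊓ U₂)) i) = _
      rw [Pi.single_eq_of_ne hl.symm, map_zero, mul_zero]
    · simp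

end ClutchFrames

/-! ### Sections over basic open subsets -/

section Affine

variable {X : Scheme.{0}}

/-- Every sufficiently large exponent is allowed, so that finitely many functions can be extended
with the same power. -/
lemma exists_res_eq_pow_mul {U : X.Opens} (hU : IsAffineOpen U) (g : Γ(X, U))
    (s : Γ(X, X.basicOpen g)) : ∃ N : ℕ, ∀ M ≥ N, ∃ s' : Γ(X, U),
      res (X.basicOpen_le g) s' = res (X.basicOpen_le g) g ^ M * s := by
  have := hU.isLocalization_basicOpen g
  obtain ⟨N, s', h⟩ := IsLocalization.Away.surj g s
  refine ⟨N, fun M hM => ⟨s' * g ^ (M - N), ?_⟩⟩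
  have h' : s * res (X.basicOpen_le g) g ^ N = res (X.basicOpen_le g) s' := h
  rw [map_mul, ← h', map_pow, mul_assoc, ← pow_add, Nat.add_sub_cancel' hM, mul_comm]

lemma isUnit_res_basicOpen {U : X.Opens} (g : Γ(X, U)) :
    IsUnit (res (X.basicOpen_le g) g : Γ(X, X.basicOpen g)) :=
  X.toRingedSpace.isUnit_res_basicOpen g

variable [IsIntegral X] {F : X.Modules}

lemma res_injective {U V : X.Opens} (h : V ≤ U) (hV : (V : Set X).Nonempty) :
    Function.Injective (res h : Γ(X, U) →+* Γ(X, V)) := by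
  have : Nonempty V := hV.to_subtype
  exact map_injective_of_isIntegral X (homOfLE h)

lemma nonempty_inf {U V : X.Opens} (hU : (U : Set X).Nonempty) (hV : (V : Set X).Nonempty) :
    ((U ⊓ V : X.Opens) : Set X).Nonempty :=
  nonempty_preirreducible_inter U.2 V.2 hU hV

/-- In a local frame the coordinates are functions on an integral scheme, hence determined on any
nonempty open. The nonemptiness hypothesis is conditional so that `U` may be empty. -/
lemma resM_injective (hF : IsVectorBundle F) {U V : X.Opens} (h : V ≤ U)
    (hV : (U : Set X).Nonempty → (V : Set X).Nonempty) : Function.Injective (resM F h) := by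
  intro s s' e
  refine section_ext F fun x hx => ?_
  obtain ⟨W, hxW, n, v, hv⟩ := hF x
  refine ⟨U ⊓ W, inf_le_left, ⟨hx, hxW⟩, ?_⟩
  refine (hv.coords (U ⊓ W) inf_le_right).injective (funext fun k => ?_)
  have hne : (((U ⊓ W) ⊓ V : X.Opens) : Set X).Nonempty :=
    nonempty_inf ⟨x, hx, hxW⟩ (hV ⟨x, hx⟩)
  refine res_injective (inf_le_left : (U ⊓ W) ⊓ V ≤ U ⊓ W) hne ?_
  rw [hv.res_coords, hv.res_coords, resM_resM, resM_resM]
  have := congrArg (resM F (inf_le_right : (U ⊓ W) ⊓ V ≤ V)) e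
  rw [resM_resM, resM_resM] at this
  rw [this]

/-- A section over a basic open subset of an affine open subset, multiplied by a suitable power of
the function, extends. -/
lemma exists_resM_eq_pow_smul (hF : IsVectorBundle F) {U : X.Opens} (hU : IsAffineOpen U)
    {g : Γ(X, U)} (hg : (X.basicOpen g : Set X).Nonempty) (s : Γ(F, X.basicOpen g)) :
    ∃ (N : ℕ) (s' : Γ(F, U)),
      resM F (X.basicOpen_le g) s' = res (X.basicOpen_le g) g ^ N • s := by
  -- On a basic open inside a trivialising neighbourhood, the coordinates of `s` extend after
  -- multiplication by a power of `g`. Again all large exponents work, so a finite subcover can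
  -- share one.
  have local_ext : ∀ x ∈ U, ∃ (V : X.Opens) (hV : V ≤ U), x ∈ V ∧ ∃ N : ℕ, ∀ M ≥ N,
      ∃ s' : Γ(F, V), resM F (inf_le_left : V ⊓ X.basicOpen g ≤ V) s' =
        resM F inf_le_right (res (X.basicOpen_le g) g ^ M • s) := by
    intro x hx
    obtain ⟨W, hxW, n, v, hv⟩ := hF x
    obtain ⟨f, hfW, hxf⟩ := hU.exists_basicOpen_le ⟨x, hxW⟩ hx
    let V := X.basicOpen f
    have hVU : V ≤ U := X.basicOpen_le f
    have hV : IsAffineOpen V := hU.basicOpen f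
    let g' : Γ(X, V) := res hVU g
    have hb : X.basicOpen g' = V ⊓ X.basicOpen g := X.basicOpen_res g (homOfLE hVU).op
    choose N hN using fun k => exists_res_eq_pow_mul hV g'
      (hv.coords (X.basicOpen g') ((X.basicOpen_le g').trans hfW)
        (resM F (hb.le.trans inf_le_right) s) k)
    refine ⟨V, hVU, hxf, Finset.univ.sup N, fun M hM => ?_⟩
    choose c hc using fun k => hN k M ((Finset.le_sup (Finset.mem_univ k)).trans hM)
    refine ⟨∑ k, c k • resM F hfW (v k), ?_⟩
    have key : resM F (X.basicOpen_le g') (∑ k, c k • resM F hfW (v k)) =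
        res (hb.le.trans inf_le_right) (res (X.basicOpen_le g) g ^ M) •
          resM F (hb.le.trans inf_le_right) s := by
      rw [← hv.sum_coords ((X.basicOpen_le g').trans hfW) (resM F (hb.le.trans inf_le_right) s)]
      simp only [resM_sum_smul, resM_resM, hc, Finset.smul_sum, map_pow, res_res, smul_smul, g']
    have := congrArg (resM F hb.ge) key
    rw [resM_resM, resM_smul, resM_resM, res_res] at this
    rw [resM_smul]
    exact this
  choose! V hVU hxV N hN using local_ext
  obtain ⟨T, hT⟩ := hU.isCompact.elim_nhds_subcover (fun x => (V x : Set X))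
    (fun x hx => (V x).2.mem_nhds (hxV x hx))
  have hg' : ∀ W : X.Opens, (W : Set X).Nonempty → ((W ⊓ X.basicOpen g : X.Opens) : Set X).Nonempty :=
    fun W hW => nonempty_inf hW hg
  -- The local extensions agree on overlaps because a section is determined by its restriction to
  -- the locus where `g` is invertible.
  obtain ⟨s', hs'⟩ := exists_section_of_local F (U := U) (fun W t => W ≤ U ∧
    resM F (inf_le_left : W ⊓ X.basicOpen g ≤ W) t =
      resM F inf_le_right (res (X.basicOpen_le g) g ^ (T.sup N) • s)) (by
        rintro W W' h - t ⟨hWU, ht⟩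
        refine ⟨h.trans hWU, ?_⟩
        have := congrArg (resM F (inf_le_inf_right (X.basicOpen g) h)) ht
        simpa only [resM_resM] using this) (by
        rintro W - t t' ⟨-, ht⟩ ⟨-, ht'⟩
        exact resM_injective hF inf_le_left (hg' W) (ht.trans ht'.symm)) (by
        intro x hx
        obtain ⟨y, hy, hxy⟩ := Set.mem_iUnion₂.1 (hT.2 hx)
        obtain ⟨t, ht⟩ := hN y (hT.1 y hy) (T.sup N) (Finset.le_sup hy)
        exact ⟨V y, hVU y (hT.1 y hy), hxy, t, hVU y (hT.1 y hy), ht⟩)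
  refine ⟨T.sup N, s', section_ext F fun x hx => ?_⟩
  obtain ⟨W, hW, hxW, -, h⟩ := hs' x (X.basicOpen_le g hx)
  refine ⟨W ⊓ X.basicOpen g, inf_le_right, ⟨hxW, hx⟩, ?_⟩
  rw [resM_resM] at h
  rw [resM_resM]
  exact h

lemma smul_eq_zero_of_isVectorBundle (hF : IsVectorBundle F) {U : X.Opens} {r : Γ(X, U)}
    {s : Γ(F, U)} (h : r • s = 0) (hr : r ≠ 0) : s = 0 := by
  refine section_ext F fun x hx => ?_
  obtain ⟨W, hxW, n, v, hv⟩ := hF x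
  have hne : ((U ⊓ W : X.Opens) : Set X).Nonempty := ⟨x, hx, hxW⟩
  refine ⟨U ⊓ W, inf_le_left, ⟨hx, hxW⟩, (hv.coords _ inf_le_right).injective (funext fun k => ?_)⟩
  have : Nonempty (U ⊓ W : X.Opens) := hne.to_subtype
  have h1 := congrArg (resM F (inf_le_left : U ⊓ W ≤ U)) h
  rw [resM_smul, map_zero] at h1
  have h2 := congrFun (congrArg (hv.coords _ inf_le_right) h1) k
  rw [map_smul, map_zero, Pi.smul_apply, smul_eq_mul, Pi.zero_apply, mul_eq_zero] at h2
  rw [map_zero, map_zero]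
  exact h2.resolve_left fun h3 => hr (res_injective inf_le_left hne (h3.trans (map_zero _).symm))

end Affine

/-! ### Triviality over principal ideal domains -/

section Affine

variable {X : Scheme.{0}} [IsIntegral X] {F : X.Modules}

/-- A vector bundle on an integral affine scheme is trivial if the ring of functions is a principal
ideal domain. -/
theorem exists_isFrame_of_isPrincipalIdealRing (hF : IsVectorBundle F) {U : X.Opens}
    (hU : IsAffineOpen U) (hne : (U : Set X).Nonempty) [IsPrincipalIdealRing Γ(X, U)] :
    ∃ (n : ℕ) (v : Fin n → Γ(F, U)), IsFrame F U v := by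
  have : Nonempty U := hne.to_subtype
  have hloc : ∀ x ∈ U, ∃ g : Γ(X, U), x ∈ X.basicOpen g ∧
      ∃ (n : ℕ) (v : Fin n → Γ(F, X.basicOpen g)), IsFrame F (X.basicOpen g) v := by
    intro x hx
    obtain ⟨W, hxW, n, v, hv⟩ := hF x
    obtain ⟨f, hfW, hxf⟩ := hU.exists_basicOpen_le ⟨x, hxW⟩ hx
    exact ⟨f, hxf, n, _, hv.mono hfW⟩
  choose! g hxg n v hv using hloc
  obtain ⟨T, hT⟩ := hU.isCompact.elim_nhds_subcover (fun x => (X.basicOpen (g x) : Set X))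
    (fun x hx => (X.basicOpen (g x)).2.mem_nhds (hxg x hx))
  have hext : ∀ (x : T) (k : Fin (n x.1)), ∃ (N : ℕ) (s : Γ(F, U)),
      resM F (X.basicOpen_le (g x.1)) s = res (X.basicOpen_le (g x.1)) (g x.1) ^ N • v x.1 k :=
    fun x k => exists_resM_eq_pow_smul hF hU ⟨x.1, hxg x.1 (hT.1 x.1 x.2)⟩ (v x.1 k)
  choose N s hs using hext
  -- The span of the local frames with denominators cleared. It need not be shown to be all of `Γ(F,
  -- U)`: it is finitely generated and torsion-free, hence free, and contains every local frame up
  -- to units, so a basis of it restricts to frames.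
  let S : Submodule Γ(X, U) Γ(F, U) :=
    Submodule.span _ (Set.range fun p : Σ x : T, Fin (n x.1) => s p.1 p.2)
  have : Module.Finite Γ(X, U) S :=
    Module.Finite.span_of_finite _ (Set.finite_range _)
  have : Module.IsTorsionFree Γ(X, U) S := by
    refine Module.IsTorsionFree.of_smul_eq_zero fun r m h => ?_
    by_cases hr : r = 0
    · exact Or.inl hr
    · refine Or.inr (Subtype.ext (smul_eq_zero_of_isVectorBundle hF ?_ hr))
      exact congrArg Subtype.val h
  have : Module.Free Γ(X, U) S := Module.free_of_finite_type_torsion_free'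
  let b := Module.finBasis Γ(X, U) S
  let e : Fin (Module.finrank Γ(X, U) S) → Γ(F, U) := fun j => (b j : Γ(F, U))
  refine ⟨_, e, isFrame_of_local fun y hy => ?_⟩
  obtain ⟨x, hxT, hyx⟩ := Set.mem_iUnion₂.1 (hT.2 hy)
  have hx : x ∈ U := hT.1 x hxT
  let V := X.basicOpen (g x)
  have hVU : V ≤ U := X.basicOpen_le (g x)
  have hVne : (V : Set X).Nonempty := ⟨x, hxg x hx⟩
  have hfr : IsFrame F V (v x) := hv x hx
  obtain ⟨A, hA⟩ := hfr.exists_matrix fun j => resM F hVU (e j)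
  have hunit : IsUnit (res hVU (g x)) := isUnit_res_basicOpen (g x)
  have hB : ∀ k, ∃ c : Fin (Module.finrank Γ(X, U) S) → Γ(X, V),
      v x k = ∑ j, c j • resM F hVU (e j) := by
    intro k
    have hmem : s ⟨x, hxT⟩ k ∈ S := Submodule.subset_span ⟨⟨⟨x, hxT⟩, k⟩, rfl⟩
    have h1 : s ⟨x, hxT⟩ k = ∑ j, b.repr ⟨_, hmem⟩ j • e j := by
      have := congrArg S.subtype (b.sum_repr ⟨_, hmem⟩)
      simp only [map_sum, map_smul] at this
      exact this.symm
    have h2 := congrArg (resM F hVU) h1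
    rw [hs ⟨x, hxT⟩ k, resM_sum_smul] at h2
    obtain ⟨u, hu⟩ := hunit.pow (N ⟨x, hxT⟩ k)
    refine ⟨fun j => ↑u⁻¹ * res hVU (b.repr ⟨_, hmem⟩ j), ?_⟩
    simp only [mul_smul]
    rw [← Finset.smul_sum, ← h2, ← hu, smul_smul, Units.inv_mul, one_smul]
  choose c hc using hB
  let B : Matrix (Fin (Module.finrank Γ(X, U) S)) (Fin (n x)) Γ(X, V) := fun j k => c k j
  have hAB : A * B = 1 := by
    refine eq_one_of_sum_eq hfr fun k => ?_
    conv_lhs => rw [hc k]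
    simp only [hA]
    exact sum_smul_sum A (fun j => B j k) (v x)
  have hBA : B * A = 1 := by
    -- A basis of `S` stays linearly independent on the basic open: clear the denominators of a
    -- relation and use that restriction of sections is injective.
    have inj : ∀ f : Fin (Module.finrank Γ(X, U) S) → Γ(X, V),
        ∑ j, f j • resM F hVU (e j) = 0 → f = 0 := by
      intro f hf
      have := hU.isLocalization_basicOpen (g x)
      obtain ⟨r, hr⟩ := IsLocalization.exist_integer_multiples_of_finite
        (Submonoid.powers (g x)) f
      choose a ha using hr
      have ha' : ∀ j, res hVU (a j) = res hVU (r : Γ(X, U)) * f j := ha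
      have h3 : ∑ j, a j • e j = 0 := by
        refine resM_injective hF hVU (fun _ => hVne) ?_
        rw [resM_sum_smul, map_zero]
        simp only [ha', mul_smul]
        rw [← Finset.smul_sum, hf, smul_zero]
      have h4 : ∑ j, a j • b j = 0 := Subtype.ext (by simpa [e] using h3)
      have h5 := Fintype.linearIndependent_iff.1 b.linearIndependent a h4
      funext j
      have h6 := ha' j
      rw [h5 j, map_zero] at h6
      obtain ⟨m, hm⟩ := r.2
      have hru : IsUnit (res hVU (r : Γ(X, U))) := by
        rw [← hm]
        simpa only [map_pow] using hunit.pow m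
      exact (hru.mul_right_eq_zero).1 h6.symm
    ext i j
    have h7 := inj (fun i => (B * A) i j - (1 : Matrix _ _ Γ(X, V)) i j) ?_
    · exact sub_eq_zero.1 (congrFun h7 i)
    · simp only [sub_smul, Finset.sum_sub_distrib]
      rw [sub_eq_zero]
      have h8 := sum_smul_sum B (fun i => A i j) (fun j => resM F hVU (e j))
      have h9 : ∑ i, A i j • ∑ l, B l i • resM F hVU (e l) = resM F hVU (e j) := by
        rw [hA j]
        exact Finset.sum_congr rfl fun i _ => by rw [hc i]
      refine (h8.symm.trans h9).trans ?_
      rw [Finset.sum_eq_single j]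
      · rw [Matrix.one_apply_eq, one_smul]
      · intro l _ hl
        rw [Matrix.one_apply_ne hl, zero_smul]
      · simp
  refine ⟨V, hVU, hyx, ?_⟩
  have := isFrame_of_matrix hfr hAB hBA
  simpa only [← hA] using this

end Affine

/-! ### Functions on the charts of the conic -/

section

open HomogeneousLocalization

/-- The structure map from the constants to the functions on an open subset of the conic. -/
def const (W : conic.Opens) : ℝ →+* Γ(conic, W) :=
  (res le_top).comp ((Scheme.ΓSpecIso (.of ℝ)).inv ≫ conicToSpec.appTop).hom

lemma res_const {U V : conic.Opens} (h : V ≤ U) (c : ℝ) : res h (const U c) = const V c :=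
  res_res _ _ _

lemma basicOpen_ι_conicToSpec (j : Fin 3) :
    (Proj.basicOpen grading (coord j)).ι ≫ conicToSpec =
      Proj.basicOpenToSpec grading (coord j) ≫ Spec.map (CommRingCat.ofHom
        ((fromZeroRingHom grading _).comp (algebraMap ℝ (grading 0)))) := by
  have h := Proj.awayι_toSpecZero grading (coord j) (coord_mem j) one_pos
  rw [Proj.awayι, Category.assoc, Iso.inv_comp_eq, Proj.basicOpenIsoSpec_hom] at h
  rw [conicToSpec, reassoc_of% h, CommRingCat.ofHom_comp, Spec.map_comp]

/-- Constants are defined through the structure morphism, as in the definition of the differentials;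
this matches them with the degree zero constants of the homogeneous localisation, where computations
take place. -/
lemma const_basicOpen (j : Fin 3) (c : ℝ) :
    const (Proj.basicOpen grading (coord j)) c = Proj.awayToSection grading (coord j)
      (fromZeroRingHom grading _ (algebraMap ℝ (grading 0) c)) := by
  have h := congrArg Scheme.Hom.appTop (basicOpen_ι_conicToSpec j)
  rw [Scheme.Hom.comp_appTop, Scheme.Hom.comp_appTop] at h
  have h2 := Proj.basicOpenToSpec_app_top grading (coord j)
  change (Proj.basicOpenToSpec grading (coord j)).appTop = _ at h2
  rw [h2] at h
  have h3 := congrArg (fun f => (Scheme.ΓSpecIso (.of ℝ)).inv ≫ f ≫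
    (Proj.basicOpen grading (coord j)).topIso.hom) h
  simp only [Category.assoc, Iso.inv_hom_id, Category.comp_id] at h3
  rw [Scheme.ΓSpecIso_naturality_assoc, Iso.inv_hom_id_assoc] at h3
  have h4 := congrArg (fun f => f.hom c) h3
  refine Eq.trans ?_ h4
  simp only [const, RingHom.comp_apply, CommRingCat.hom_comp]
  rfl

/-- Dehomogenisation with respect to the coordinate of index `j`. -/
def dehom (j : Fin 3) : MvPolynomial (Fin 3) ℝ →+* Away grading (coord j) :=
  MvPolynomial.eval₂Hom ((fromZeroRingHom grading _).comp (algebraMap ℝ (grading 0)))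
    fun i => Away.mk grading (coord_mem j) 1 (coord i) (by simpa using coord_mem i)

lemma val_mk_mul_pow (j : Fin 3) (n : ℕ) (a : CoordRing) (ha : a ∈ grading (n • 1)) :
    (Away.mk grading (coord_mem j) n a ha).val * algebraMap CoordRing _ (coord j) ^ n =
      algebraMap CoordRing (Localization.Away (coord j)) a := by
  rw [Away.val_mk, ← Localization.mk_one_eq_algebraMap, Localization.mk_pow, Localization.mk_mul,
    ← Localization.mk_one_eq_algebraMap, Localization.mk_eq_mk_iff]
  refine Localization.r_of_eq ?_
  simp [mul_comm]

lemma val_mk_mul (i j : Fin 3) :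
    (Away.mk grading (coord_mem j) 1 (coord i) (by simpa using coord_mem i)).val *
      algebraMap CoordRing _ (coord j) = algebraMap CoordRing (Localization.Away (coord j)) (coord i) :=
  (congrArg (_ * ·) (pow_one _).symm).trans (val_mk_mul_pow j 1 (coord i) _)

/-- Every monomial of degree `n` acquires `n` denominators, one for each factor, and these are
cancelled by the `n`-th power of the coordinate. -/
lemma val_dehom_mul_pow (j : Fin 3) (n : ℕ) (p : MvPolynomial (Fin 3) ℝ) (hp : p.IsHomogeneous n) :
    (dehom j p).val * algebraMap CoordRing _ (coord j) ^ n =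
      algebraMap CoordRing _ (Ideal.Quotient.mk _ p) := by
  let φ : MvPolynomial (Fin 3) ℝ →+* Localization.Away (coord j) :=
    (algebraMap (Away grading (coord j)) _).comp (dehom j)
  let ψ : MvPolynomial (Fin 3) ℝ →+* Localization.Away (coord j) :=
    (algebraMap CoordRing _).comp (Ideal.Quotient.mk _)
  have hX : ∀ i, φ (MvPolynomial.X i) * algebraMap CoordRing _ (coord j) =
      ψ (MvPolynomial.X i) := by
    intro i
    change (dehom j (MvPolynomial.X i)).val * _ = algebraMap CoordRing _ (coord i)
    rw [dehom, MvPolynomial.coe_eval₂Hom, MvPolynomial.eval₂_X]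
    exact val_mk_mul i j
  have hC : ∀ c, φ (MvPolynomial.C c) = ψ (MvPolynomial.C c) := by
    intro c
    change (dehom j (MvPolynomial.C c)).val = _
    rw [dehom, MvPolynomial.coe_eval₂Hom, MvPolynomial.eval₂_C]
    rfl
  change φ p * _ = ψ p
  rw [p.as_sum, map_sum, map_sum, Finset.sum_mul]
  refine Finset.sum_congr rfl fun d hd => ?_
  have hdeg : d.sum (fun _ k => k) = n := by
    have := hp (MvPolynomial.mem_support_iff.mp hd)
    simpa [Finsupp.weight_apply] using this
  rw [MvPolynomial.monomial_eq, map_mul, map_mul, hC, mul_assoc, Finsupp.prod, map_prod, map_prod,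
    ← hdeg, Finsupp.sum, ← Finset.prod_pow_eq_pow_sum, ← Finset.prod_mul_distrib]
  congr 1
  refine Finset.prod_congr rfl fun i _ => ?_
  rw [map_pow, map_pow, ← mul_pow, hX]

lemma dehom_surjective (j : Fin 3) : Function.Surjective (dehom j) := by
  intro a
  obtain ⟨n, _, ⟨p, hp, rfl⟩, rfl⟩ := Away.mk_surjective grading (coord_mem j) a
  refine ⟨p, val_injective _ ?_⟩
  have hu : IsUnit (algebraMap CoordRing (Localization.Away (coord j)) (coord j) ^ n) :=
    (IsLocalization.Away.algebraMap_isUnit (coord j)).pow n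
  have hp' : p.IsHomogeneous n := by simpa using hp
  refine hu.mul_left_injective ?_
  change _ * _ = _ * _
  rw [val_dehom_mul_pow j n p hp']
  exact (val_mk_mul_pow j n _ _).symm

/-- The polynomial functions on the open subset where the coordinate of index `j` does not
vanish. -/
def polyHom (j : Fin 3) :
    MvPolynomial (Fin 3) ℝ →+* Γ(conic, Proj.basicOpen grading (coord j)) :=
  MvPolynomial.eval₂Hom (const _) fun i => coordDiv i j

lemma polyHom_eq (j : Fin 3) (p : MvPolynomial (Fin 3) ℝ) :
    polyHom j p = Proj.awayToSection grading (coord j) (dehom j p) := by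
  change polyHom j p = ((Proj.awayToSection grading (coord j)).hom.comp (dehom j)) p
  congr 1
  refine MvPolynomial.ringHom_ext (fun c => ?_) fun i => ?_
  · simp [polyHom, dehom, const_basicOpen]
  · simp [polyHom, dehom, coordDiv]

lemma awayToSection_bijective (j : Fin 3) :
    Function.Bijective (Proj.awayToSection grading (coord j)) :=
  ConcreteCategory.bijective_of_isIso (Proj.basicOpenIsoAway grading (coord j) (coord_mem j) one_pos).hom

lemma polyHom_surjective (j : Fin 3) : Function.Surjective (polyHom j) := by
  intro a
  obtain ⟨b, rfl⟩ := (awayToSection_bijective j).2 a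
  obtain ⟨p, rfl⟩ := dehom_surjective j b
  exact ⟨p, polyHom_eq j p⟩

lemma coordDiv_self (j : Fin 3) : coordDiv j j = 1 := by
  rw [coordDiv, ← map_one (Proj.awayToSection grading (coord j)).hom]
  congr 1
  refine val_injective _ ?_
  rw [Away.val_mk, HomogeneousLocalization.val_one, ← Localization.mk_one, Localization.mk_eq_mk_iff]
  refine Localization.r_of_eq ?_
  simp

lemma coordDiv_sq_sum (j : Fin 3) :
    coordDiv 0 j ^ 2 + coordDiv 1 j ^ 2 + coordDiv 2 j ^ 2 = 0 := by
  have h : dehom j quadric = 0 := by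
    refine val_injective _ ?_
    have hu : IsUnit (algebraMap CoordRing (Localization.Away (coord j)) (coord j) ^ 2) :=
      (IsLocalization.Away.algebraMap_isUnit (coord j)).pow 2
    refine hu.mul_left_injective ?_
    change _ * _ = _ * _
    rw [val_dehom_mul_pow j 2 _ quadric_mem, Ideal.Quotient.eq_zero_iff_mem.mpr
      (Ideal.mem_span_singleton_self quadric), HomogeneousLocalization.val_zero, map_zero, zero_mul]
  have := polyHom_eq j quadric
  rw [h, map_zero] at this
  simpa [polyHom, quadric] using this

variable {B : Type} [CommRing B]

/-- The ring homomorphism from the coordinate ring with given values on constants and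
coordinates. -/
def coordLift (f : ℝ →+* B) (w : Fin 3 → B) (hw : w 0 ^ 2 + w 1 ^ 2 + w 2 ^ 2 = 0) :
    CoordRing →+* B :=
  Ideal.Quotient.lift _ (MvPolynomial.eval₂Hom f w) fun a ha => by
    obtain ⟨b, rfl⟩ := Ideal.mem_span_singleton'.mp ha
    simp [quadric, hw]

/-- Evaluation of the functions on the open subset where the coordinate of index `j` does not vanish
at a point with values in a ring. -/
lemma exists_evaluation (j : Fin 3) (f : ℝ →+* B) (w : Fin 3 → B)
    (hw : w 0 ^ 2 + w 1 ^ 2 + w 2 ^ 2 = 0) (hj : w j = 1) :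
    ∃ φ : Γ(conic, Proj.basicOpen grading (coord j)) →+* B,
      (∀ c, φ (const _ c) = f c) ∧ ∀ i, φ (coordDiv i j) = w i := by
  have hc : ∀ i, coordLift f w hw (coord i) = w i := fun i => by simp [coordLift, coord]
  have hu : IsUnit (coordLift f w hw (coord j)) := by rw [hc, hj]; exact isUnit_one
  let e := RingEquiv.ofBijective (Proj.awayToSection grading (coord j)).hom (awayToSection_bijective j)
  let g : Localization.Away (coord j) →+* B := Localization.awayLift (coordLift f w hw) _ hu
  have hg : ∀ a, g (algebraMap CoordRing _ a) = coordLift f w hw a :=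
    IsLocalization.Away.lift_eq _ hu
  refine ⟨(g.comp (algebraMap (Away grading (coord j)) _)).comp e.symm.toRingHom, fun c => ?_,
    fun i => ?_⟩
  · rw [const_basicOpen]
    change g (algebraMap (Away grading (coord j)) _ (e.symm (e _))) = _
    rw [e.symm_apply_apply]
    change g (algebraMap CoordRing _ (algebraMap ℝ CoordRing c)) = _
    rw [hg]
    change coordLift f w hw (Ideal.Quotient.mk _ (MvPolynomial.C c)) = _
    simp [coordLift]
  · change g (algebraMap (Away grading (coord j)) _ (e.symm (e _))) = _
    rw [e.symm_apply_apply]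
    change g (Away.mk grading (coord_mem j) 1 (coord i) _).val = _
    have : g ((Away.mk grading (coord_mem j) 1 (coord i) (by simpa using coord_mem i)).val *
        algebraMap CoordRing _ (coord j)) = w i := by
      rw [val_mk_mul i j, hg, hc]
    rwa [map_mul, hg, hc, hj, mul_one] at this

end

/-! ### The ring `ℝ[a, b] / (a² + b² + 1)` -/

section

open Polynomial

/-- The algebra `B` over the real numbers is the coordinate ring `ℝ[a, b] / (a² + b² + 1)`. -/
structure IsConicRing {B : Type} [CommRing B] [Algebra ℝ B] (a b : B) : Prop where
  rel : a ^ 2 + b ^ 2 + 1 = 0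
  exists_eq : ∀ f : B, ∃ p q : ℝ[X], f = aeval b p + a * aeval b q
  eq_zero : ∀ p q : ℝ[X], aeval b p + a * aeval b q = 0 → p = 0 ∧ q = 0

/-- At a real number both summands are nonnegative and 1 + r² is positive, so both polynomials
vanish at every real number. -/
lemma eq_zero_of_sq_add_eq_zero {p q : ℝ[X]} (h : p ^ 2 + (1 + X ^ 2) * q ^ 2 = 0) :
    p = 0 ∧ q = 0 := by
  have h1 : ∀ r : ℝ, p.eval r = 0 ∧ q.eval r = 0 := by
    intro r
    have h2 := congrArg (Polynomial.eval r) h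
    simp only [eval_add, eval_mul, eval_pow, eval_one, eval_X, eval_zero] at h2
    have h3 : q.eval r ^ 2 = 0 := by
      nlinarith [sq_nonneg (p.eval r), sq_nonneg (q.eval r), sq_nonneg (r * q.eval r)]
    have h4 : p.eval r ^ 2 = 0 := by rw [h3] at h2; linarith
    exact ⟨pow_eq_zero_iff two_ne_zero |>.mp h4, pow_eq_zero_iff two_ne_zero |>.mp h3⟩
  exact ⟨Polynomial.funext fun r => by simpa using (h1 r).1,
    Polynomial.funext fun r => by simpa using (h1 r).2⟩

namespace IsConicRing

variable {B : Type} [CommRing B] [Algebra ℝ B] {a b : B} (h : IsConicRing a b)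
include h

lemma mem_subalgebra (S : Subalgebra ℝ B) (ha : a ∈ S) (hb : b ∈ S) (f : B) : f ∈ S := by
  obtain ⟨p, q, rfl⟩ := h.exists_eq f
  have hp : ∀ p : ℝ[X], aeval b p ∈ S := fun p => by
    have e : aeval b p = _ := Subalgebra.aeval_coe S ⟨b, hb⟩ p
    rw [e]
    exact SetLike.coe_mem _
  exact S.add_mem (hp p) (S.mul_mem ha (hp q))

/-- Multiply by the conjugate p - aq: since a² = -(1 + b²), the product is the norm p² + (1 + b²)q²,
a polynomial in b alone. -/
lemma exists_norm {f : B} (hf : f ≠ 0) :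
    ∃ (g : B) (r : ℝ[X]), r ≠ 0 ∧ f * g = aeval b r := by
  obtain ⟨p, q, rfl⟩ := h.exists_eq f
  refine ⟨aeval b p - a * aeval b q, p ^ 2 + (1 + X ^ 2) * q ^ 2, fun h0 => hf ?_, ?_⟩
  · obtain ⟨rfl, rfl⟩ := eq_zero_of_sq_add_eq_zero h0
    simp
  · simp only [map_add, map_mul, map_pow, map_one, aeval_X]
    linear_combination (-(aeval b q) ^ 2) * h.rel

lemma aeval_injective {r : ℝ[X]} (hr : aeval b r = 0) : r = 0 :=
  (h.eq_zero r 0 (by simp [hr])).1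

/-- Nonzero elements have nonzero multiples in ℝ[b], and these multiply as polynomials do. -/
lemma isDomain : IsDomain B := by
  have : Nontrivial B := by
    refine ⟨⟨0, 1, fun h0 => one_ne_zero (h.aeval_injective (r := 1) ?_)⟩⟩
    simp [← h0]
  have : NoZeroDivisors B := by
    refine ⟨fun {f g} hfg => ?_⟩
    by_contra! hne
    obtain ⟨f', r, hr, hr'⟩ := h.exists_norm hne.1
    obtain ⟨g', s, hs, hs'⟩ := h.exists_norm hne.2
    refine mul_ne_zero hr hs (h.aeval_injective ?_)
    rw [map_mul, ← hr', ← hs', mul_mul_mul_comm, hfg, zero_mul]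
  exact NoZeroDivisors.to_isDomain B

/-- The norm of a nonzero element of the prime makes b, hence a, algebraic modulo the prime. The
quotient is thus a domain algebraic over ℝ, that is, an algebraic field extension, and embeds in ℂ.
-/
lemma exists_algHom_complex (𝔭 : Ideal B) [𝔭.IsPrime] (h𝔭 : 𝔭 ≠ ⊥) :
    ∃ ψ : B →ₐ[ℝ] ℂ, ∀ f, ψ f = 0 ↔ f ∈ 𝔭 := by
  obtain ⟨f, hf, hf0⟩ := 𝔭.ne_bot_iff.mp h𝔭
  obtain ⟨g, r, hr, hr'⟩ := h.exists_norm hf0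
  let π : B →ₐ[ℝ] B ⧸ 𝔭 := Ideal.Quotient.mkₐ ℝ 𝔭
  have hb : IsAlgebraic ℝ (π b) := by
    refine ⟨r, hr, ?_⟩
    rw [aeval_algHom_apply, ← hr']
    exact Ideal.Quotient.eq_zero_iff_mem.mpr (𝔭.mul_mem_right g hf)
  have ha : IsAlgebraic ℝ (π a) := by
    refine IsAlgebraic.of_pow two_pos ?_
    have e : π a ^ 2 = -(π b ^ 2 + 1) := by
      rw [← map_pow, ← map_pow, ← map_one π, ← map_add, ← map_neg]
      congr 1
      linear_combination h.rel
    rw [e]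
    exact ((hb.pow 2).add isAlgebraic_one).neg
  have halg : Algebra.IsAlgebraic ℝ (B ⧸ 𝔭) := by
    refine ⟨fun x => ?_⟩
    obtain ⟨f, rfl⟩ := Ideal.Quotient.mk_surjective x
    exact h.mem_subalgebra ((Subalgebra.algebraicClosure ℝ (B ⧸ 𝔭)).comap π) ha hb f
  let χ : B ⧸ 𝔭 →ₐ[ℝ] ℂ := IsAlgClosed.lift
  have hinj : Function.Injective χ := by
    have : Algebra.IsIntegral ℝ (B ⧸ 𝔭) := inferInstance
    let : Field (B ⧸ 𝔭) := (isField_of_isIntegral_of_isField' (R := ℝ) (Field.toIsField ℝ)).toField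
    exact χ.toRingHom.injective
  refine ⟨χ.comp π, fun f => ?_⟩
  rw [AlgHom.comp_apply, map_eq_zero_iff χ hinj]
  exact Ideal.Quotient.eq_zero_iff_mem

/-- The nonzero prime ideals are generated by linear polynomials. -/
lemma exists_prime_eq_span (𝔭 : Ideal B) [𝔭.IsPrime] (h𝔭 : 𝔭 ≠ ⊥) :
    ∃ α β γ : ℝ, (α ≠ 0 ∨ β ≠ 0) ∧
      𝔭 = Ideal.span {algebraMap ℝ B α * a + algebraMap ℝ B β * b + algebraMap ℝ B γ} := by
  obtain ⟨ψ, hψ⟩ := h.exists_algHom_complex 𝔭 h𝔭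
  set a₁ := (ψ a).re with ha1
  set a₂ := (ψ a).im with ha2
  set b₁ := (ψ b).re with hb1
  set b₂ := (ψ b).im with hb2
  have hrel : ψ a ^ 2 + ψ b ^ 2 + 1 = 0 := by
    rw [← map_pow, ← map_pow, ← map_one ψ, ← map_add, ← map_add, h.rel, map_zero]
  -- If both imaginary parts vanished, the point would be a real solution of a² + b² + 1 = 0.
  have hne : b₂ ≠ 0 ∨ -a₂ ≠ 0 := by
    by_contra! hc
    have e := congrArg Complex.re hrel
    simp only [pow_two, Complex.add_re, Complex.mul_re, Complex.one_re, Complex.zero_re, ← ha1,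
      ← hb1, ← ha2, ← hb2, hc.1, neg_eq_zero.mp hc.2] at e
    nlinarith [sq_nonneg a₁, sq_nonneg b₁]
  have hρ : a₂ ^ 2 + b₂ ^ 2 ≠ 0 := by
    intro h0
    have h1 : a₂ = 0 := by nlinarith [sq_nonneg a₂, sq_nonneg b₂]
    have h2 : b₂ = 0 := by nlinarith [sq_nonneg a₂, sq_nonneg b₂]
    simp [h1, h2] at hne
  -- The real line through the point (ψ a, ψ b) and its complex conjugate.
  refine ⟨b₂, -a₂, a₂ * b₁ - b₂ * a₁, hne, ?_⟩
  set c : ℝ →+* B := algebraMap ℝ B with hc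
  set ℓ : B := c b₂ * a + c (-a₂) * b + c (a₂ * b₁ - b₂ * a₁) with hℓ
  have hψc : ∀ r, ψ (c r) = r := fun r => ψ.commutes r
  have hℓmem : ℓ ∈ 𝔭 := by
    rw [← hψ, hℓ]
    simp only [map_add, map_mul, hψc]
    apply Complex.ext <;> simp [← ha1, ← ha2, ← hb1, ← hb2] <;> ring
  -- A linear form taking a nonreal value at the point; 1 and `w` will span the residue ring over ℝ.
  set w : B := c a₂ * a + c b₂ * b with hw
  have hψw : (ψ w).im ≠ 0 := by
    have : (ψ w).im = a₂ ^ 2 + b₂ ^ 2 := by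
      rw [hw]
      simp only [map_add, map_mul, hψc]
      simp [← ha1, ← ha2, ← hb1, ← hb2]
      ring
    rwa [this]
  -- Modulo `ℓ` every function is a real combination of 1 and `w`: the forms `ℓ` and `w` determine a
  -- and b through a linear system of determinant a₂² + b₂², and the conic relation makes w²
  -- constant modulo `ℓ`.
  have key : ∀ f : B, ∃ r s : ℝ, f - (c r + c s * w) ∈ Ideal.span {ℓ} := by
    have hunit : c (a₂ ^ 2 + b₂ ^ 2) * c (a₂ ^ 2 + b₂ ^ 2)⁻¹ = 1 := by
      rw [← map_mul, mul_inv_cancel₀ hρ, map_one]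
    set ρ := a₂ ^ 2 + b₂ ^ 2 with hρd
    set d := a₂ * b₁ - b₂ * a₁ with hd
    have hcρ : c ρ = c a₂ ^ 2 + c b₂ ^ 2 := by simp [hρd]
    have hww : w ^ 2 - c (-ρ - d ^ 2) ∈ Ideal.span {ℓ} := by
      refine Ideal.mem_span_singleton'.mpr ⟨-(ℓ - 2 * c d), ?_⟩
      have e : c (-ρ - d ^ 2) = -(c a₂ ^ 2 + c b₂ ^ 2) - c d ^ 2 := by
        rw [map_sub, map_neg, hcρ, map_pow]
      rw [e, hw, hℓ, map_neg]
      linear_combination (-(c a₂ ^ 2 + c b₂ ^ 2)) * h.rel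
    let S : Subalgebra ℝ B :=
      { carrier := {f | ∃ r s : ℝ, f - (c r + c s * w) ∈ Ideal.span {ℓ}}
        add_mem' := by
          rintro f g ⟨r, s, hf⟩ ⟨r', s', hg⟩
          refine ⟨r + r', s + s', ?_⟩
          have := Ideal.add_mem _ hf hg
          rw [map_add, map_add]
          convert this using 1
          ring
        mul_mem' := by
          rintro f g ⟨r, s, hf⟩ ⟨r', s', hg⟩
          refine ⟨r * r' + s * s' * (-ρ - d ^ 2), r * s' + s * r', ?_⟩
          have := Ideal.add_mem _ (Ideal.add_mem _ (Ideal.mul_mem_right g _ hf)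
            (Ideal.mul_mem_left _ (c r + c s * w) hg)) (Ideal.mul_mem_left _ (c s * c s') hww)
          convert this using 1
          simp only [map_add, map_mul]
          ring
        algebraMap_mem' := fun r => ⟨r, 0, by simp [← hc]⟩ }
    have haS : a ∈ S := by
      refine ⟨-(ρ⁻¹ * b₂ * d), ρ⁻¹ * a₂, Ideal.mem_span_singleton'.mpr ⟨c ρ⁻¹ * c b₂, ?_⟩⟩
      rw [hcρ] at hunit
      simp only [map_neg, map_mul]
      rw [hw, hℓ, map_neg]
      linear_combination a * hunit
    have hbS : b ∈ S := by
      refine ⟨ρ⁻¹ * a₂ * d, ρ⁻¹ * b₂, Ideal.mem_span_singleton'.mpr ⟨-(c ρ⁻¹ * c a₂), ?_⟩⟩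
      rw [hcρ] at hunit
      simp only [map_mul]
      rw [hw, hℓ, map_neg]
      linear_combination b * hunit
    exact h.mem_subalgebra S haS hbS
  refine le_antisymm (fun f hf => ?_) ((Ideal.span_singleton_le_iff_mem _).mpr hℓmem)
  obtain ⟨r, s, hrs⟩ := key f
  have hmem : c r + c s * w ∈ 𝔭 := by
    have := 𝔭.sub_mem hf ((Ideal.span_singleton_le_iff_mem _).mpr hℓmem hrs)
    simpa using this
  -- As ψ w is not real, the vanishing of r + s ψ w forces s = 0 and then r = 0.
  rw [← hψ, map_add, map_mul, hψc, hψc] at hmem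
  have him := congrArg Complex.im hmem
  have hre := congrArg Complex.re hmem
  simp only [Complex.add_im, Complex.ofReal_im, Complex.im_ofReal_mul, Complex.zero_im, zero_add,
    mul_eq_zero, hψw, or_false] at him
  subst him
  simp at hre
  subst hre
  simpa using hrs

lemma isPrincipalIdealRing : IsPrincipalIdealRing B := by
  refine IsPrincipalIdealRing.of_prime fun 𝔭 _ => ?_
  by_cases h𝔭 : 𝔭 = ⊥
  · subst h𝔭
    exact bot_isPrincipal
  · obtain ⟨α, β, γ, -, rfl⟩ := h.exists_prime_eq_span 𝔭 h𝔭
    exact ⟨⟨_, rfl⟩⟩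

end IsConicRing

end

/-! ### The charts of the conic and integrality -/

section

open Polynomial

section Integral

variable {X : Scheme.{0}}

/-- A scheme is integral if it is covered by two affine open subsets with nonempty intersection
whose rings of functions are domains. -/
lemma isIntegral_of_affine_cover {V₁ V₂ : X.Opens} (h₁ : IsAffineOpen V₁) (h₂ : IsAffineOpen V₂)
    (hV : V₁ ⊔ V₂ = ⊤) [IsDomain Γ(X, V₁)] [IsDomain Γ(X, V₂)]
    (hne : IsReduced X → ((V₁ ⊓ V₂ : X.Opens) : Set X).Nonempty) : IsIntegral X := by
  have key : ∀ V : X.Opens, IsAffineOpen V → IsDomain Γ(X, V) → IsIntegral V.toScheme := by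
    intro V hV hd
    have : IsAffine V.toScheme := hV
    have hd' : IsDomain Γ(V.toScheme, ⊤) := V.topIso.commRingCatIsoToRingEquiv.toMulEquiv.isDomain _
    have : Nonempty V.toScheme := by
      by_contra hemp
      rw [not_nonempty_iff] at hemp
      have : (⊤ : V.toScheme.Opens) = ⊥ := Subsingleton.elim _ _
      have hs : Subsingleton Γ(V.toScheme, ⊤) := by
        rw [this]; infer_instance
      exact not_subsingleton _ hs
    exact isIntegral_of_isAffine_of_isDomain _
  have i₁ := key V₁ h₁ inferInstance
  have i₂ := key V₂ h₂ inferInstance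
  -- Reducedness is local and comes first, since the hypothesis that the overlap is nonempty may
  -- depend on it.
  have hred : IsReduced X := by
    have : ∀ x : X, _root_.IsReduced (X.presheaf.stalk x) := by
      intro x
      have hx : x ∈ V₁ ⊔ V₂ := by rw [hV]; trivial
      rcases hx with hx | hx
      · have := @isReduced_stalk_of_isReduced V₁.toScheme inferInstance ⟨x, hx⟩
        exact isReduced_of_injective (V₁.stalkIso ⟨x, hx⟩).inv.hom
          (V₁.stalkIso ⟨x, hx⟩).symm.commRingCatIsoToRingEquiv.injective
      · have := @isReduced_stalk_of_isReduced V₂.toScheme inferInstance ⟨x, hx⟩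
        exact isReduced_of_injective (V₂.stalkIso ⟨x, hx⟩).inv.hom
          (V₂.stalkIso ⟨x, hx⟩).symm.commRingCatIsoToRingEquiv.injective
    exact isReduced_of_isReduced_stalk X
  have s₁ : IrreducibleSpace (V₁ : Set X) := inferInstanceAs (IrreducibleSpace V₁.toScheme)
  have s₂ : IrreducibleSpace (V₂ : Set X) := inferInstanceAs (IrreducibleSpace V₂.toScheme)
  have p₁ : IsIrreducible (V₁ : Set X) := .of_subtype
  have p₂ : IsIrreducible (V₂ : Set X) := .of_subtype
  have hcl : closure (V₁ : Set X) = Set.univ := by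
    refine Set.eq_univ_of_univ_subset fun x _ => ?_
    have hx : x ∈ V₁ ⊔ V₂ := by rw [hV]; trivial
    rcases hx with hx | hx
    · exact subset_closure hx
    · refine closure_mono Set.inter_subset_right
        (subset_closure_inter_of_isPreirreducible_of_isOpen p₂.2 V₁.2 ?_ hx)
      rw [Set.inter_comm]
      exact hne hred
  have hirr : IrreducibleSpace X := by
    rw [irreducibleSpace_def]
    exact (congrArg IsIrreducible hcl).mp (isIrreducible_iff_closure.mpr p₁)
  exact isIntegral_of_irreducibleSpace_of_isReduced X

end Integral

/-! ### The two charts of the conic and their overlap. -/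

instance (W : conic.Opens) : Algebra ℝ Γ(conic, W) := (const W).toAlgebra

lemma algebraMap_eq_const (W : conic.Opens) : algebraMap ℝ Γ(conic, W) = const W := rfl

lemma res_algebraMap {U V : conic.Opens} (h : V ≤ U) (c : ℝ) :
    res h (algebraMap ℝ _ c) = algebraMap ℝ _ c :=
  res_const h c

lemma isConicRing_coordDiv {j k : Fin 3} (hjk : j = 2 ∧ k = 1 ∨ j = 1 ∧ k = 2) :
    IsConicRing (coordDiv 0 j) (coordDiv k j) := by
  have hrel : coordDiv 0 j ^ 2 + coordDiv k j ^ 2 + 1 = 0 := by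
    have := coordDiv_sq_sum j
    rcases hjk with ⟨rfl, rfl⟩ | ⟨rfl, rfl⟩
    · rwa [coordDiv_self, one_pow] at this
    · rw [coordDiv_self, one_pow] at this
      linear_combination this
  refine ⟨hrel, fun f => ?_, fun p q hpq => ?_⟩
  · let S : Subalgebra ℝ Γ(conic, Proj.basicOpen grading (coord j)) :=
      { carrier := {f | ∃ p q : ℝ[X], f = aeval (coordDiv k j) p + coordDiv 0 j * aeval (coordDiv k j) q}
        add_mem' := by
          rintro _ _ ⟨p, q, rfl⟩ ⟨p', q', rfl⟩
          refine ⟨p + p', q + q', ?_⟩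
          simp only [map_add]
          ring
        mul_mem' := by
          rintro _ _ ⟨p, q, rfl⟩ ⟨p', q', rfl⟩
          refine ⟨p * p' - (1 + X ^ 2) * (q * q'), p * q' + q * p', ?_⟩
          simp only [map_add, map_sub, map_mul, map_pow, aeval_X, map_one]
          linear_combination (aeval (coordDiv k j) q) * (aeval (coordDiv k j) q') * hrel
        algebraMap_mem' := fun r => ⟨C r, 0, by simp⟩ }
    obtain ⟨P, rfl⟩ := polyHom_surjective j f
    change polyHom j P ∈ S
    induction P using MvPolynomial.induction_on with
    | C c =>
      rw [polyHom, MvPolynomial.coe_eval₂Hom, MvPolynomial.eval₂_C]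
      exact S.algebraMap_mem c
    | add p q hp hq => rw [map_add]; exact S.add_mem hp hq
    | mul_X p i hp =>
      rw [map_mul]
      refine S.mul_mem hp ?_
      have h0 : coordDiv 0 j ∈ S := ⟨0, 1, by simp⟩
      have h1 : coordDiv k j ∈ S := ⟨X, 0, by simp⟩
      have h2 : coordDiv j j ∈ S := by rw [coordDiv_self]; exact S.one_mem
      rw [polyHom, MvPolynomial.coe_eval₂Hom, MvPolynomial.eval₂_X]
      rcases hjk with ⟨rfl, rfl⟩ | ⟨rfl, rfl⟩ <;> fin_cases i <;> assumption
  -- The point with coordinates i√(1 + r²) and r lies on the conic. As the first coordinate is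
  -- purely imaginary and nonzero, the real and imaginary parts of the relation separate p(r) from
  -- q(r).
  · have key : ∀ r : ℝ, p.eval r = 0 ∧ q.eval r = 0 := by
      intro r
      set s : ℝ := Real.sqrt (1 + r ^ 2) with hs
      have hs2 : (s : ℂ) ^ 2 = 1 + r ^ 2 := by
        rw [← Complex.ofReal_pow, Real.sq_sqrt (by positivity)]
        push_cast
        ring
      have hs0 : s ≠ 0 := (Real.sqrt_pos.mpr (by positivity)).ne'
      obtain ⟨φ, hφ, hφ'⟩ := exists_evaluation j Complex.ofRealHom
        (fun i => if i = 0 then Complex.I * s else if i = k then (r : ℂ) else 1)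
        (by
          have e : (Complex.I * s) ^ 2 = -(1 + (r : ℂ) ^ 2) := by
            rw [mul_pow, Complex.I_sq, hs2]; ring
          rcases hjk with ⟨rfl, rfl⟩ | ⟨rfl, rfl⟩ <;> simp [e])
        (by rcases hjk with ⟨rfl, rfl⟩ | ⟨rfl, rfl⟩ <;> simp)
      have hk : φ (coordDiv k j) = r := by
        rw [hφ']
        rcases hjk with ⟨rfl, rfl⟩ | ⟨rfl, rfl⟩ <;> simp
      have hx : φ (coordDiv 0 j) = Complex.I * s := by rw [hφ']; simp
      have hev : ∀ p : ℝ[X], φ (aeval (coordDiv k j) p) = (p.eval r : ℝ) := by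
        intro p
        have hc : φ.comp (const _) = Complex.ofRealHom := RingHom.ext hφ
        rw [aeval_def, hom_eval₂, algebraMap_eq_const, hc, hk]
        exact eval₂_at_apply Complex.ofRealHom r
      have := congrArg φ hpq
      rw [map_add, map_mul, hev, hev, hx, map_zero] at this
      have hre := congrArg Complex.re this
      have him := congrArg Complex.im this
      simp [hs0] at hre him
      exact ⟨hre, him⟩
    exact ⟨Polynomial.funext fun r => by simpa using (key r).1,
      Polynomial.funext fun r => by simpa using (key r).2⟩

lemma isConicRing_R₁ : IsConicRing (coordDiv 0 2) (coordDiv 1 2) :=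
  isConicRing_coordDiv (.inl ⟨rfl, rfl⟩)

lemma isConicRing_R₂ : IsConicRing (coordDiv 0 1) (coordDiv 2 1) :=
  isConicRing_coordDiv (.inr ⟨rfl, rfl⟩)

instance : IsDomain R₁ := isConicRing_R₁.isDomain

instance : IsDomain R₂ := isConicRing_R₂.isDomain

instance : IsPrincipalIdealRing R₁ := isConicRing_R₁.isPrincipalIdealRing

instance : IsPrincipalIdealRing R₂ := isConicRing_R₂.isPrincipalIdealRing

/-- Where y and z vanish the relation gives x² = 0, and the three coordinates have no common zero.
-/
lemma U₁_sup_U₂ : U₁ ⊔ U₂ = ⊤ := by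
  have h : ⨆ i, Proj.basicOpen grading (coord i) = ⊤ := by
    refine Proj.iSup_basicOpen_eq_top' grading coord (fun i => ⟨1, coord_mem i⟩) ?_
    refine eq_top_iff.mpr fun a _ => ?_
    obtain ⟨p, rfl⟩ := Ideal.Quotient.mk_surjective a
    induction p using MvPolynomial.induction_on with
    | C c => exact Subalgebra.algebraMap_mem _ (algebraMap ℝ (grading 0) c)
    | add p q hp hq => rw [map_add]; exact Subalgebra.add_mem _ (hp trivial) (hq trivial)
    | mul_X p i hp =>
      rw [map_mul]
      exact Subalgebra.mul_mem _ (hp trivial) (Algebra.subset_adjoin ⟨i, rfl⟩)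
  refine top_le_iff.mp fun x hx => ?_
  rw [← h] at hx
  obtain ⟨i, hi⟩ := Opens.mem_iSup.mp hx
  by_contra hc
  have hz : coord 2 ∈ x.asHomogeneousIdeal := by
    by_contra hz
    exact hc (.inl hz)
  have hy : coord 1 ∈ x.asHomogeneousIdeal := by
    by_contra hy
    exact hc (.inr hy)
  have hrel : coord 0 * coord 0 = -(coord 1 * coord 1 + coord 2 * coord 2) := by
    have : coord 0 ^ 2 + coord 1 ^ 2 + coord 2 ^ 2 = 0 :=
      Ideal.Quotient.eq_zero_iff_mem.mpr (Ideal.mem_span_singleton_self quadric)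
    linear_combination this
  have hx0 : coord 0 ∈ x.asHomogeneousIdeal := by
    have hm : coord 0 * coord 0 ∈ x.asHomogeneousIdeal.toIdeal := by
      rw [hrel]
      exact Ideal.neg_mem_iff _ |>.mpr
        (Ideal.add_mem _ (Ideal.mul_mem_left _ _ hy) (Ideal.mul_mem_left _ _ hz))
    exact (x.isPrime.mem_or_mem hm).elim id id
  fin_cases i
  · exact hi hx0
  · exact hi hy
  · exact hi hz

/-- Where y/z is invertible, y is a unit in the local ring; conversely z/y is an inverse on the
overlap. This makes `R₁₂` the localisation of `R₁` at y/z. -/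
lemma basicOpen_coordDiv : conic.basicOpen (coordDiv 1 2) = U₁ ⊓ U₂ := by
  refine le_antisymm (fun x hx => ?_) ?_
  · have hx₁ : x ∈ U₁ := conic.basicOpen_le _ hx
    refine ⟨hx₁, fun hy => ?_⟩
    obtain ⟨g, hg⟩ := (isUnit_res_basicOpen (coordDiv 1 2)).exists_right_inv
    have hz : coord 2 ∉ x.asHomogeneousIdeal := hx₁
    have hx' : x.asHomogeneousIdeal.toIdeal.IsPrime := x.isPrime
    have e₁ : ((res (conic.basicOpen_le _) (coordDiv 1 2)).1 ⟨x, hx⟩).val =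
        Localization.mk (coord 1) ⟨coord 2 ^ 1, by rw [pow_one]; exact hz⟩ := rfl
    have h2 := congrArg HomogeneousLocalization.val
      (congrArg (fun s : Γ(conic, conic.basicOpen (coordDiv 1 2)) => s.1 ⟨x, hx⟩) hg)
    replace h2 := (HomogeneousLocalization.val_mul _ _).symm.trans
      (h2.trans HomogeneousLocalization.val_one)
    rw [e₁, ← mul_one (coord 1), ← one_mul (⟨coord 2 ^ 1, _⟩ : x.asHomogeneousIdeal.toIdeal.primeCompl),
      ← Localization.mk_mul, Localization.mk_one_eq_algebraMap, mul_assoc] at h2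
    exact (IsLocalization.AtPrime.isUnit_to_map_iff (Localization.AtPrime _)
      x.asHomogeneousIdeal.toIdeal (coord 1)).mp (.of_mul_eq_one _ h2) hy
  · have hu : IsUnit (res inf_le_left (coordDiv 1 2) : Γ(conic, U₁ ⊓ U₂)) :=
      .of_mul_eq_one _ yz_mul_zy
    have h1 := conic.basicOpen_of_isUnit hu
    have h2 := conic.basicOpen_res (coordDiv 1 2) (homOfLE (inf_le_left : U₁ ⊓ U₂ ≤ U₁)).op
    have h3 : U₁ ⊓ U₂ = (U₁ ⊓ U₂) ⊓ conic.basicOpen (coordDiv 1 2) := h1.symm.trans h2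
    exact inf_eq_left.mp h3.symm

instance : IsIntegral conic := by
  have h₁ : IsAffineOpen U₁ := Proj.isAffineOpen_basicOpen grading (coord 2) (coord_mem 2) one_pos
  have h₂ : IsAffineOpen U₂ := Proj.isAffineOpen_basicOpen grading (coord 1) (coord_mem 1) one_pos
  refine isIntegral_of_affine_cover h₁ h₂ U₁_sup_U₂ fun hred => ?_
  by_contra hemp
  rw [Set.not_nonempty_iff_eq_empty] at hemp
  have h0 : coordDiv 1 2 = 0 := by
    refine eq_zero_of_basicOpen_eq_bot _ ?_
    rw [basicOpen_coordDiv]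
    exact Opens.ext hemp
  have h1 := isConicRing_R₁.aeval_injective (r := X) (by simp [h0])
  exact X_ne_zero h1

end

/-! ### Expansions of the functions on the overlap -/

section

open LaurentPolynomial

lemma xy_mul_yz : ι₂ (coordDiv 0 1) * ι₁ (coordDiv 1 2) = xz := by
  refine Subtype.ext (funext fun p => ?_)
  apply HomogeneousLocalization.val_injective
  have h₁ : coord 1 ∉ p.1.asHomogeneousIdeal := p.2.2
  have h₂ : coord 2 ∉ p.1.asHomogeneousIdeal := p.2.1
  have e₁ : ((ι₁ (coordDiv 1 2)).1 p).val = Localization.mk (coord 1) ⟨coord 2 ^ 1, by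
    rw [pow_one]; exact h₂⟩ := rfl
  have e₂ : ((ι₂ (coordDiv 0 1)).1 p).val = Localization.mk (coord 0) ⟨coord 1 ^ 1, by
    rw [pow_one]; exact h₁⟩ := rfl
  have e₃ : (xz.1 p).val = Localization.mk (coord 0) ⟨coord 2 ^ 1, by
    rw [pow_one]; exact h₂⟩ := rfl
  erw [HomogeneousLocalization.val_mul]
  rw [e₁, e₂, e₃, Localization.mk_mul, Localization.mk_eq_mk_iff]
  refine Localization.r_of_eq ?_
  simp
  ring

lemma nonempty_U₁_inf_U₂ : ((U₁ ⊓ U₂ : conic.Opens) : Set conic).Nonempty := by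
  rw [← basicOpen_coordDiv]
  by_contra hemp
  rw [Set.not_nonempty_iff_eq_empty] at hemp
  have h0 : coordDiv 1 2 = 0 := eq_zero_of_basicOpen_eq_bot _ (Opens.ext hemp)
  exact Polynomial.X_ne_zero (isConicRing_R₁.aeval_injective (r := Polynomial.X) (by simp [h0]))

lemma ι₁_injective : Function.Injective ι₁ := res_injective _ nonempty_U₁_inf_U₂

lemma xz_sq : xz ^ 2 = -1 - (t : R₁₂) ^ 2 := by
  have := congrArg ι₁ isConicRing_R₁.rel
  simp only [map_add, map_pow, map_one, map_zero] at this
  change xz ^ 2 + _ + 1 = 0 at this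
  have ht : (t : R₁₂) = -ι₁ (coordDiv 1 2) := rfl
  rw [ht]
  linear_combination this

lemma xz_mul_xz : xz * xz = -1 - (t : R₁₂) ^ 2 := by rw [← xz_sq, pow_two]

/-- The function `-y / z` on `U₁`. -/
def t₁ : R₁ := -coordDiv 1 2

/-- The function `x / z` on `U₁`. -/
def x₁ : R₁ := coordDiv 0 2

/-- The function `-z / y` on `U₂`. -/
def t₂ : R₂ := -coordDiv 2 1

/-- The function `-x / y` on `U₂`. -/
def x₂ : R₂ := -coordDiv 0 1

lemma ι₁_t₁ : ι₁ t₁ = t := map_neg _ _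

lemma ι₁_x₁ : ι₁ x₁ = xz := rfl

lemma ι₂_t₂ : ι₂ t₂ = ((t⁻¹ : R₁₂ˣ) : R₁₂) := map_neg _ _

/-- The signs in `t₂` and `x₂` are chosen so that the change of chart is t ↦ t⁻¹, x/z ↦ (x/z)t⁻¹,
without signs. -/
lemma ι₂_x₂ : ι₂ x₂ = xz * ((t⁻¹ : R₁₂ˣ) : R₁₂) := by
  rw [← xy_mul_yz, x₂, map_neg]
  change _ = _ * _ * (-ι₂ (coordDiv 2 1))
  rw [mul_neg, mul_assoc, yz_mul_zy, mul_one]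

lemma IsConicRing.neg_right {B : Type} [CommRing B] [Algebra ℝ B] {a b : B} (h : IsConicRing a b) :
    IsConicRing a (-b) := by
  have key : ∀ p : Polynomial ℝ, Polynomial.aeval (-b) p =
      Polynomial.aeval b (p.comp (-Polynomial.X)) := fun p => by simp [Polynomial.aeval_comp]
  refine ⟨by rw [neg_sq]; exact h.rel, fun f => ?_, fun p q hpq => ?_⟩
  · obtain ⟨p, q, rfl⟩ := h.exists_eq f
    exact ⟨p.comp (-Polynomial.X), q.comp (-Polynomial.X), by
      simp [Polynomial.aeval_comp]⟩
  · rw [key, key] at hpq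
    obtain ⟨hp, hq⟩ := h.eq_zero _ _ hpq
    have inv : ∀ p : Polynomial ℝ, (p.comp (-Polynomial.X)).comp (-Polynomial.X) = p := by
      intro p
      simp [Polynomial.comp_assoc]
    rw [← inv p, ← inv q, hp, hq]
    simp

lemma IsConicRing.neg_left {B : Type} [CommRing B] [Algebra ℝ B] {a b : B} (h : IsConicRing a b) :
    IsConicRing (-a) b := by
  refine ⟨by rw [neg_sq]; exact h.rel, fun f => ?_, fun p q hpq => ?_⟩
  · obtain ⟨p, q, rfl⟩ := h.exists_eq f
    exact ⟨p, -q, by simp⟩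
  · obtain ⟨hp, hq⟩ := h.eq_zero p (-q) (by rw [← hpq]; simp)
    exact ⟨hp, neg_eq_zero.mp hq⟩

lemma isConicRing_t₁ : IsConicRing x₁ t₁ := isConicRing_R₁.neg_right

lemma isConicRing_t₂ : IsConicRing x₂ t₂ := isConicRing_R₂.neg_right.neg_left

lemma exists_ι₁_eq_pow_mul (f : R₁₂) :
    ∃ (n : ℕ) (g : R₁), ι₁ g = (t : R₁₂) ^ n * f := by
  -- The open is a variable here because `basicOpen_coordDiv` is an equality of opens that has to be
  -- substituted.
  have key : ∀ (W : conic.Opens) (hW : W = conic.basicOpen (coordDiv 1 2)) (hle : W ≤ U₁)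
      (f : Γ(conic, W)), ∃ (n : ℕ) (g : R₁), res hle g = res hle (coordDiv 1 2) ^ n * f := by
    rintro W rfl hle f
    obtain ⟨N, hN⟩ := exists_res_eq_pow_mul
      (Proj.isAffineOpen_basicOpen grading (coord 2) (coord_mem 2) one_pos) (coordDiv 1 2) f
    exact ⟨N, hN N le_rfl⟩
  obtain ⟨n, g, hg⟩ := key _ basicOpen_coordDiv.symm inf_le_left f
  refine ⟨n, (-1) ^ n * g, ?_⟩
  rw [map_mul, map_pow, map_neg, map_one]
  change _ * res _ g = _
  rw [hg, ← ι₁_t₁, t₁, map_neg, neg_pow (ι₁ _), mul_assoc]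
  rfl

lemma ι₁_algebraMap (c : ℝ) : ι₁ (algebraMap ℝ R₁ c) = algebraMap ℝ R₁₂ c := res_algebraMap _ c

lemma ι₂_algebraMap (c : ℝ) : ι₂ (algebraMap ℝ R₂ c) = algebraMap ℝ R₁₂ c := res_algebraMap _ c

/-- Evaluation of Laurent polynomials at `t = -y / z`. -/
def evalT : ℝ[T;T⁻¹] →+* R₁₂ := LaurentPolynomial.eval₂ (algebraMap ℝ R₁₂) t

lemma evalT_T (n : ℤ) : evalT (T n) = ((t ^ n : R₁₂ˣ) : R₁₂) := eval₂_T _ _ n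

lemma evalT_C (c : ℝ) : evalT (C c) = algebraMap ℝ R₁₂ c := eval₂_C _ _ c

lemma evalT_toLaurent (p : Polynomial ℝ) :
    evalT (Polynomial.toLaurent p) = ι₁ (Polynomial.aeval t₁ p) := by
  rw [evalT, eval₂_toLaurent, Polynomial.aeval_def, Polynomial.hom_eval₂, ι₁_t₁]
  rw [show ι₁.comp (algebraMap ℝ R₁) = algebraMap ℝ R₁₂ from RingHom.ext ι₁_algebraMap]

lemma evalT_invert_toLaurent (p : Polynomial ℝ) :
    evalT (invert (Polynomial.toLaurent p)) = ι₂ (Polynomial.aeval t₂ p) := by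
  induction p using Polynomial.induction_on' with
  | add p q hp hq => rw [map_add, map_add, map_add, map_add, map_add, hp, hq]
  | monomial n c =>
    rw [← Polynomial.C_mul_X_pow_eq_monomial, Polynomial.toLaurent_C_mul_X_pow, map_mul, invert_C,
      invert_T, map_mul, evalT_T, evalT_C, map_mul, Polynomial.aeval_C, map_pow, Polynomial.aeval_X,
      map_mul, map_pow, ι₂_t₂, ι₂_algebraMap]
    simp

/-- The expansion of the functions on `U₁ ⊓ U₂` as `p(t) + (x / z) q(t)`, where `p` and `q` are
Laurent polynomials. -/
def expand : ℝ[T;T⁻¹] × ℝ[T;T⁻¹] →ₗ[ℝ] R₁₂ where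
  toFun p := evalT p.1 + xz * evalT p.2
  map_add' p q := by simp only [Prod.fst_add, Prod.snd_add, map_add]; ring
  map_smul' c p := by
    change evalT (c • p.1) + xz * evalT (c • p.2) = c • (evalT p.1 + xz * evalT p.2)
    rw [smul_eq_C_mul, smul_eq_C_mul, map_mul, map_mul, evalT_C, Algebra.smul_def]
    ring

/-- Multiplication by a power of t turns Laurent polynomials into polynomials and functions on the
overlap into functions on `U₁`, where the normal form p(t) + (x/z)q(t) is known to exist and to be
unique. -/
lemma expand_bijective : Function.Bijective expand := by
  constructor
  · rw [← LinearMap.ker_eq_bot, LinearMap.ker_eq_bot']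
    rintro ⟨p, q⟩ h
    obtain ⟨m, p', hp⟩ := exists_T_pow p
    obtain ⟨n, q', hq⟩ := exists_T_pow q
    have h1 : ι₁ (Polynomial.aeval t₁ (p' * Polynomial.X ^ n) +
        x₁ * Polynomial.aeval t₁ (q' * Polynomial.X ^ m)) = ι₁ 0 := by
      rw [map_zero, map_add ι₁, map_mul ι₁, ← evalT_toLaurent, ← evalT_toLaurent,
        map_mul Polynomial.toLaurent, map_mul Polynomial.toLaurent, hp, hq,
        Polynomial.toLaurent_X_pow, Polynomial.toLaurent_X_pow, ι₁_x₁, mul_T_assoc, mul_T_assoc,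
        add_comm (n : ℤ), map_mul, map_mul, ← mul_assoc, ← add_mul]
      change expand (p, q) * _ = 0
      rw [h, zero_mul]
    obtain ⟨h2, h3⟩ := isConicRing_t₁.eq_zero _ _ (ι₁_injective h1)
    have hp0 : p' = 0 := (mul_eq_zero.mp h2).resolve_right (pow_ne_zero _ Polynomial.X_ne_zero)
    have hq0 : q' = 0 := (mul_eq_zero.mp h3).resolve_right (pow_ne_zero _ Polynomial.X_ne_zero)
    rw [hp0, map_zero] at hp
    rw [hq0, map_zero] at hq
    exact Prod.ext ((isUnit_T (m : ℤ)).mul_left_eq_zero.mp hp.symm)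
      ((isUnit_T (n : ℤ)).mul_left_eq_zero.mp hq.symm)
  · intro f
    obtain ⟨n, g, hg⟩ := exists_ι₁_eq_pow_mul f
    obtain ⟨p, q, rfl⟩ := isConicRing_t₁.exists_eq g
    refine ⟨(T (-n) * Polynomial.toLaurent p, T (-n) * Polynomial.toLaurent q), ?_⟩
    change evalT _ + xz * evalT _ = f
    rw [map_add, map_mul, ← evalT_toLaurent, ← evalT_toLaurent, ι₁_x₁] at hg
    rw [map_mul, map_mul, evalT_T, mul_left_comm, ← mul_add, hg, ← mul_assoc,
      ← Units.val_pow_eq_pow_val, ← Units.val_mul]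
    simp

/-- The expansion of functions as an equivalence. -/
def expandEquiv : (ℝ[T;T⁻¹] × ℝ[T;T⁻¹]) ≃ₗ[ℝ] R₁₂ := LinearEquiv.ofBijective expand expand_bijective

/-- The coefficient of `t ^ k` in the expansion of a function on `U₁ ⊓ U₂`. -/
def coeffA (k : ℤ) : R₁₂ →ₗ[ℝ] ℝ where
  toFun f := (expandEquiv.symm f).1.coeff k
  map_add' f g := by simp
  map_smul' c f := by simp

/-- The coefficient of `(x / z) t ^ k` in the expansion of a function on `U₁ ⊓ U₂`. -/
def coeffB (k : ℤ) : R₁₂ →ₗ[ℝ] ℝ where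
  toFun f := (expandEquiv.symm f).2.coeff k
  map_add' f g := by simp
  map_smul' c f := by simp

lemma coeffA_expand (k : ℤ) (p q : ℝ[T;T⁻¹]) : coeffA k (evalT p + xz * evalT q) = p.coeff k := by
  change (expandEquiv.symm (expandEquiv (p, q))).1.coeff k = _
  rw [LinearEquiv.symm_apply_apply]

lemma coeffB_expand (k : ℤ) (p q : ℝ[T;T⁻¹]) : coeffB k (evalT p + xz * evalT q) = q.coeff k := by
  change (expandEquiv.symm (expandEquiv (p, q))).2.coeff k = _
  rw [LinearEquiv.symm_apply_apply]

lemma exists_eq_expand (f : R₁₂) : ∃ p q, f = evalT p + xz * evalT q := by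
  obtain ⟨⟨p, q⟩, rfl⟩ := expand_bijective.2 f
  exact ⟨p, q, rfl⟩

lemma ext_coeff {f g : R₁₂} (hA : ∀ k, coeffA k f = coeffA k g)
    (hB : ∀ k, coeffB k f = coeffB k g) : f = g :=
  expandEquiv.symm.injective (Prod.ext (LaurentPolynomial.ext hA) (LaurentPolynomial.ext hB))

lemma coeff_T_mul (n k : ℤ) (p : ℝ[T;T⁻¹]) : (T n * p).coeff k = p.coeff (k - n) := by
  rw [T, AddMonoidAlgebra.coeff_single_mul_apply, one_mul, neg_add_eq_sub]

lemma coeffA_t_mul (n k : ℤ) (f : R₁₂) :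
    coeffA k (((t ^ n : R₁₂ˣ) : R₁₂) * f) = coeffA (k - n) f := by
  obtain ⟨p, q, rfl⟩ := exists_eq_expand f
  rw [mul_add, mul_left_comm, ← evalT_T, ← map_mul, ← map_mul, coeffA_expand, coeffA_expand,
    coeff_T_mul]

lemma coeffB_t_mul (n k : ℤ) (f : R₁₂) :
    coeffB k (((t ^ n : R₁₂ˣ) : R₁₂) * f) = coeffB (k - n) f := by
  obtain ⟨p, q, rfl⟩ := exists_eq_expand f
  rw [mul_add, mul_left_comm, ← evalT_T, ← map_mul, ← map_mul, coeffB_expand, coeffB_expand,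
    coeff_T_mul]

lemma xz_mul_expand (p q : ℝ[T;T⁻¹]) :
    xz * (evalT p + xz * evalT q) = evalT (-(q + T 2 * q)) + xz * evalT p := by
  have : evalT (T 2) = (t : R₁₂) ^ 2 := by rw [evalT_T]; rfl
  rw [map_neg, map_add, map_mul, this]
  linear_combination (evalT q) * xz_mul_xz

/-- From (x/z)² = -1 - t²; the second term shifts the exponent by two. -/
lemma coeffA_xz_mul (k : ℤ) (f : R₁₂) :
    coeffA k (xz * f) = -(coeffB k f + coeffB (k - 2) f) := by
  obtain ⟨p, q, rfl⟩ := exists_eq_expand f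
  rw [xz_mul_expand, coeffA_expand, coeffB_expand, coeffB_expand, ← coeff_T_mul]
  simp

lemma coeffB_xz_mul (k : ℤ) (f : R₁₂) : coeffB k (xz * f) = coeffA k f := by
  obtain ⟨p, q, rfl⟩ := exists_eq_expand f
  rw [xz_mul_expand, coeffA_expand, coeffB_expand]

lemma coeffA_algebraMap (k : ℤ) (c : ℝ) : coeffA k (algebraMap ℝ R₁₂ c) = if k = 0 then c else 0 := by
  have := coeffA_expand k (C c) 0
  rwa [map_zero, mul_zero, add_zero, evalT_C, C_apply] at this

lemma coeffB_algebraMap (k : ℤ) (c : ℝ) : coeffB k (algebraMap ℝ R₁₂ c) = 0 := by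
  have := coeffB_expand k (C c) 0
  rwa [map_zero, mul_zero, add_zero, evalT_C] at this

lemma coeff_toLaurent_of_neg {k : ℤ} (hk : k < 0) (p : Polynomial ℝ) :
    (Polynomial.toLaurent p).coeff k = 0 := by
  by_contra h
  have := Finsupp.mem_support_iff.mpr h
  rw [support_coeff_toLaurent] at this
  obtain ⟨n, -, rfl⟩ := Finset.mem_map.mp this
  exact absurd hk (by simp)

lemma coeffA_ι₁ {k : ℤ} (hk : k < 0) (f : R₁) : coeffA k (ι₁ f) = 0 := by
  obtain ⟨p, q, rfl⟩ := isConicRing_t₁.exists_eq f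
  rw [map_add, map_mul, ← evalT_toLaurent, ← evalT_toLaurent, ι₁_x₁, coeffA_expand,
    coeff_toLaurent_of_neg hk]

lemma coeffB_ι₁ {k : ℤ} (hk : k < 0) (f : R₁) : coeffB k (ι₁ f) = 0 := by
  obtain ⟨p, q, rfl⟩ := isConicRing_t₁.exists_eq f
  rw [map_add, map_mul, ← evalT_toLaurent, ← evalT_toLaurent, ι₁_x₁, coeffB_expand,
    coeff_toLaurent_of_neg hk]

lemma ι₂_expand (p q : Polynomial ℝ) :
    ι₂ (Polynomial.aeval t₂ p + x₂ * Polynomial.aeval t₂ q) =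
      evalT (invert (Polynomial.toLaurent p)) +
        xz * evalT (T (-1) * invert (Polynomial.toLaurent q)) := by
  rw [map_add, map_mul, ← evalT_invert_toLaurent, ← evalT_invert_toLaurent, ι₂_x₂, map_mul, evalT_T,
    zpow_neg_one, mul_assoc]

lemma coeffA_ι₂ {k : ℤ} (hk : 0 < k) (f : R₂) : coeffA k (ι₂ f) = 0 := by
  obtain ⟨p, q, rfl⟩ := isConicRing_t₂.exists_eq f
  rw [ι₂_expand, coeffA_expand, invert_apply, coeff_toLaurent_of_neg (by omega)]

/-- The exponent 0 is excluded too, unlike in `coeffA_ι₂`: the second generator of `R₂` is (x/z)t⁻¹,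
so its exponents start at -1. The gap is the source of the Quillen block. -/
lemma coeffB_ι₂ {k : ℤ} (hk : 0 ≤ k) (f : R₂) : coeffB k (ι₂ f) = 0 := by
  obtain ⟨p, q, rfl⟩ := isConicRing_t₂.exists_eq f
  rw [ι₂_expand, coeffB_expand, coeff_T_mul, invert_apply, coeff_toLaurent_of_neg (by omega)]

lemma eq_sum_coeff (f : R₁₂) : ∃ s : Finset ℤ, (∀ k ∉ s, coeffA k f = 0 ∧ coeffB k f = 0) ∧
    f = ∑ k ∈ s, (algebraMap ℝ R₁₂ (coeffA k f) * ((t ^ k : R₁₂ˣ) : R₁₂) +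
      algebraMap ℝ R₁₂ (coeffB k f) * (xz * ((t ^ k : R₁₂ˣ) : R₁₂))) := by
  obtain ⟨p, q, rfl⟩ := exists_eq_expand f
  refine ⟨p.coeff.support ∪ q.coeff.support, fun k hk => ?_, ?_⟩
  · rw [coeffA_expand, coeffB_expand]
    simpa using hk
  · have key : ∀ (p : ℝ[T;T⁻¹]) (s : Finset ℤ), p.coeff.support ⊆ s →
        evalT p = ∑ k ∈ s, algebraMap ℝ R₁₂ (p.coeff k) * ((t ^ k : R₁₂ˣ) : R₁₂) := by
      intro p s hs
      have hp : p = ∑ k ∈ s, C (p.coeff k) * T k := by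
        refine LaurentPolynomial.ext fun k => ?_
        rw [AddMonoidAlgebra.coeff_sum, Finsupp.finsetSum_apply]
        simp only [← single_eq_C_mul_T, AddMonoidAlgebra.coeff_single, Finsupp.single_apply]
        rw [Finset.sum_ite_eq' s k]
        split_ifs with hk
        · rfl
        · exact Finsupp.notMem_support_iff.mp fun h => hk (hs h)
      conv_lhs => rw [hp]
      simp only [map_sum, map_mul, evalT_C, evalT_T]
    simp only [coeffA_expand, coeffB_expand]
    rw [Finset.sum_add_distrib, key p _ Finset.subset_union_left,
      key q _ Finset.subset_union_right, Finset.mul_sum]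
    congr 1
    exact Finset.sum_congr rfl fun k _ => by ring

lemma exists_ι₂_eq {f : R₁₂} (hA : ∀ k > 0, coeffA k f = 0) (hB : ∀ k ≥ 0, coeffB k f = 0) :
    ∃ g, ι₂ g = f := by
  obtain ⟨s, -, hf⟩ := eq_sum_coeff f
  rw [← RingHom.mem_range, hf]
  have ht : ∀ k ≤ (0 : ℤ), ((t ^ k : R₁₂ˣ) : R₁₂) ∈ ι₂.range := by
    intro k hk
    obtain ⟨n, rfl⟩ : ∃ n : ℕ, k = -n := ⟨k.natAbs, by omega⟩
    exact ⟨t₂ ^ n, by rw [map_pow, ι₂_t₂]; simp⟩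
  refine Subring.sum_mem _ fun k _ => add_mem ?_ ?_
  · rcases le_or_gt k 0 with hk | hk
    · exact mul_mem ⟨_, ι₂_algebraMap _⟩ (ht k hk)
    · rw [hA k hk]
      simp
  · rcases lt_or_ge k 0 with hk | hk
    · refine mul_mem ⟨_, ι₂_algebraMap _⟩ ?_
      have e : xz * ((t ^ k : R₁₂ˣ) : R₁₂) = ι₂ x₂ * ((t ^ (k + 1) : R₁₂ˣ) : R₁₂) := by
        rw [ι₂_x₂, mul_assoc, ← Units.val_mul, ← zpow_neg_one, ← zpow_add]
        congr 4
        ring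
      rw [e]
      exact mul_mem ⟨_, rfl⟩ (ht _ (by omega))
    · rw [hB k hk]
      simp

lemma ι₂_injective : Function.Injective ι₂ := by
  rw [injective_iff_map_eq_zero]
  intro f hf
  obtain ⟨p, q, rfl⟩ := isConicRing_t₂.exists_eq f
  rw [ι₂_expand] at hf
  have h := expand_bijective.1 (a₁ := (invert (Polynomial.toLaurent p),
    T (-1) * invert (Polynomial.toLaurent q))) (a₂ := 0) (by rw [map_zero]; exact hf)
  have h1 := congrArg Prod.fst h
  have h2 := congrArg Prod.snd h
  simp only [Prod.fst_zero, Prod.snd_zero, map_eq_zero_iff invert invert.injective,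
    Polynomial.toLaurent_eq_zero, (isUnit_T (R := ℝ) (-1)).mul_right_eq_zero] at h1 h2
  simp [h1, h2]

end

/-! ### Equivalence of transition matrices -/

section

open Matrix

lemma map_mulVec_comp {A B κ κ' : Type} [CommRing A] [CommRing B] [Fintype κ] (i : A →+* B)
    (L : Matrix κ' κ A) (v : κ → A) : L.map i *ᵥ (i ∘ v) = i ∘ (L *ᵥ v) := by
  ext k
  exact (RingHom.map_mulVec i L v k).symm

section TransEquiv

variable {R₁ R₂ R : Type} [CommRing R₁] [CommRing R₂] [CommRing R] {i₁ : R₁ →+* R} {i₂ : R₂ →+* R}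
  {κ κ' κ'' : Type} [Fintype κ] [Fintype κ'] [Fintype κ''] [DecidableEq κ] [DecidableEq κ']
  [DecidableEq κ'']

lemma TransEquiv.symm {M : Matrix κ κ R} {N : Matrix κ' κ' R} (h : TransEquiv i₁ i₂ M N) :
    TransEquiv i₁ i₂ N M := by
  obtain ⟨L, L', S, S', hL, hL', hS, hS', rfl⟩ := h
  refine ⟨L', L, S', S, hL', hL, hS', hS, ?_⟩
  rw [Matrix.mul_assoc, Matrix.mul_assoc, ← Matrix.map_mul, hS, ← Matrix.mul_assoc,
    ← Matrix.mul_assoc, ← Matrix.map_mul, hL', Matrix.map_one _ (map_zero _) (map_one _),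
    Matrix.map_one _ (map_zero _) (map_one _), Matrix.one_mul, Matrix.mul_one]

lemma TransEquiv.trans {M : Matrix κ κ R} {N : Matrix κ' κ' R} {P : Matrix κ'' κ'' R}
    (h : TransEquiv i₁ i₂ M N) (h' : TransEquiv i₁ i₂ N P) : TransEquiv i₁ i₂ M P := by
  obtain ⟨L, L', S, S', hL, hL', hS, hS', rfl⟩ := h
  obtain ⟨A, A', B, B', hA, hA', hB, hB', rfl⟩ := h'
  refine ⟨A * L, L' * A', S * B, B' * S', ?_, ?_, ?_, ?_, ?_⟩
  · rw [Matrix.mul_assoc, ← Matrix.mul_assoc L, hL, Matrix.one_mul, hA]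
  · rw [Matrix.mul_assoc, ← Matrix.mul_assoc A', hA', Matrix.one_mul, hL']
  · rw [Matrix.mul_assoc, ← Matrix.mul_assoc B, hB, Matrix.one_mul, hS]
  · rw [Matrix.mul_assoc, ← Matrix.mul_assoc S', hS', Matrix.one_mul, hB']
  · simp only [Matrix.map_mul, Matrix.mul_assoc]

lemma TransEquiv.smul {M : Matrix κ κ R} {N : Matrix κ' κ' R} (h : TransEquiv i₁ i₂ M N) (c : R) :
    TransEquiv i₁ i₂ (c • M) (c • N) := by
  obtain ⟨L, L', S, S', hL, hL', hS, hS', rfl⟩ := h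
  exact ⟨L, L', S, S', hL, hL', hS, hS', by rw [Matrix.mul_smul, Matrix.smul_mul]⟩

lemma transEquiv_submatrix (M : Matrix κ κ R) (e : κ' ≃ κ) :
    TransEquiv i₁ i₂ M (M.submatrix e e) := by
  have key : ∀ {A : Type} [CommRing A],
      (1 : Matrix κ κ A).submatrix e id * (1 : Matrix κ κ A).submatrix id e = 1 ∧
      (1 : Matrix κ κ A).submatrix id e * (1 : Matrix κ κ A).submatrix e id = 1 := by
    intro A _
    constructor
    · rw [← Matrix.submatrix_mul _ _ _ id _ Function.bijective_id, Matrix.one_mul,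
        Matrix.submatrix_one_equiv]
    · rw [Matrix.submatrix_mul_equiv, Matrix.one_mul, Matrix.submatrix_id_id]
  refine ⟨_, _, _, _, key.1, key.2, key.2, key.1, ?_⟩
  rw [← Matrix.submatrix_map, ← Matrix.submatrix_map, Matrix.map_one _ (map_zero _) (map_one _),
    Matrix.map_one _ (map_zero _) (map_one _)]
  ext i j
  simp [Matrix.mul_apply, Matrix.one_apply]

lemma transEquiv_of_eq {M N : Matrix κ κ R} (h : M = N) : TransEquiv i₁ i₂ M N :=
  h ▸ ⟨1, 1, 1, 1, Matrix.one_mul _, Matrix.one_mul _, Matrix.one_mul _, Matrix.one_mul _, by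
    rw [Matrix.map_one _ (map_zero _) (map_one _), Matrix.map_one _ (map_zero _) (map_one _),
      Matrix.one_mul, Matrix.mul_one]⟩

lemma TransEquiv.exists_fromBlocks {ν : Type} [Fintype ν] [DecidableEq ν] (A : Matrix ν ν R)
    (b : Matrix ν κ R) {M : Matrix κ κ R} {N : Matrix κ' κ' R} (h : TransEquiv i₁ i₂ M N) :
    ∃ b', TransEquiv i₁ i₂ (fromBlocks A b 0 M) (fromBlocks A b' 0 N) := by
  obtain ⟨L, L', S, S', hL, hL', hS, hS', rfl⟩ := h
  refine ⟨b * S.map i₁, fromBlocks 1 0 0 L, fromBlocks 1 0 0 L', fromBlocks 1 0 0 S,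
    fromBlocks 1 0 0 S', ?_, ?_, ?_, ?_, ?_⟩
  · simp [fromBlocks_multiply, hL]
  · simp [fromBlocks_multiply, hL']
  · simp [fromBlocks_multiply, hS]
  · simp [fromBlocks_multiply, hS']
  · simp [fromBlocks_multiply, fromBlocks_map, Matrix.map_one]

/-- Unipotent changes of frame alter the upper right block by coboundaries; modulo these it is the
class of an extension. -/
lemma transEquiv_fromBlocks_add {ν : Type} [Fintype ν] [DecidableEq ν] (A : Matrix ν ν R)
    (b : Matrix ν κ R) (M : Matrix κ κ R) (L : Matrix ν κ R₂) (S : Matrix ν κ R₁) :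
    TransEquiv i₁ i₂ (fromBlocks A b 0 M)
      (fromBlocks A (b + L.map i₂ * M + A * S.map i₁) 0 M) := by
  refine ⟨fromBlocks 1 L 0 1, fromBlocks 1 (-L) 0 1, fromBlocks 1 S 0 1,
    fromBlocks 1 (-S) 0 1, ?_, ?_, ?_, ?_, ?_⟩
  · simp [fromBlocks_multiply]
  · simp [fromBlocks_multiply]
  · simp [fromBlocks_multiply]
  · simp [fromBlocks_multiply]
  · simp [fromBlocks_multiply, fromBlocks_map, Matrix.map_one, add_comm, add_left_comm]

/-- A nonzero pair `(f, g)` with `M f = g`: a nonzero section of the bundle glued along `M`. -/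
def HasSection (i₁ : R₁ →+* R) (i₂ : R₂ →+* R) (M : Matrix κ κ R) : Prop :=
  ∃ (f : κ → R₁) (g : κ → R₂), f ≠ 0 ∧ M *ᵥ (i₁ ∘ f) = i₂ ∘ g

lemma TransEquiv.hasSection {M : Matrix κ κ R} {N : Matrix κ' κ' R} (h : TransEquiv i₁ i₂ M N)
    (hM : HasSection i₁ i₂ M) : HasSection i₁ i₂ N := by
  obtain ⟨L, L', S, S', hL, hL', hS, hS', rfl⟩ := h
  obtain ⟨f, g, hf, hfg⟩ := hM
  refine ⟨S' *ᵥ f, L *ᵥ g, fun h0 => hf ?_, ?_⟩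
  · rw [← Matrix.one_mulVec f, ← hS, ← Matrix.mulVec_mulVec, h0, Matrix.mulVec_zero]
  · rw [← map_mulVec_comp, ← map_mulVec_comp, ← hfg, Matrix.mulVec_mulVec, Matrix.mul_assoc, ← Matrix.map_mul,
      hS, Matrix.map_one _ (map_zero _) (map_one _), Matrix.mul_one, Matrix.mulVec_mulVec]

end TransEquiv

/-- A unimodular vector over a principal ideal domain is the first column of an invertible
matrix. -/
lemma exists_matrix_of_span_eq_top {A : Type} [CommRing A] [IsDomain A] [IsPrincipalIdealRing A]
    {κ : Type} [Fintype κ] [DecidableEq κ] (f : κ → A) (hf : Ideal.span (Set.range f) = ⊤) :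
    ∃ (m : ℕ) (S : Matrix κ (Unit ⊕ Fin m) A) (S' : Matrix (Unit ⊕ Fin m) κ A),
      1 + m = Fintype.card κ ∧ S * S' = 1 ∧ S' * S = 1 ∧ ∀ k, S k (Sum.inl ()) = f k := by
  obtain ⟨c, hc⟩ := Ideal.mem_span_range_iff_exists_fun.mp ((Ideal.eq_top_iff_one _).mp hf)
  -- A functional with value 1 on `f` splits off the line spanned by `f`; its kernel is free over a
  -- principal ideal domain and completes `f` to a basis.
  let φ : (κ → A) →ₗ[A] A := Fintype.linearCombination A (fun k => c k) |>.comp LinearMap.id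
  have hφ : ∀ x, φ x = ∑ k, x k * c k := fun x => by
    simp [φ, Fintype.linearCombination_apply]
  have hφf : φ f = 1 := by rw [hφ, ← hc]; exact Finset.sum_congr rfl fun k _ => mul_comm _ _
  let N := LinearMap.ker φ
  let bN := Module.finBasis A N
  set m := Module.finrank A N
  let v : Unit ⊕ Fin m → (κ → A) := Sum.elim (fun _ => f) (fun j => (bN j : κ → A))
  have hφN : ∀ j, φ (bN j) = 0 := fun j => (bN j).2
  have hli : LinearIndependent A v := by
    rw [Fintype.linearIndependent_iff]
    intro g hg
    simp only [Fintype.sum_sum_type, Finset.univ_unique, Finset.sum_singleton, v, Sum.elim_inl,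
      Sum.elim_inr] at hg
    have h0 : g (Sum.inl ()) = 0 := by
      have := congrArg φ hg
      simpa [hφf, hφN] using this
    have h1 : ∑ j, g (Sum.inr j) • bN j = 0 := by
      apply Subtype.ext
      change g (Sum.inl ()) • f + _ = 0 at hg
      rw [h0, zero_smul, zero_add] at hg
      simpa using hg
    have h2 := Fintype.linearIndependent_iff.mp bN.linearIndependent _ h1
    rintro (⟨⟩ | j)
    · exact h0
    · exact h2 j
  have hsp : ⊤ ≤ Submodule.span A (Set.range v) := by
    intro x _
    have hx : x - φ x • f ∈ N := by
      simp [N, hφf]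
    have e : x = φ x • v (Sum.inl ()) + ∑ j, bN.repr ⟨_, hx⟩ j • v (Sum.inr j) := by
      have := congrArg (Subtype.val) (bN.sum_repr ⟨_, hx⟩)
      simp only [Submodule.coe_sum, Submodule.coe_smul] at this
      simp only [v, Sum.elim_inl, Sum.elim_inr]
      rw [this]
      abel
    rw [e]
    exact add_mem (Submodule.smul_mem _ _ (Submodule.subset_span ⟨_, rfl⟩))
      (Submodule.sum_mem _ fun j _ => Submodule.smul_mem _ _ (Submodule.subset_span ⟨_, rfl⟩))
  let B := Module.Basis.mk hli hsp
  refine ⟨m, (Pi.basisFun A κ).toMatrix B, B.toMatrix (Pi.basisFun A κ), ?_, ?_, ?_, fun k => ?_⟩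
  · have := Module.finrank_eq_card_basis B
    rw [Module.finrank_fintype_fun_eq_card, Fintype.card_sum, Fintype.card_fin] at this
    simpa using this.symm
  · exact Module.Basis.toMatrix_mul_toMatrix_flip _ _
  · exact Module.Basis.toMatrix_mul_toMatrix_flip _ _
  · simp [Module.Basis.toMatrix_apply, B, v]

end

/-! ### Sections of twists -/

section

open Matrix

/-- Modulo b one has a² = -1, so the product of αa + β with β - αa is the nonzero constant α² + β².
-/
lemma IsConicRing.isCoprime {B : Type} [CommRing B] [Algebra ℝ B] {a b : B} (h : IsConicRing a b)
    {α β : ℝ} (γ : ℝ) (hne : α ≠ 0 ∨ β ≠ 0) :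
    IsCoprime (algebraMap ℝ B α * a + algebraMap ℝ B γ * b + algebraMap ℝ B β) b := by
  set c := algebraMap ℝ B
  have hd : α ^ 2 + β ^ 2 ≠ 0 := by
    intro h0
    have h1 : α = 0 := by nlinarith [sq_nonneg α, sq_nonneg β]
    have h2 : β = 0 := by nlinarith [sq_nonneg α, sq_nonneg β]
    simp [h1, h2] at hne
  have hc : (c α ^ 2 + c β ^ 2) * c (α ^ 2 + β ^ 2)⁻¹ = 1 := by
    rw [← map_pow, ← map_pow, ← map_add, ← map_mul, mul_inv_cancel₀ hd, map_one]
  refine ⟨(c β - c α * a) * c (α ^ 2 + β ^ 2)⁻¹,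
    -(c α ^ 2 * b + c γ * (c β - c α * a)) * c (α ^ 2 + β ^ 2)⁻¹, ?_⟩
  linear_combination hc - c α ^ 2 * c (α ^ 2 + β ^ 2)⁻¹ * h.rel

lemma exists_ι₂_eq_zpow_mul {ι : Type} [Fintype ι] (F : ι → R₁₂) :
    ∃ (n : ℕ) (G : ι → R₂), ∀ i, ι₂ (G i) = ((t ^ (-n : ℤ) : R₁₂ˣ) : R₁₂) * F i := by
  have key : ∀ i, ∃ n : ℕ, ∀ m ≥ n, ∃ g : R₂, ι₂ g = ((t ^ (-m : ℤ) : R₁₂ˣ) : R₁₂) * F i := by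
    intro i
    obtain ⟨s, hs, -⟩ := eq_sum_coeff (F i)
    -- The extra 1 serves the second component, whose exponents in `R₂` must be strictly negative.
    refine ⟨s.sup Int.natAbs + 1, fun m hm => exists_ι₂_eq (fun k hk => ?_) fun k hk => ?_⟩
    · rw [coeffA_t_mul]
      refine (hs _ fun hmem => ?_).1
      have := Finset.le_sup (f := Int.natAbs) hmem
      omega
    · rw [coeffB_t_mul]
      refine (hs _ fun hmem => ?_).2
      have := Finset.le_sup (f := Int.natAbs) hmem
      omega
  choose n hn using key
  choose G hG using fun i => hn i (∑ j, n j) (Finset.single_le_sum (fun _ _ => Nat.zero_le _)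
    (Finset.mem_univ i))
  exact ⟨_, G, hG⟩

/-- Both πe and tⁿe are regular on `U₁` for some n, and a Bézout relation between π and tⁿ expresses
e through them. -/
lemma exists_ι₁_of_isCoprime {π : R₁} (hπ : IsCoprime π t₁) {e : R₁₂} {f : R₁}
    (h : ι₁ π * e = ι₁ f) : ∃ e', ι₁ e' = e := by
  obtain ⟨n, g, hg⟩ := exists_ι₁_eq_pow_mul e
  obtain ⟨p, q, hpq⟩ := hπ.pow_right (n := n)
  refine ⟨p * f + q * g, ?_⟩
  have := congrArg ι₁ hpq
  simp only [map_add, map_mul, map_pow, map_one, ι₁_t₁] at this ⊢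
  linear_combination e * this - ι₁ p * h + ι₁ q * hg

lemma exists_ι₂_of_isCoprime {ρ : R₂} (hρ : IsCoprime ρ t₂) {e : R₁₂} {f : R₂}
    (h : ι₂ ρ * e = ι₂ f) : ∃ e', ι₂ e' = e := by
  obtain ⟨n, g, hg⟩ := exists_ι₂_eq_zpow_mul (fun _ : Unit => e)
  obtain ⟨p, q, hpq⟩ := hρ.pow_right (n := n)
  have h1 := congrArg ι₂ hpq
  refine ⟨p * f + q * g (), ?_⟩
  have h2 : ι₂ t₂ ^ n = ((t ^ (-n : ℤ) : R₁₂ˣ) : R₁₂) := by rw [ι₂_t₂]; simp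
  simp only [map_add, map_mul, map_pow, map_one, h2] at h1 ⊢
  linear_combination e * h1 - ι₂ p * h + ι₂ q * hg ()

lemma t_mul_t_inv : (t : R₁₂) * ((t⁻¹ : R₁₂ˣ) : R₁₂) = 1 := t.mul_inv

/-- The two sides have disjoint exponents, nonnegative on the left and negative on the right: a line
bundle of negative degree has no sections. -/
lemma eq_zero_of_ι₁_eq {f : R₁} {g : R₂} {n : ℤ} (hn : n < 0)
    (h : ι₁ f = ((t ^ n : R₁₂ˣ) : R₁₂) * ι₂ g) : f = 0 := by
  refine ι₁_injective ?_
  rw [map_zero]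
  refine ext_coeff (fun k => ?_) fun k => ?_ <;> rw [map_zero] <;> rcases lt_or_ge k 0 with hk | hk
  · exact coeffA_ι₁ hk f
  · rw [h, coeffA_t_mul, coeffA_ι₂ (by omega)]
  · exact coeffB_ι₁ hk f
  · rw [h, coeffB_t_mul, coeffB_ι₂ (by omega)]

/-- The entries lie in a common maximal ideal, which is nonzero and therefore generated by a linear
form. -/
lemma exists_eq_smul_of_span_ne_top {A : Type} [CommRing A] [Algebra ℝ A] {a b : A}
    (hA : IsConicRing a b) {κ : Type} {f : κ → A} (hf : f ≠ 0)
    (h : Ideal.span (Set.range f) ≠ ⊤) :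
    ∃ (α β γ : ℝ) (f' : κ → A), (α ≠ 0 ∨ β ≠ 0) ∧ ∀ k, f k =
      (algebraMap ℝ A α * a + algebraMap ℝ A β * b + algebraMap ℝ A γ) * f' k := by
  obtain ⟨𝔭, h𝔭, hle⟩ := Ideal.exists_le_maximal _ h
  have hmem : ∀ k, f k ∈ 𝔭 := fun k => hle (Ideal.subset_span ⟨k, rfl⟩)
  have hne : 𝔭 ≠ ⊥ := by
    rintro rfl
    exact hf (funext fun k => hmem k)
  have := h𝔭.isPrime
  obtain ⟨α, β, γ, hαβ, rfl⟩ := hA.exists_prime_eq_span 𝔭 hne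
  choose f' hf' using fun k => Ideal.mem_span_singleton.mp (hmem k)
  exact ⟨α, β, γ, f', hαβ, hf'⟩

section Sections

variable {κ : Type} [Fintype κ] [DecidableEq κ] {M P : Matrix κ κ R₁₂} {f : κ → R₁} {g : κ → R₂}

omit [DecidableEq κ] in
-- A section with a zero on `U₁` is divisible there by a linear form π = tρ. Then ρ times tMf' is
-- regular on `U₂`, and since ρ is coprime to `t₂` so is tMf' itself; thus f' is a section of the
-- twist by t.
lemma span_eq_top_of_section (hf : f ≠ 0) (hfg : M *ᵥ (ι₁ ∘ f) = ι₂ ∘ g)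
    (h : ¬ HasSection ι₁ ι₂ ((t : R₁₂) • M)) : Ideal.span (Set.range f) = ⊤ := by
  by_contra htop
  obtain ⟨α, β, γ, f', hne, hf'⟩ := exists_eq_smul_of_span_ne_top isConicRing_t₁ hf htop
  set π := algebraMap ℝ R₁ α * x₁ + algebraMap ℝ R₁ β * t₁ + algebraMap ℝ R₁ γ with hπ
  -- The same linear form in the coordinates of `U₂`: the change of chart exchanges t and 1, hence
  -- also the coefficients β and γ.
  set ρ := algebraMap ℝ R₂ α * x₂ + algebraMap ℝ R₂ γ * t₂ + algebraMap ℝ R₂ β with hρ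
  have hρπ : ι₁ π = t * ι₂ ρ := by
    simp only [hπ, hρ, map_add, map_mul, ι₁_algebraMap, ι₂_algebraMap, ι₁_x₁, ι₁_t₁, ι₂_x₂, ι₂_t₂]
    linear_combination (-algebraMap ℝ R₁₂ α * xz - algebraMap ℝ R₁₂ γ) * t_mul_t_inv
  have hcop : IsCoprime ρ t₂ := isConicRing_t₂.isCoprime γ hne
  have hk : ∀ k, ∃ e, ι₂ e = (((t : R₁₂) • M) *ᵥ (ι₁ ∘ f')) k := by
    intro k
    refine exists_ι₂_of_isCoprime hcop (f := g k) ?_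
    have h1 := congrFun hfg k
    have h2 : ι₁ ∘ f = ι₁ π • (ι₁ ∘ f') := by
      ext k
      simp [hf' k]
    rw [h2, Matrix.mulVec_smul, Pi.smul_apply, smul_eq_mul, hρπ] at h1
    rw [Matrix.smul_mulVec, Pi.smul_apply, smul_eq_mul]
    change _ = ι₂ (g k) at h1
    linear_combination h1
  choose e he using hk
  refine h ⟨f', e, fun h0 => hf ?_, funext fun k => (he k).symm⟩
  ext k : 1
  rw [hf' k, h0, Pi.zero_apply, mul_zero]

/-- The mirror image for zeros on `U₂`: the quotient is regular there by construction, and the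
inverse matrix carries it to `U₁`, where regularity follows from coprimality with `t₁`. -/
lemma span_eq_top_of_section' (hf : f ≠ 0) (hfg : M *ᵥ (ι₁ ∘ f) = ι₂ ∘ g) (hP : M * P = 1)
    (h : ¬ HasSection ι₁ ι₂ ((t : R₁₂) • M)) : Ideal.span (Set.range g) = ⊤ := by
  by_contra htop
  have hPM : P * M = 1 := mul_eq_one_comm.mp hP
  have hfP : ι₁ ∘ f = P *ᵥ (ι₂ ∘ g) := by
    rw [← hfg, Matrix.mulVec_mulVec, hPM, Matrix.one_mulVec]
  have hg : g ≠ 0 := by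
    rintro rfl
    refine hf (funext fun k => ι₁_injective ?_)
    have := congrFun hfP k
    have h0 : ι₂ ∘ (0 : κ → R₂) = 0 := funext fun _ => map_zero ι₂
    rw [h0, Matrix.mulVec_zero] at this
    simpa using this
  obtain ⟨α, β, γ, g', hne, hg'⟩ := exists_eq_smul_of_span_ne_top isConicRing_t₂ hg htop
  set ρ := algebraMap ℝ R₂ α * x₂ + algebraMap ℝ R₂ β * t₂ + algebraMap ℝ R₂ γ with hρ
  set π := algebraMap ℝ R₁ α * x₁ + algebraMap ℝ R₁ γ * t₁ + algebraMap ℝ R₁ β with hπ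
  have hρπ : ι₂ ρ = ((t⁻¹ : R₁₂ˣ) : R₁₂) * ι₁ π := by
    simp only [hπ, hρ, map_add, map_mul, ι₁_algebraMap, ι₂_algebraMap, ι₁_x₁, ι₁_t₁, ι₂_x₂, ι₂_t₂]
    linear_combination (-algebraMap ℝ R₁₂ γ) * t_mul_t_inv
  have hcop : IsCoprime π t₁ := isConicRing_t₁.isCoprime γ hne
  have hg2 : ι₂ ∘ g = ι₂ ρ • (ι₂ ∘ g') := by
    ext k
    simp [hg' k]
  have hk : ∀ k, ∃ e, ι₁ e = ((t⁻¹ : R₁₂ˣ) : R₁₂) * (P *ᵥ (ι₂ ∘ g')) k := by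
    intro k
    refine exists_ι₁_of_isCoprime hcop (f := f k) ?_
    have h1 := congrFun hfP k
    rw [hg2, Matrix.mulVec_smul, Pi.smul_apply, smul_eq_mul, hρπ] at h1
    change ι₁ (f k) = _ at h1
    linear_combination -h1
  choose e he using hk
  have he' : ι₁ ∘ e = ((t⁻¹ : R₁₂ˣ) : R₁₂) • (P *ᵥ (ι₂ ∘ g')) := funext he
  refine h ⟨e, g', fun h0 => hf ?_, ?_⟩
  · ext k : 1
    refine ι₁_injective ?_
    have h1 := congrFun hfP k
    rw [hg2, Matrix.mulVec_smul, Pi.smul_apply, smul_eq_mul, hρπ] at h1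
    change ι₁ (f k) = _ at h1
    have h2 := he k
    rw [h0] at h2
    rw [h1, Pi.zero_apply, map_zero]
    rw [Pi.zero_apply, map_zero] at h2
    linear_combination - ι₁ π * h2
  · rw [he', Matrix.smul_mulVec, Matrix.mulVec_smul, Matrix.mulVec_mulVec, hP, Matrix.one_mulVec,
      smul_smul, t_mul_t_inv, one_smul]

/-- For very negative k a column of the twisted matrix is regular on `U₂`, which gives a section.
For large k there is none, because the exponents in the inverse matrix are bounded and
`eq_zero_of_ι₁_eq` applies. So a largest k exists. -/
lemma exists_twist [Nonempty κ] (hP : M * P = 1) : ∃ k : ℤ,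
    HasSection ι₁ ι₂ (((t ^ k : R₁₂ˣ) : R₁₂) • M) ∧
      ¬ HasSection ι₁ ι₂ (((t ^ (k + 1) : R₁₂ˣ) : R₁₂) • M) := by
  have hPM : P * M = 1 := mul_eq_one_comm.mp hP
  obtain ⟨k, hk, hmax⟩ := Int.exists_greatest_of_bdd
    (P := fun k : ℤ => HasSection ι₁ ι₂ (((t ^ k : R₁₂ˣ) : R₁₂) • M)) (by
      obtain ⟨n, p, hp⟩ := exists_ι₂_eq_zpow_mul (fun ij : κ × κ => P ij.1 ij.2)
      refine ⟨n, fun k ⟨f, g, hf, hfg⟩ => ?_⟩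
      by_contra! hlt
      refine hf (funext fun i => ?_)
      refine eq_zero_of_ι₁_eq (g := ∑ j, p (i, j) * g j) (n := n - k) (by omega) ?_
      have h1 : ι₁ ∘ f = ((t ^ (-k) : R₁₂ˣ) : R₁₂) • (P *ᵥ (ι₂ ∘ g)) := by
        rw [← hfg, Matrix.smul_mulVec, Matrix.mulVec_smul, Matrix.mulVec_mulVec, hPM, smul_smul,
          ← Units.val_mul, ← _root_.zpow_add, neg_add_cancel, zpow_zero, Units.val_one, one_smul,
          Matrix.one_mulVec]
      have h2 := congrFun h1 i
      change ι₁ (f i) = _ at h2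
      rw [h2, Pi.smul_apply, smul_eq_mul, map_sum]
      simp only [map_mul, hp, Matrix.mulVec, dotProduct, Function.comp_apply, Finset.mul_sum]
      refine Finset.sum_congr rfl fun j _ => ?_
      rw [← mul_assoc, ← mul_assoc, ← mul_assoc, ← Units.val_mul, ← _root_.zpow_add]
      congr 5
      ring) (by
      obtain ⟨k₀⟩ := ‹Nonempty κ›
      obtain ⟨n, g, hg⟩ := exists_ι₂_eq_zpow_mul (fun i => M i k₀)
      refine ⟨-n, Pi.single k₀ 1, g, fun h0 => one_ne_zero (α := R₁) ?_, ?_⟩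
      · simpa using congrFun h0 k₀
      · have h1 : ι₁ ∘ (Pi.single k₀ 1 : κ → R₁) = Pi.single k₀ 1 := by
          ext i
          by_cases hi : i = k₀
          · subst hi; simp
          · simp [hi]
        rw [h1, Matrix.mulVec_single_one]
        ext i
        simp [hg i])
  exact ⟨k, hk, fun h => by have := hmax _ h; omega⟩

/-- A matrix with a section that does not vanish anywhere is equivalent to a block triangular
matrix. -/
lemma exists_transEquiv_fromBlocks (hP : M * P = 1) (hM : HasSection ι₁ ι₂ M)
    (h : ¬ HasSection ι₁ ι₂ ((t : R₁₂) • M)) :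
    ∃ (m : ℕ) (b : Matrix Unit (Fin m) R₁₂) (M' P' : Matrix (Fin m) (Fin m) R₁₂),
      1 + m = Fintype.card κ ∧ M' * P' = 1 ∧
        TransEquiv ι₁ ι₂ M (fromBlocks 1 b 0 M') := by
  obtain ⟨f, g, hf, hfg⟩ := hM
  obtain ⟨m, S, S', hm, hS, hS', hSf⟩ := exists_matrix_of_span_eq_top f
    (span_eq_top_of_section hf hfg h)
  obtain ⟨m', T, T', hm', hT, hT', hTg⟩ := exists_matrix_of_span_eq_top g
    (span_eq_top_of_section' hf hfg hP h)
  obtain rfl : m = m' := by omega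
  -- In frames starting with `f` on `U₁` and with `g` on `U₂`, the section is the first basis vector
  -- on both sides, so the first column of the matrix is standard.
  set N := T'.map ι₂ * M * S.map ι₁ with hN
  have hcol : ∀ i, N i (Sum.inl ()) = (1 : Matrix (Unit ⊕ Fin m) (Unit ⊕ Fin m) R₁₂) i (Sum.inl ()) := by
    intro i
    have h1 : (S.map ι₁).col (Sum.inl ()) = ι₁ ∘ f := funext fun k => congrArg ι₁ (hSf k)
    have h2 : T.col (Sum.inl ()) = g := funext hTg
    have h3 : N.col (Sum.inl ()) = ι₂ ∘ (T' *ᵥ g) := by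
      rw [hN, ← map_mulVec_comp, ← hfg, ← h1, Matrix.mulVec_mulVec]
      rfl
    have h4 : T' *ᵥ g = (1 : Matrix (Unit ⊕ Fin m) (Unit ⊕ Fin m) R₂).col (Sum.inl ()) := by
      rw [← hT', ← h2]
      rfl
    rw [h4] at h3
    refine (congrFun h3 i).trans ?_
    change ι₂ ((1 : Matrix (Unit ⊕ Fin m) (Unit ⊕ Fin m) R₂) i (Sum.inl ())) = _
    rw [Matrix.one_apply, Matrix.one_apply, apply_ite ι₂, map_one, map_zero]
  have hNe : N = fromBlocks 1 N.toBlocks₁₂ 0 N.toBlocks₂₂ := by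
    conv_lhs => rw [← fromBlocks_toBlocks N]
    congr 1
    · ext ⟨⟩ ⟨⟩
      exact (hcol _).trans (by simp)
    · ext i ⟨⟩
      exact (hcol _).trans (by simp)
  have hTE : TransEquiv ι₁ ι₂ M N := ⟨T', T, S, S', hT', hT, hS, hS', rfl⟩
  have hdet : IsUnit N.toBlocks₂₂.det := by
    have h1 : N * (S'.map ι₁ * P * T.map ι₂) = 1 := by
      have e1 : S.map ι₁ * S'.map ι₁ = 1 := by
        rw [← Matrix.map_mul, hS, Matrix.map_one _ (map_zero _) (map_one _)]
      have e2 : T'.map ι₂ * T.map ι₂ = 1 := by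
        rw [← Matrix.map_mul, hT', Matrix.map_one _ (map_zero _) (map_one _)]
      rw [hN, ← Matrix.mul_assoc, ← Matrix.mul_assoc, Matrix.mul_assoc _ (S.map ι₁), e1,
        Matrix.mul_one, Matrix.mul_assoc _ M, hP, Matrix.mul_one, e2]
    have h2 := Matrix.isUnit_det_of_right_inverse h1
    rw [hNe, det_fromBlocks_zero₂₁, det_one, one_mul] at h2
    exact h2
  exact ⟨m, N.toBlocks₁₂, N.toBlocks₂₂, N.toBlocks₂₂⁻¹, hm, Matrix.mul_nonsing_inv _ hdet,
    hNe ▸ hTE⟩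

end Sections

end

/-! ### Extensions of block matrices -/

section

open Matrix

/-- The block diagonal matrix with blocks `t ^ r a` and `oddBlock (s b)`. -/
def blockMatrix {α β : Type} [DecidableEq α] [DecidableEq β] (r : α → ℤ) (s : β → ℤ) :
    Matrix (α ⊕ Fin 2 × β) (α ⊕ Fin 2 × β) R₁₂ :=
  fromBlocks (diagonal fun a => evenBlock (r a)) 0 0 (blockDiagonal fun b => oddBlock (s b))

lemma ι₁_smul (c : ℝ) (f : R₁) : ι₁ (c • f) = c • ι₁ f := by
  rw [Algebra.smul_def, Algebra.smul_def, map_mul, ι₁_algebraMap]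

lemma ι₂_smul (c : ℝ) (f : R₂) : ι₂ (c • f) = c • ι₂ f := by
  rw [Algebra.smul_def, Algebra.smul_def, map_mul, ι₂_algebraMap]

lemma t_zpow_mul (m n : ℤ) : ((t ^ m : R₁₂ˣ) : R₁₂) * ((t ^ n : R₁₂ˣ) : R₁₂) =
    ((t ^ (m + n) : R₁₂ˣ) : R₁₂) := by
  rw [← Units.val_mul, ← _root_.zpow_add]

lemma t_zpow_zero : ((t ^ (0 : ℤ) : R₁₂ˣ) : R₁₂) = 1 := by simp

lemma t_zpow_one : ((t ^ (1 : ℤ) : R₁₂ˣ) : R₁₂) = t := by simp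

lemma exists_ι₁_eq_zpow {k : ℤ} (hk : 0 ≤ k) : ∃ g, ι₁ g = ((t ^ k : R₁₂ˣ) : R₁₂) := by
  lift k to ℕ using hk
  exact ⟨t₁ ^ k, by rw [map_pow, ι₁_t₁]; simp⟩

lemma exists_ι₁_eq_xz_zpow {k : ℤ} (hk : 0 ≤ k) : ∃ g, ι₁ g = xz * ((t ^ k : R₁₂ˣ) : R₁₂) := by
  obtain ⟨g, hg⟩ := exists_ι₁_eq_zpow hk
  exact ⟨x₁ * g, by rw [map_mul, hg, ι₁_x₁]⟩

lemma exists_ι₂_eq_zpow {k : ℤ} (hk : k ≤ 0) : ∃ g, ι₂ g = ((t ^ k : R₁₂ˣ) : R₁₂) := by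
  obtain ⟨n, rfl⟩ : ∃ n : ℕ, k = -n := ⟨k.natAbs, by omega⟩
  exact ⟨t₂ ^ n, by rw [map_pow, ι₂_t₂]; simp⟩

lemma exists_ι₂_eq_xz_zpow {k : ℤ} (hk : k < 0) : ∃ g, ι₂ g = xz * ((t ^ k : R₁₂ˣ) : R₁₂) := by
  obtain ⟨g, hg⟩ := exists_ι₂_eq_zpow (k := k + 1) (by omega)
  refine ⟨x₂ * g, ?_⟩
  rw [map_mul, hg, ι₂_x₂, ← _root_.zpow_neg_one, mul_assoc, t_zpow_mul, neg_add_cancel_comm_assoc]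

/-- The functions on `U₁ ⊓ U₂` of the form `f + t ^ r g`, with `f` regular on `U₁` and `g` regular
on `U₂`. -/
lemma exists_split {r : ℤ} (hr : -1 ≤ r) {f : R₁₂} (h : 0 ≤ r ∨ coeffB (-1) f = 0) :
    ∃ f₁ f₂, f = ι₁ f₁ + ((t ^ r : R₁₂ˣ) : R₁₂) * ι₂ f₂ := by
  let S : AddSubgroup R₁₂ :=
    { carrier := {f | ∃ f₁ f₂, f = ι₁ f₁ + ((t ^ r : R₁₂ˣ) : R₁₂) * ι₂ f₂}
      add_mem' := by
        rintro _ _ ⟨f₁, f₂, rfl⟩ ⟨g₁, g₂, rfl⟩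
        exact ⟨f₁ + g₁, f₂ + g₂, by rw [map_add, map_add]; ring⟩
      zero_mem' := ⟨0, 0, by simp⟩
      neg_mem' := by
        rintro _ ⟨f₁, f₂, rfl⟩
        exact ⟨-f₁, -f₂, by rw [map_neg, map_neg]; ring⟩ }
  have h₁ : ∀ (c : ℝ) {f : R₁₂}, (∃ g, ι₁ g = f) → algebraMap ℝ R₁₂ c * f ∈ S := by
    rintro c _ ⟨g, rfl⟩
    exact ⟨algebraMap ℝ R₁ c * g, 0, by rw [map_mul, ι₁_algebraMap, map_zero]; ring⟩
  have h₂ : ∀ (c : ℝ) {f : R₁₂}, (∃ g, ι₂ g = ((t ^ (-r) : R₁₂ˣ) : R₁₂) * f) →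
      algebraMap ℝ R₁₂ c * f ∈ S := by
    rintro c f ⟨g, hg⟩
    refine ⟨0, algebraMap ℝ R₂ c * g, ?_⟩
    rw [map_mul, ι₂_algebraMap, map_zero, hg, zero_add, mul_left_comm, ← mul_assoc (Units.val _),
      t_zpow_mul, add_neg_cancel, t_zpow_zero, one_mul]
  obtain ⟨s, -, hf⟩ := eq_sum_coeff f
  change f ∈ S
  rw [hf]
  refine sum_mem fun k _ => add_mem ?_ ?_
  · rcases le_or_gt 0 k with hk | hk
    · exact h₁ _ (exists_ι₁_eq_zpow hk)
    · refine h₂ _ ?_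
      rw [t_zpow_mul]
      exact exists_ι₂_eq_zpow (by omega)
  · rcases le_or_gt 0 k with hk | hk
    · exact h₁ _ (exists_ι₁_eq_xz_zpow hk)
    · by_cases hkr : -r + k < 0
      · refine h₂ _ ?_
        rw [mul_left_comm, t_zpow_mul]
        exact exists_ι₂_eq_xz_zpow hkr
      -- This case needs r = -1. The monomial (x/z)t⁻¹ is the one that can be moved to neither side;
      -- the quotient of `R₁₂` by R₁ + t⁻¹R₂ is the first cohomology of Ω.
      · have : k = -1 := by omega
        subst this
        rw [h.resolve_left (by omega), map_zero, zero_mul]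
        exact zero_mem _

lemma smul_blockMatrix {α β : Type} [DecidableEq α] [DecidableEq β] (r : α → ℤ) (s : β → ℤ) (k : ℤ) :
    ((t ^ k : R₁₂ˣ) : R₁₂) • blockMatrix r s = blockMatrix (fun a => k + r a) (fun b => k + s b) := by
  rw [blockMatrix, blockMatrix, fromBlocks_smul, smul_zero, smul_zero, ← diagonal_smul,
    ← blockDiagonal_smul]
  congr 2
  · ext a
    exact t_zpow_mul _ _
  · ext b : 1
    ext i j
    fin_cases i <;> fin_cases j <;>
      simp [oddBlock, mul_left_comm _ xz, ← Units.val_mul, ← _root_.zpow_add, add_assoc]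

lemma transEquiv_blockMatrix_comp {α β α' β' : Type} [DecidableEq α] [DecidableEq β] [DecidableEq α']
    [DecidableEq β'] [Fintype α] [Fintype β] [Fintype α'] [Fintype β'] (r : α → ℤ) (s : β → ℤ)
    (e : α' ≃ α) (e' : β' ≃ β) :
    TransEquiv ι₁ ι₂ (blockMatrix r s) (blockMatrix (r ∘ e) (s ∘ e')) := by
  refine (transEquiv_submatrix _ (Equiv.sumCongr e ((Equiv.refl _).prodCongr e'))).trans
    (transEquiv_of_eq ?_)
  ext (i | ⟨i, j⟩) (i' | ⟨i', j'⟩)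
  · simp [blockMatrix, diagonal_apply]
  · simp [blockMatrix]
  · simp [blockMatrix]
  · simp [blockMatrix, blockDiagonal_apply]

/-! ### Extensions of a block matrix whose next twist has no section. -/

section Extension

variable {ν : Type} [Fintype ν] [DecidableEq ν]

omit [DecidableEq ν] in
-- A section φ of tD lifts to the twisted extension once the coefficient of (x/z)t⁻¹ in bφ vanishes,
-- by `exists_split`. This is a single real linear condition, so some nontrivial real combination of
-- two independent sections lifts.
lemma false_of_two_sections {b : Matrix Unit ν R₁₂} {D : Matrix ν ν R₁₂}
    (h : ¬ HasSection ι₁ ι₂ ((t : R₁₂) • fromBlocks (1 : Matrix Unit Unit R₁₂) b 0 D))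
    (f g : ν → R₁)
    (hli : ∀ a c : ℝ, algebraMap ℝ R₁ a • f + algebraMap ℝ R₁ c • g = 0 → a = 0 ∧ c = 0)
    (hf : ∃ p, ((t : R₁₂) • D) *ᵥ (ι₁ ∘ f) = ι₂ ∘ p)
    (hg : ∃ q, ((t : R₁₂) • D) *ᵥ (ι₁ ∘ g) = ι₂ ∘ q) : False := by
  obtain ⟨p, hp⟩ := hf
  obtain ⟨q, hq⟩ := hg
  obtain ⟨a, c, hne, hac⟩ : ∃ a c : ℝ, ¬ (a = 0 ∧ c = 0) ∧
      a * coeffB (-1) ((b *ᵥ (ι₁ ∘ f)) ()) + c * coeffB (-1) ((b *ᵥ (ι₁ ∘ g)) ()) = 0 := by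
    by_cases h0 : coeffB (-1) ((b *ᵥ (ι₁ ∘ f)) ()) = 0
    · exact ⟨1, 0, by simp, by simp [h0]⟩
    · exact ⟨-coeffB (-1) ((b *ᵥ (ι₁ ∘ g)) ()), coeffB (-1) ((b *ᵥ (ι₁ ∘ f)) ()), fun h => h0 h.2,
        by ring⟩
  set φ := algebraMap ℝ R₁ a • f + algebraMap ℝ R₁ c • g with hφ
  have hφ' : ι₁ ∘ φ = algebraMap ℝ R₁₂ a • (ι₁ ∘ f) + algebraMap ℝ R₁₂ c • (ι₁ ∘ g) := by
    ext k
    simp [hφ, ι₁_smul]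
  have hb : coeffB (-1) ((b *ᵥ (ι₁ ∘ φ)) ()) = 0 := by
    rw [hφ', Matrix.mulVec_add, Matrix.mulVec_smul, Matrix.mulVec_smul, Pi.add_apply, Pi.smul_apply,
      Pi.smul_apply, algebraMap_smul, algebraMap_smul, map_add, map_smul, map_smul, smul_eq_mul,
      smul_eq_mul, hac]
  obtain ⟨f₁, f₂, h12⟩ := exists_split (r := -1) le_rfl (.inr hb)
  refine h ⟨Sum.elim (fun _ => -f₁) φ, Sum.elim (fun _ => f₂)
    (algebraMap ℝ R₂ a • p + algebraMap ℝ R₂ c • q), fun h0 => hne (hli a c ?_), ?_⟩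
  · ext k : 1
    exact congrFun h0 (Sum.inr k)
  · have e : ι₁ ∘ Sum.elim (fun _ : Unit => -f₁) φ = Sum.elim (fun _ => -ι₁ f₁) (ι₁ ∘ φ) := by
      ext (k | k) <;> simp
    rw [Matrix.smul_mulVec, e, fromBlocks_mulVec]
    ext (⟨⟩ | k)
    · simp only [Matrix.one_mulVec, Pi.smul_apply, Sum.elim_inl, Pi.add_apply, Function.comp_apply,
        smul_eq_mul, Sum.elim_comp_inl, Sum.elim_comp_inr]
      rw [h12, _root_.zpow_neg_one]
      linear_combination (ι₂ f₂) * t_mul_t_inv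
    · simp only [Matrix.zero_mulVec, Pi.smul_apply, Sum.elim_inr, Function.comp_apply,
        smul_eq_mul, Sum.elim_comp_inl, Sum.elim_comp_inr, zero_add]
      have e1 := congrFun (Matrix.smul_mulVec (t : R₁₂) D (ι₁ ∘ φ)) k
      rw [Pi.smul_apply, smul_eq_mul] at e1
      rw [← e1, hφ', Matrix.mulVec_add, Matrix.mulVec_smul, Matrix.mulVec_smul, hp, hq]
      simp [ι₂_smul]

end Extension

section Clear

variable {α β : Type} [Fintype α] [Fintype β] [DecidableEq α] [DecidableEq β] {r : α → ℤ} {s : β → ℤ}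
  {b : Matrix Unit (α ⊕ Fin 2 × β) R₁₂}

lemma ι₁_comp_single {ν : Type} [DecidableEq ν] (i : ν) (f : R₁) :
    ι₁ ∘ (Pi.single i f : ν → R₁) = Pi.single i (ι₁ f) := by
  ext k
  by_cases hk : k = i
  · subst hk; simp
  · simp [hk]

lemma exists_smul_blockMatrix_mulVec_inl (i : α) {f : R₁}
    (hf : ∃ g, ι₂ g = ((t ^ (1 + r i) : R₁₂ˣ) : R₁₂) * ι₁ f) :
    ∃ p, ((t : R₁₂) • blockMatrix r s) *ᵥ (ι₁ ∘ Pi.single (Sum.inl i) f) = ι₂ ∘ p := by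
  obtain ⟨g, hg⟩ := hf
  refine ⟨Pi.single (Sum.inl i) g, ?_⟩
  rw [ι₁_comp_single, ← t_zpow_one, smul_blockMatrix]
  ext (k | k)
  · by_cases hk : k = i
    · subst hk
      simp [blockMatrix, evenBlock, hg]
    · simp [blockMatrix, hk]
  · simp [blockMatrix]

lemma exists_smul_blockMatrix_mulVec_inr (i : β) (k : Fin 2) (hs : s i ≤ -2) :
    ∃ p, ((t : R₁₂) • blockMatrix r s) *ᵥ (ι₁ ∘ Pi.single (Sum.inr (k, i)) 1) = ι₂ ∘ p := by
  have h : ∀ l, ∃ p, ι₂ p = oddBlock (1 + s i) l k := by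
    intro l
    fin_cases l <;> fin_cases k
    · exact exists_ι₂_eq_zpow (by omega)
    · exact exists_ι₂_eq_xz_zpow (by omega)
    · exact ⟨0, map_zero _⟩
    · exact exists_ι₂_eq_zpow (by omega)
  choose p hp using h
  refine ⟨Sum.elim 0 fun l => if l.2 = i then p l.1 else 0, ?_⟩
  rw [ι₁_comp_single, ← t_zpow_one, smul_blockMatrix, map_one, mulVec_single_one]
  ext (l | ⟨l, j⟩)
  · simp [blockMatrix]
  · by_cases hj : j = i
    · subst hj
      simp [blockMatrix, blockDiagonal_apply, hp]
    · simp [blockMatrix, blockDiagonal_apply, hj]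

variable (h : ¬ HasSection ι₁ ι₂
  ((t : R₁₂) • fromBlocks (1 : Matrix Unit Unit R₁₂) b 0 (blockMatrix r s)))
include h

/-- If the exponent were at most -2, both 1 and t would be sections of this line after the twist by
t. -/
lemma neg_one_le_of_not_hasSection_inl (i : α) : -1 ≤ r i := by
  by_contra! hr
  refine false_of_two_sections h (Pi.single (Sum.inl i) 1) (Pi.single (Sum.inl i) t₁)
    (fun a c hac => ?_) (exists_smul_blockMatrix_mulVec_inl i ?_)
    (exists_smul_blockMatrix_mulVec_inl i ?_)
  · have h1 := congrArg ι₁ (congrFun hac (Sum.inl i))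
    simp only [Pi.add_apply, Pi.smul_apply, Pi.single_eq_same, smul_eq_mul, mul_one, Pi.zero_apply,
      map_zero, map_add, map_mul, ι₁_algebraMap, ι₁_t₁] at h1
    rw [mul_comm, ← t_zpow_one] at h1
    have h2 := congrArg (coeffA 0) h1
    have h3 := congrArg (coeffA 1) h1
    rw [map_add, coeffA_t_mul, coeffA_algebraMap, coeffA_algebraMap, map_zero] at h2 h3
    simp at h2 h3
    exact ⟨h2, h3⟩
  · rw [map_one, mul_one]
    exact exists_ι₂_eq_zpow (by omega)
  · rw [ι₁_t₁, ← t_zpow_one, t_zpow_mul]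
    exact exists_ι₂_eq_zpow (by omega)

omit h in
lemma single_add_single_eq_zero {ν : Type} [DecidableEq ν] {i j : ν} (hij : i ≠ j) (a c : ℝ)
    (hac : algebraMap ℝ R₁ a • Pi.single i (1 : R₁) + algebraMap ℝ R₁ c • Pi.single j (1 : R₁) = 0) :
    a = 0 ∧ c = 0 := by
  have h1 := congrFun hac i
  have h2 := congrFun hac j
  simp [hij, hij.symm] at h1 h2
  exact ⟨h1, h2⟩

/-- If the exponent were at most -2, both basis vectors of the 2 × 2 block would be sections after
the twist by t. -/
lemma neg_one_le_of_not_hasSection_inr (i : β) : -1 ≤ s i := by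
  by_contra! hs
  exact false_of_two_sections h (Pi.single (Sum.inr (0, i)) 1) (Pi.single (Sum.inr (1, i)) 1)
    (single_add_single_eq_zero (by simp)) (exists_smul_blockMatrix_mulVec_inr i 0 (by omega))
    (exists_smul_blockMatrix_mulVec_inr i 1 (by omega))

/-- A line of exponent -1 becomes trivial in the twist and contributes the section 1; two such lines
would give two independent sections. -/
lemma eq_of_eq_neg_one {i j : α} (hi : r i = -1) (hj : r j = -1) : i = j := by
  by_contra hij
  refine false_of_two_sections h (Pi.single (Sum.inl i) 1) (Pi.single (Sum.inl j) 1)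
    (single_add_single_eq_zero (by simpa using hij)) (exists_smul_blockMatrix_mulVec_inl i ?_)
    (exists_smul_blockMatrix_mulVec_inl j ?_)
  · rw [hi, map_one, mul_one]
    exact exists_ι₂_eq_zpow (by omega)
  · rw [hj, map_one, mul_one]
    exact exists_ι₂_eq_zpow (by omega)

end Clear

end

/-! ### Merging blocks -/

section

open Matrix

lemma coeffB_xz_mul_t_inv : coeffB (-1) (xz * ((t ^ (-1 : ℤ) : R₁₂ˣ) : R₁₂)) = 1 := by
  have := coeffA_t_mul (-1) (-1) (algebraMap ℝ R₁₂ 1)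
  rw [map_one, mul_one] at this
  rw [coeffB_xz_mul, this, ← map_one (algebraMap ℝ R₁₂), coeffA_algebraMap]
  simp

/-- An entry over the block t^q may be changed by elements of R₁ + t^q R₂, and only for q = -1 can a
multiple of (x/z)t⁻¹ survive. -/
lemma exists_clear_line {q : ℤ} (hq : -1 ≤ q) (f : R₁₂) : ∃ (L : R₂) (S : R₁) (c : ℝ),
    f + ι₂ L * ((t ^ q : R₁₂ˣ) : R₁₂) + ι₁ S = c • (xz * ((t ^ (-1 : ℤ) : R₁₂ˣ) : R₁₂)) ∧
      (c ≠ 0 → q = -1) := by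
  rcases hq.lt_or_eq with h | rfl
  · obtain ⟨f₁, f₂, hf⟩ := exists_split hq (f := f) (.inl (by omega))
    refine ⟨-f₂, -f₁, 0, ?_, by simp⟩
    rw [map_neg, map_neg, zero_smul]
    linear_combination hf
  · set c := coeffB (-1) f
    obtain ⟨f₁, f₂, hf⟩ := exists_split (r := -1) le_rfl
      (f := f - c • (xz * ((t ^ (-1 : ℤ) : R₁₂ˣ) : R₁₂)))
      (.inr (by rw [map_sub, map_smul, coeffB_xz_mul_t_inv]; simp [c]))
    refine ⟨-f₂, -f₁, c, ?_, fun _ => rfl⟩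
    rw [map_neg, map_neg]
    linear_combination hf

/-- A block `oddBlock q` with q ≥ -1 has no nontrivial extension by the trivial line. -/
lemma exists_clear_quillen {q : ℤ} (hq : -1 ≤ q) (f₀ f₁ : R₁₂) : ∃ (L₀ L₁ : R₂) (S₀ S₁ : R₁),
    f₀ + ι₂ L₀ * ((t ^ (q + 1) : R₁₂ˣ) : R₁₂) + ι₁ S₀ = 0 ∧
      f₁ + (ι₂ L₀ * (xz * ((t ^ q : R₁₂ˣ) : R₁₂)) + ι₂ L₁ * ((t ^ q : R₁₂ˣ) : R₁₂)) + ι₁ S₁ = 0 := by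
  obtain ⟨a₁, a₂, ha⟩ := exists_split (r := q + 1) (by omega) (f := f₀) (.inl (by omega))
  rcases hq.lt_or_eq with h | rfl
  · obtain ⟨b₁, b₂, hb⟩ := exists_split hq (f := f₁ - ι₂ a₂ * (xz * ((t ^ q : R₁₂ˣ) : R₁₂)))
      (.inl (by omega))
    refine ⟨-a₂, -b₂, -a₁, -b₁, ?_, ?_⟩ <;> simp only [map_neg]
    · linear_combination ha
    · linear_combination hb
  · set g := f₁ - ι₂ a₂ * (xz * ((t ^ (-1 : ℤ) : R₁₂ˣ) : R₁₂)) with hg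
    set c := coeffB (-1) g
    obtain ⟨b₁, b₂, hb⟩ := exists_split (r := -1) le_rfl
      (f := g - c • (xz * ((t ^ (-1 : ℤ) : R₁₂ˣ) : R₁₂)))
      (.inr (by rw [map_sub, map_smul, coeffB_xz_mul_t_inv]; simp [c]))
    rw [neg_add_cancel, t_zpow_zero] at ha ⊢
    -- The first diagonal entry is now 1, so a constant can be moved from `L₀` to `S₀` without
    -- changing the first equation. In the second equation it contributes a multiple of (x/z)t⁻¹,
    -- which removes the remaining obstruction.
    refine ⟨-a₂ - algebraMap ℝ R₂ c, -b₂, -a₁ + algebraMap ℝ R₁ c, -b₁, ?_, ?_⟩ <;>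
      simp only [map_neg, map_sub, map_add, ι₁_algebraMap, ι₂_algebraMap]
    · linear_combination ha
    · rw [Algebra.smul_def, hg] at hb
      linear_combination hb

section Clear

variable {α β : Type} [Fintype α] [Fintype β] [DecidableEq α] [DecidableEq β] {r : α → ℤ} {s : β → ℤ}

lemma exists_clear (b : Matrix Unit (α ⊕ Fin 2 × β) R₁₂) (hr : ∀ i, -1 ≤ r i) (hs : ∀ j, -1 ≤ s j) :
    ∃ c : α → ℝ, (∀ i, c i ≠ 0 → r i = -1) ∧
      TransEquiv ι₁ ι₂ (fromBlocks (1 : Matrix Unit Unit R₁₂) b 0 (blockMatrix r s))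
        (fromBlocks (1 : Matrix Unit Unit R₁₂) (of fun _ => Sum.elim
          (fun i => c i • (xz * ((t ^ (-1 : ℤ) : R₁₂ˣ) : R₁₂))) 0) 0 (blockMatrix r s)) := by
  choose L S c hc hc' using fun i => exists_clear_line (hr i) (b () (Sum.inl i))
  choose L₀ L₁ S₀ S₁ h₀ h₁ using fun j => exists_clear_quillen (hs j) (b () (Sum.inr (0, j)))
    (b () (Sum.inr (1, j)))
  refine ⟨c, hc', (transEquiv_fromBlocks_add _ b (blockMatrix r s)
    (of fun _ => Sum.elim L fun l => ![L₀ l.2, L₁ l.2] l.1)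
    (of fun _ => Sum.elim S fun l => ![S₀ l.2, S₁ l.2] l.1)).trans (transEquiv_of_eq ?_)⟩
  congr 1
  ext ⟨⟩ (i | ⟨k, j⟩)
  · simp only [Matrix.one_mul, Matrix.add_apply, Matrix.mul_apply, Fintype.sum_sum_type, blockMatrix,
      fromBlocks_apply₁₁, fromBlocks_apply₂₁, diagonal_apply, Matrix.map_apply, of_apply, Sum.elim_inl,
      Matrix.zero_apply, mul_zero, Finset.sum_const_zero, add_zero, mul_ite, Finset.sum_ite_eq',
      Finset.mem_univ, if_true]
    exact hc i
  · simp only [Matrix.one_mul, Matrix.add_apply, Matrix.mul_apply, Fintype.sum_sum_type, blockMatrix,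
      fromBlocks_apply₁₂, fromBlocks_apply₂₂, Matrix.map_apply, of_apply, Sum.elim_inr,
      Matrix.zero_apply, mul_zero, Finset.sum_const_zero, zero_add, mul_ite, Finset.sum_ite_eq',
      Finset.mem_univ, if_true, blockDiagonal_apply, Fintype.sum_prod_type, Fin.sum_univ_two,
      Pi.zero_apply]
    fin_cases k
    · simpa [oddBlock] using h₀ j
    · simpa [oddBlock] using h₁ j

omit [Fintype α] [Fintype β] in
lemma fromBlocks_one_zero_eq (r : α → ℤ) (s : β → ℤ) :
    (blockMatrix (Sum.elim (fun _ : Unit => 0) r) s) =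
      (fromBlocks (1 : Matrix Unit Unit R₁₂) 0 0 (blockMatrix r s)).submatrix
        (Equiv.sumAssoc Unit α (Fin 2 × β)) (Equiv.sumAssoc Unit α (Fin 2 × β)) := by
  ext ((⟨⟩ | i) | ⟨k, j⟩) ((⟨⟩ | i') | ⟨k', j'⟩)
  all_goals simp [blockMatrix, diagonal_apply, evenBlock]

/-- The index of the rows of the block matrix in which a line of degree `0` and the line of index
`i₀` are replaced by a `2 × 2` block. -/
def mergeIdx (i₀ : α) : {i : α // i ≠ i₀} ⊕ Fin 2 × (Unit ⊕ β) → Unit ⊕ (α ⊕ Fin 2 × β)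
  | .inl i => .inr (.inl i)
  | .inr (k, .inr j) => .inr (.inr (k, j))
  | .inr (0, .inl ()) => .inl ()
  | .inr (1, .inl ()) => .inr (.inl i₀)

omit [Fintype α] [Fintype β] [DecidableEq β] in
lemma mergeIdx_bijective (i₀ : α) : Function.Bijective (mergeIdx (β := β) i₀) := by
  have h2 : ∀ k : Fin 2, k = 0 ∨ k = 1 := by decide
  constructor
  · rintro (⟨i, hi⟩ | ⟨k, ⟨⟩ | j⟩) (⟨i', hi'⟩ | ⟨k', ⟨⟩ | j'⟩) h
    all_goals
      try rcases h2 k with rfl | rfl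
      all_goals try rcases h2 k' with rfl | rfl
      all_goals simp_all [mergeIdx]
    exact hi' h.symm
  · rintro (⟨⟩ | i | ⟨k, j⟩)
    · exact ⟨.inr (0, .inl ()), rfl⟩
    · by_cases hi : i = i₀
      · exact ⟨.inr (1, .inl ()), by rw [hi]; rfl⟩
      · exact ⟨.inl ⟨i, hi⟩, rfl⟩
    · exact ⟨.inr (k, .inr j), rfl⟩

omit [Fintype α] [Fintype β] in
-- The diagonal entries 1 and t⁻¹, joined by the entry (x/z)t⁻¹, are literally `oddBlock (-1)`.
lemma submatrix_mergeIdx (i₀ : α) (hi₀ : r i₀ = -1) :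
    (fromBlocks (1 : Matrix Unit Unit R₁₂) (of fun _ => Sum.elim
      (Pi.single i₀ (xz * ((t ^ (-1 : ℤ) : R₁₂ˣ) : R₁₂))) 0) 0 (blockMatrix r s)).submatrix
        (mergeIdx i₀) (mergeIdx i₀) =
      blockMatrix (fun i : {i : α // i ≠ i₀} => r i) (Sum.elim (fun _ : Unit => -1) s) := by
  have h2 : ∀ k : Fin 2, k = 0 ∨ k = 1 := by decide
  ext (⟨i, hi⟩ | ⟨k, ⟨⟩ | j⟩) (⟨i', hi'⟩ | ⟨k', ⟨⟩ | j'⟩)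
  · simp [mergeIdx, blockMatrix, diagonal_apply]
  · rcases h2 k' with rfl | rfl <;> simp [mergeIdx, blockMatrix, hi]
  · simp [mergeIdx, blockMatrix]
  · rcases h2 k with rfl | rfl <;> simp [mergeIdx, blockMatrix, hi', hi'.symm]
  · rcases h2 k with rfl | rfl <;> rcases h2 k' with rfl | rfl <;>
      simp [mergeIdx, blockMatrix, oddBlock, evenBlock, hi₀]
  · rcases h2 k with rfl | rfl <;> simp [mergeIdx, blockMatrix, blockDiagonal_apply]
  · simp [mergeIdx, blockMatrix]
  · rcases h2 k' with rfl | rfl <;> simp [mergeIdx, blockMatrix, blockDiagonal_apply]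
  · simp [mergeIdx, blockMatrix, blockDiagonal_apply]

/-- Rescaling the first frame vector by a real constant normalises a nonzero class to 1, after which
the two rows form a single block. -/
lemma transEquiv_merge (i₀ : α) (hi₀ : r i₀ = -1) {c : α → ℝ} (hc : c i₀ ≠ 0)
    (hc' : ∀ i ≠ i₀, c i = 0) :
    TransEquiv ι₁ ι₂ (fromBlocks (1 : Matrix Unit Unit R₁₂) (of fun _ => Sum.elim
          (fun i => c i • (xz * ((t ^ (-1 : ℤ) : R₁₂ˣ) : R₁₂))) 0) 0 (blockMatrix r s))
      (blockMatrix (fun i : {i : α // i ≠ i₀} => r i) (Sum.elim (fun _ : Unit => -1) s)) := by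
  have hdiag : ∀ {A : Type} [CommRing A] [Algebra ℝ A] (a a' : ℝ), a * a' = 1 →
      fromBlocks (algebraMap ℝ A a • (1 : Matrix Unit Unit A)) 0 0 (1 : Matrix (α ⊕ Fin 2 × β) (α ⊕ Fin 2 × β) A) *
      fromBlocks (algebraMap ℝ A a' • (1 : Matrix Unit Unit A)) 0 0 (1 : Matrix (α ⊕ Fin 2 × β) (α ⊕ Fin 2 × β) A) = 1 := by
    intro A _ _ a a' h
    simp [fromBlocks_multiply, smul_smul, mul_comm a', h]
  have step : TransEquiv ι₁ ι₂ (fromBlocks (1 : Matrix Unit Unit R₁₂) (of fun _ => Sum.elim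
          (fun i => c i • (xz * ((t ^ (-1 : ℤ) : R₁₂ˣ) : R₁₂))) 0) 0 (blockMatrix r s))
      (fromBlocks (1 : Matrix Unit Unit R₁₂) (of fun _ => Sum.elim
          (Pi.single i₀ (xz * ((t ^ (-1 : ℤ) : R₁₂ˣ) : R₁₂))) 0) 0 (blockMatrix r s)) := by
    refine ⟨fromBlocks (algebraMap ℝ R₂ (c i₀)⁻¹ • 1) 0 0 1, fromBlocks (algebraMap ℝ R₂ (c i₀) • 1) 0 0 1,
      fromBlocks (algebraMap ℝ R₁ (c i₀) • 1) 0 0 1, fromBlocks (algebraMap ℝ R₁ (c i₀)⁻¹ • 1) 0 0 1,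
      hdiag _ _ (inv_mul_cancel₀ hc), hdiag _ _ (mul_inv_cancel₀ hc),
      hdiag _ _ (mul_inv_cancel₀ hc), hdiag _ _ (inv_mul_cancel₀ hc), ?_⟩
    have e₁ : (algebraMap ℝ R₁ (c i₀) • (1 : Matrix Unit Unit R₁)).map ι₁ = (c i₀) • 1 := by
      ext; simp [ι₁_smul]
    have e₂ : (algebraMap ℝ R₂ (c i₀)⁻¹ • (1 : Matrix Unit Unit R₂)).map ι₂ = (c i₀)⁻¹ • 1 := by
      ext; simp [ι₂_smul]
    rw [fromBlocks_map, fromBlocks_map, e₁, e₂, fromBlocks_multiply, fromBlocks_multiply]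
    congr 1
    · simp [smul_smul, hc]
    · ext ⟨⟩ (i | i)
      · by_cases hi : i = i₀
        · subst hi
          simp [Matrix.map_one, smul_smul, hc]
        · simp [Matrix.map_one, hi, hc' i hi]
      · simp [Matrix.map_one]
    · simp [Matrix.map_one]
    · simp [Matrix.map_one]
  exact step.trans ((transEquiv_submatrix _ (Equiv.ofBijective _ (mergeIdx_bijective i₀))).trans
    (transEquiv_of_eq (submatrix_mergeIdx i₀ hi₀)))

end Clear

end

/-! ### Existence and degrees of normal forms -/

section

open Matrix

lemma exists_transEquiv_fin {α β : Type} [Fintype α] [Fintype β] [DecidableEq α] [DecidableEq β]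
    (r : α → ℤ) (s : β → ℤ) : ∃ (a b : ℕ) (r' : Fin a → ℤ) (s' : Fin b → ℤ),
      TransEquiv ι₁ ι₂ (blockMatrix r s) (blockMatrix r' s') :=
  ⟨_, _, _, _, transEquiv_blockMatrix_comp r s (Fintype.equivFin α).symm (Fintype.equivFin β).symm⟩

/-- If the class clears completely, a trivial line splits off. Otherwise the surviving entries lie
over lines of exponent -1, of which there is at most one, and that line merges with the trivial one.
-/
lemma exists_transEquiv_of_not_hasSection {α β : Type} [Fintype α] [Fintype β] [DecidableEq α]
    [DecidableEq β] {r : α → ℤ} {s : β → ℤ} {b : Matrix Unit (α ⊕ Fin 2 × β) R₁₂}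
    (h : ¬ HasSection ι₁ ι₂
      ((t : R₁₂) • fromBlocks (1 : Matrix Unit Unit R₁₂) b 0 (blockMatrix r s))) :
    ∃ (m n : ℕ) (r' : Fin m → ℤ) (s' : Fin n → ℤ),
      TransEquiv ι₁ ι₂ (fromBlocks (1 : Matrix Unit Unit R₁₂) b 0 (blockMatrix r s))
        (blockMatrix r' s') := by
  obtain ⟨c, hc, hb⟩ := exists_clear b (neg_one_le_of_not_hasSection_inl h)
    (neg_one_le_of_not_hasSection_inr h)
  by_cases h0 : ∀ i, c i = 0
  · obtain ⟨m, n, r', s', h'⟩ := exists_transEquiv_fin (Sum.elim (fun _ : Unit => 0) r) s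
    refine ⟨m, n, r', s', hb.trans (TransEquiv.trans ?_ h')⟩
    rw [fromBlocks_one_zero_eq]
    refine TransEquiv.trans (transEquiv_of_eq ?_) (transEquiv_submatrix _ _)
    congr 1
    ext ⟨⟩ (i | i) <;> simp [h0]
  · push Not at h0
    obtain ⟨i₀, hi₀⟩ := h0
    obtain ⟨m, n, r', s', h'⟩ := exists_transEquiv_fin (fun i : {i : α // i ≠ i₀} => r i)
      (Sum.elim (fun _ : Unit => -1) s)
    refine ⟨m, n, r', s', hb.trans ((transEquiv_merge i₀ (hc _ hi₀) hi₀ fun i hi => ?_).trans h')⟩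
    by_contra hne
    exact hi (eq_of_eq_neg_one h (hc _ hne) (hc _ hi₀))

/-- Every invertible matrix over `R₁₂` is equivalent to a block matrix. -/
theorem exists_transEquiv_blockMatrix (n : ℕ) : ∀ {κ : Type} [Fintype κ] [DecidableEq κ]
    {M P : Matrix κ κ R₁₂}, Fintype.card κ = n → M * P = 1 →
      ∃ (a b : ℕ) (r : Fin a → ℤ) (s : Fin b → ℤ), TransEquiv ι₁ ι₂ M (blockMatrix r s) := by
  induction n with
  | zero =>
    intro κ _ _ M P hκ _
    have : IsEmpty κ := Fintype.card_eq_zero_iff.mp hκ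
    refine ⟨0, 0, 0, 0, (transEquiv_submatrix M (Equiv.equivOfIsEmpty (Fin 0 ⊕ Fin 2 × Fin 0) κ)).trans
      (transEquiv_of_eq ?_)⟩
    ext i
    exact isEmptyElim i
  | succ n ih =>
    intro κ _ _ M P hκ hP
    have : Nonempty κ := Fintype.card_pos_iff.mp (by omega)
    -- The matrix is normalised by its maximal twist having a section; the twist is undone at the
    -- end, as normal forms are stable under twisting.
    obtain ⟨k, hk, hk'⟩ := exists_twist hP
    have hP' : (((t ^ k : R₁₂ˣ) : R₁₂) • M) * (((t ^ (-k) : R₁₂ˣ) : R₁₂) • P) = 1 := by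
      rw [Matrix.smul_mul, Matrix.mul_smul, smul_smul, t_zpow_mul, add_neg_cancel, t_zpow_zero,
        one_smul, hP]
    have ht : (t : R₁₂) • (((t ^ k : R₁₂ˣ) : R₁₂) • M) = ((t ^ (k + 1) : R₁₂ˣ) : R₁₂) • M := by
      rw [smul_smul, ← t_zpow_one, t_zpow_mul, add_comm]
    obtain ⟨m, b, M', P'', hm, hM', hTE⟩ := exists_transEquiv_fromBlocks hP' hk (by rwa [ht])
    obtain ⟨a', b', r, s, hrs⟩ := ih (κ := Fin m) (by rw [Fintype.card_fin]; omega) hM'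
    obtain ⟨b₁, hb₁⟩ := hrs.exists_fromBlocks (1 : Matrix Unit Unit R₁₂) b
    have h1 := hTE.trans hb₁
    -- Equivalence preserves the absence of sections in the next twist, so the bounds on exponents
    -- apply to the lower block in its normal form.
    obtain ⟨m₁, n₁, r', s', h'⟩ := exists_transEquiv_of_not_hasSection (r := r) (s := s) (b := b₁)
      fun hs => hk' (by
        rw [← ht]
        exact (h1.smul _).symm.hasSection hs)
    have h2 := (h1.trans h').smul ((t ^ (-k) : R₁₂ˣ) : R₁₂)
    rw [smul_smul, t_zpow_mul, neg_add_cancel, t_zpow_zero, one_smul, smul_blockMatrix] at h2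
    exact ⟨_, _, _, _, h2⟩

/-! ### From block matrices to canonical matrices. -/

section Multiplicities

variable {α β : Type} [Fintype α] [Fintype β] [DecidableEq α] [DecidableEq β]

/-- The multiplicities of the blocks of a block matrix. -/
def multiplicities (r : α → ℤ) (s : β → ℤ) : ℤ →₀ ℕ :=
  ∑ a, Finsupp.single (2 * r a) 1 + ∑ b, Finsupp.single (2 * s b + 1) 1

omit [DecidableEq α] [DecidableEq β] in
lemma multiplicities_even (r : α → ℤ) (s : β → ℤ) (k : ℤ) :
    multiplicities r s (2 * k) = Fintype.card {a // r a = k} := by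
  rw [Fintype.card_subtype, Finset.card_filter, multiplicities, Finsupp.add_apply,
    Finsupp.finsetSum_apply, Finsupp.finsetSum_apply, Finset.sum_eq_zero (s := (Finset.univ : Finset β)),
    add_zero]
  · refine Finset.sum_congr rfl fun a _ => ?_
    rw [Finsupp.single_apply]
    exact if_congr (by omega) rfl rfl
  · intro b _
    rw [Finsupp.single_apply, if_neg (by omega)]

omit [DecidableEq α] [DecidableEq β] in
lemma multiplicities_odd (r : α → ℤ) (s : β → ℤ) (k : ℤ) :
    multiplicities r s (2 * k + 1) = Fintype.card {b // s b = k} := by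
  rw [Fintype.card_subtype, Finset.card_filter, multiplicities, Finsupp.add_apply,
    Finsupp.finsetSum_apply, Finsupp.finsetSum_apply, Finset.sum_eq_zero (s := (Finset.univ : Finset α)),
    zero_add]
  · refine Finset.sum_congr rfl fun a _ => ?_
    rw [Finsupp.single_apply]
    exact if_congr (by omega) rfl rfl
  · intro b _
    rw [Finsupp.single_apply, if_neg (by omega)]

omit [Fintype α] [DecidableEq α] in
lemma exists_sigma_equiv [Finite α] (r : α → ℤ) (n : ℤ → ℕ) (h : ∀ k, n k = Nat.card {a // r a = k}) :
    ∃ e : (Σ k, Fin (n k)) ≃ α, ∀ p, r (e p) = p.1 := by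
  let e (k : ℤ) : Fin (n k) ≃ {a // r a = k} :=
    (finCongr (h k)).trans (Finite.equivFin {a // r a = k}).symm
  exact ⟨(Equiv.sigmaCongrRight e).trans (Equiv.sigmaFiberEquiv r), fun p => (e p.1 p.2).2⟩

lemma transEquiv_canonicalMatrix (r : α → ℤ) (s : β → ℤ) :
    TransEquiv ι₁ ι₂ (blockMatrix r s) (canonicalMatrix (multiplicities r s)) := by
  obtain ⟨e, he⟩ := exists_sigma_equiv r (fun k => multiplicities r s (2 * k))
    fun k => by rw [multiplicities_even, Nat.card_eq_fintype_card]
  obtain ⟨e', he'⟩ := exists_sigma_equiv s (fun k => multiplicities r s (2 * k + 1))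
    fun k => by rw [multiplicities_odd, Nat.card_eq_fintype_card]
  have := transEquiv_blockMatrix_comp r s e e'
  rw [show r ∘ e = fun p => p.1 from funext he, show s ∘ e' = fun p => p.1 from funext he'] at this
  exact this

end Multiplicities

/-! ### Maps between blocks. -/

section Vanishing

/-- Such a pair is a map between line bundles, and the target has smaller degree. -/
lemma eq_zero_of_mul_zpow {p q : ℤ} (hpq : p < q) {l : R₂} {s : R₁}
    (h : ι₂ l * ((t ^ p : R₁₂ˣ) : R₁₂) = ((t ^ q : R₁₂ˣ) : R₁₂) * ι₁ s) : s = 0 := by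
  refine eq_zero_of_ι₁_eq (n := p - q) (g := l) (by omega) ?_
  have h1 := congrArg (((t ^ (-q) : R₁₂ˣ) : R₁₂) * ·) h
  simp only [← mul_assoc, t_zpow_mul, neg_add_cancel, t_zpow_zero, one_mul] at h1
  rw [← h1, mul_right_comm, t_zpow_mul, neg_add_eq_sub]

lemma eq_zero_of_mul_zpow' {p q : ℤ} (hpq : p < q) {l : R₂} {s : R₁}
    (h : ι₂ l * ((t ^ p : R₁₂ˣ) : R₁₂) = ((t ^ q : R₁₂ˣ) : R₁₂) * ι₁ s) : l = 0 := by
  rw [eq_zero_of_mul_zpow hpq h, map_zero, mul_zero, Units.mul_left_eq_zero] at h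
  exact ι₂_injective (h.trans (map_zero _).symm)

/-- Regularity on both charts leaves only the exponent 0 in the first component and none in the
second: the global functions are the constants. -/
lemma exists_eq_algebraMap {l : R₂} {s : R₁} (h : ι₂ l = ι₁ s) :
    ∃ c : ℝ, l = algebraMap ℝ R₂ c ∧ s = algebraMap ℝ R₁ c := by
  have h1 : ι₁ s = algebraMap ℝ R₁₂ (coeffA 0 (ι₁ s)) := by
    refine ext_coeff (fun k => ?_) fun k => ?_
    · rw [coeffA_algebraMap]
      rcases lt_trichotomy k 0 with hk | rfl | hk
      · rw [coeffA_ι₁ hk, if_neg hk.ne]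
      · rw [if_pos rfl]
      · rw [← h, coeffA_ι₂ hk, if_neg hk.ne']
    · rw [coeffB_algebraMap]
      rcases lt_or_ge k 0 with hk | hk
      · rw [coeffB_ι₁ hk]
      · rw [← h, coeffB_ι₂ hk]
  exact ⟨coeffA 0 (ι₁ s), ι₂_injective (by rw [ι₂_algebraMap, h, ← h1]),
    ι₁_injective (by rw [ι₁_algebraMap, ← h1])⟩

/-- The coefficient of (x/z)t⁰ vanishes on tR₁ and on R₂, so it isolates c. This expresses that the
Quillen bundle is a nonsplit extension. -/
lemma eq_zero_of_xz_add {c : ℝ} {l : R₂} {s : R₁}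
    (h : (t : R₁₂) * ι₁ s + xz * algebraMap ℝ R₁₂ c = ι₂ l) : c = 0 ∧ s = 0 := by
  rw [← t_zpow_one] at h
  have h1 := congrArg (coeffB 0) h
  rw [map_add, coeffB_t_mul, coeffB_ι₁ (by omega), coeffB_xz_mul, coeffA_algebraMap, if_pos rfl,
    coeffB_ι₂ le_rfl, zero_add] at h1
  refine ⟨h1, eq_zero_of_mul_zpow (p := 0) (q := 1) (l := l) (by omega) ?_⟩
  rw [← h, h1, map_zero, mul_zero, add_zero, t_zpow_zero, mul_one]

/-- The block is an extension of t^s by t^(s+1). For r < s both components of the map vanish by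
degree. For r = s the component to the quotient is a constant, which must vanish because the
extension does not split. -/
lemma eq_zero_of_line_to_quillen {r s : ℤ} (hrs : r ≤ s) {l₀ l₁ : R₂} {s₀ s₁ : R₁}
    (h₀ : ι₂ l₀ * ((t ^ r : R₁₂ˣ) : R₁₂) = ((t ^ (s + 1) : R₁₂ˣ) : R₁₂) * ι₁ s₀ +
      xz * ((t ^ s : R₁₂ˣ) : R₁₂) * ι₁ s₁)
    (h₁ : ι₂ l₁ * ((t ^ r : R₁₂ˣ) : R₁₂) = ((t ^ s : R₁₂ˣ) : R₁₂) * ι₁ s₁) : s₀ = 0 ∧ s₁ = 0 := by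
  rcases hrs.lt_or_eq with hlt | rfl
  · have h2 := eq_zero_of_mul_zpow hlt h₁
    rw [h2, map_zero, mul_zero, add_zero] at h₀
    exact ⟨eq_zero_of_mul_zpow (by omega) h₀, h2⟩
  · rw [mul_comm] at h₁
    obtain ⟨c, -, rfl⟩ := exists_eq_algebraMap ((Units.mul_right_inj _).mp h₁)
    have h2 : ((t ^ r : R₁₂ˣ) : R₁₂) * (t * ι₁ s₀ + xz * algebraMap ℝ R₁₂ c) =
        ((t ^ r : R₁₂ˣ) : R₁₂) * ι₂ l₀ := by
      rw [mul_comm _ (ι₂ l₀), h₀, ι₁_algebraMap, ← t_zpow_mul, t_zpow_one]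
      ring
    obtain ⟨rfl, rfl⟩ := eq_zero_of_xz_add ((Units.mul_right_inj _).mp h2)
    exact ⟨rfl, map_zero _⟩

/-- Dually, the restriction to the subbundle t^(s+1) vanishes by degree or, for r = s + 1, is a
constant killed by nonsplitness; the map then factors through the quotient t^s. -/
lemma eq_zero_of_quillen_to_line {r s : ℤ} (hrs : s < r) {l₀ l₁ : R₂} {s₀ s₁ : R₁}
    (h₀ : ι₂ l₀ * ((t ^ (s + 1) : R₁₂ˣ) : R₁₂) = ((t ^ r : R₁₂ˣ) : R₁₂) * ι₁ s₀)
    (h₁ : ι₂ l₀ * (xz * ((t ^ s : R₁₂ˣ) : R₁₂)) + ι₂ l₁ * ((t ^ s : R₁₂ˣ) : R₁₂) =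
      ((t ^ r : R₁₂ˣ) : R₁₂) * ι₁ s₁) : s₀ = 0 ∧ s₁ = 0 := by
  rcases (Int.add_one_le_iff.mpr hrs).lt_or_eq with hlt | rfl
  · rw [eq_zero_of_mul_zpow' hlt h₀, map_zero, zero_mul, zero_add] at h₁
    exact ⟨eq_zero_of_mul_zpow hlt h₀, eq_zero_of_mul_zpow hrs h₁⟩
  · rw [mul_comm] at h₀
    obtain ⟨c, rfl, rfl⟩ := exists_eq_algebraMap ((Units.mul_right_inj _).mp h₀)
    have h2 : ((t ^ s : R₁₂ˣ) : R₁₂) * (t * ι₁ s₁ + xz * algebraMap ℝ R₁₂ (-c)) =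
        ((t ^ s : R₁₂ˣ) : R₁₂) * ι₂ l₁ := by
      rw [← t_zpow_mul, t_zpow_one, ι₂_algebraMap] at h₁
      rw [map_neg]
      linear_combination -h₁
    obtain ⟨h3, rfl⟩ := eq_zero_of_xz_add ((Units.mul_right_inj _).mp h2)
    rw [neg_eq_zero.mp h3]
    exact ⟨map_zero _, rfl⟩

variable {α β α' β' : Type} [Fintype α] [Fintype β] [Fintype α'] [Fintype β'] [DecidableEq α]
  [DecidableEq β] [DecidableEq α'] [DecidableEq β']

/-- The index `i` of the block `M_i` to which a row or column of a block matrix belongs. -/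
def blockDeg (r : α → ℤ) (s : β → ℤ) : α ⊕ Fin 2 × β → ℤ :=
  Sum.elim (fun a => 2 * r a) fun b => 2 * s b.2 + 1

/-- The block of index i has slope -i, and there are no nonzero maps from a block to one of smaller
slope. -/
lemma eq_zero_of_blockDeg_lt {r : α → ℤ} {s : β → ℤ} {r' : α' → ℤ} {s' : β' → ℤ}
    {L : Matrix (α' ⊕ Fin 2 × β') (α ⊕ Fin 2 × β) R₂} {S : Matrix (α' ⊕ Fin 2 × β') (α ⊕ Fin 2 × β) R₁}
    (h : L.map ι₂ * blockMatrix r s = blockMatrix r' s' * S.map ι₁)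
    {i : α ⊕ Fin 2 × β} {i' : α' ⊕ Fin 2 × β'} (hi : blockDeg r s i < blockDeg r' s' i') :
    S i' i = 0 := by
  have h2 : ∀ k : Fin 2, k = 0 ∨ k = 1 := by decide
  have hL₁ : ∀ j a, (L.map ι₂ * blockMatrix r s) j (Sum.inl a) =
      ι₂ (L j (Sum.inl a)) * ((t ^ r a : R₁₂ˣ) : R₁₂) := by
    intro j a
    simp [Matrix.mul_apply, blockMatrix, diagonal_apply, evenBlock]
  have hL₂ : ∀ j b, (L.map ι₂ * blockMatrix r s) j (Sum.inr (0, b)) =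
      ι₂ (L j (Sum.inr (0, b))) * ((t ^ (s b + 1) : R₁₂ˣ) : R₁₂) := by
    intro j b
    simp [Matrix.mul_apply, blockMatrix, blockDiagonal_apply, oddBlock, Fintype.sum_prod_type]
  have hL₃ : ∀ j b, (L.map ι₂ * blockMatrix r s) j (Sum.inr (1, b)) =
      ι₂ (L j (Sum.inr (0, b))) * (xz * ((t ^ s b : R₁₂ˣ) : R₁₂)) +
        ι₂ (L j (Sum.inr (1, b))) * ((t ^ s b : R₁₂ˣ) : R₁₂) := by
    intro j b
    simp [Matrix.mul_apply, blockMatrix, blockDiagonal_apply, oddBlock, Fintype.sum_prod_type]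
  have hS₁ : ∀ j a, (blockMatrix r' s' * S.map ι₁) (Sum.inl a) j =
      ((t ^ r' a : R₁₂ˣ) : R₁₂) * ι₁ (S (Sum.inl a) j) := by
    intro j a
    simp [Matrix.mul_apply, blockMatrix, diagonal_apply, evenBlock]
  have hS₂ : ∀ j b, (blockMatrix r' s' * S.map ι₁) (Sum.inr (0, b)) j =
      ((t ^ (s' b + 1) : R₁₂ˣ) : R₁₂) * ι₁ (S (Sum.inr (0, b)) j) +
        xz * ((t ^ s' b : R₁₂ˣ) : R₁₂) * ι₁ (S (Sum.inr (1, b)) j) := by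
    intro j b
    simp [Matrix.mul_apply, blockMatrix, blockDiagonal_apply, oddBlock, Fintype.sum_prod_type]
  have hS₃ : ∀ j b, (blockMatrix r' s' * S.map ι₁) (Sum.inr (1, b)) j =
      ((t ^ s' b : R₁₂ˣ) : R₁₂) * ι₁ (S (Sum.inr (1, b)) j) := by
    intro j b
    simp [Matrix.mul_apply, blockMatrix, blockDiagonal_apply, oddBlock, Fintype.sum_prod_type]
  have e := fun i' i => congrFun (congrFun h i') i
  rcases i with a | ⟨k, b⟩ <;> rcases i' with a' | ⟨k', b'⟩ <;>
    simp only [blockDeg, Sum.elim_inl, Sum.elim_inr] at hi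
  · exact eq_zero_of_mul_zpow (by omega) ((hL₁ _ _).symm.trans ((e _ _).trans (hS₁ _ _)))
  · have := eq_zero_of_line_to_quillen (by omega)
      ((hL₁ _ a).symm.trans ((e _ _).trans (hS₂ _ b')))
      ((hL₁ _ a).symm.trans ((e _ _).trans (hS₃ _ b')))
    rcases h2 k' with rfl | rfl
    exacts [this.1, this.2]
  · have := eq_zero_of_quillen_to_line (by omega)
      ((hL₂ _ b).symm.trans ((e _ _).trans (hS₁ _ a')))
      ((hL₃ _ b).symm.trans ((e _ _).trans (hS₁ _ a')))
    rcases h2 k with rfl | rfl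
    exacts [this.1, this.2]
  -- Between two blocks of rank two: first the composite to the quotient line of the target
  -- vanishes, then the resulting map into its subbundle of exponent s' + 1.
  · have h3 := eq_zero_of_quillen_to_line (by omega)
      ((hL₂ _ b).symm.trans ((e _ _).trans (hS₃ _ b')))
      ((hL₃ _ b).symm.trans ((e _ _).trans (hS₃ _ b')))
    have h4 := eq_zero_of_quillen_to_line (r := s' b' + 1) (s₀ := S (Sum.inr (0, b')) (Sum.inr (0, b)))
      (s₁ := S (Sum.inr (0, b')) (Sum.inr (1, b))) (by omega)
      ((hL₂ _ b).symm.trans ((e (Sum.inr (0, b')) _).trans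
        ((hS₂ _ b').trans (by rw [h3.1, map_zero, mul_zero, add_zero]))))
      ((hL₃ _ b).symm.trans ((e (Sum.inr (0, b')) _).trans
        ((hS₂ _ b').trans (by rw [h3.2, map_zero, mul_zero, add_zero]))))
    rcases h2 k with rfl | rfl <;> rcases h2 k' with rfl | rfl
    exacts [h4.1, h3.1, h4.2, h3.2]

end Vanishing

end

/-! ### Uniqueness of normal forms -/

section

open Matrix

lemma card_le_of_mul_eq_one {A p q : Type} [CommRing A] [Nontrivial A] [Fintype p] [Fintype q]
    [DecidableEq p] {B : Matrix p q A} {C : Matrix q p A} (h : B * C = 1) :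
    Fintype.card p ≤ Fintype.card q := by
  refine card_le_of_injective A C.mulVecLin fun v w hvw => ?_
  have h1 : C *ᵥ v = C *ᵥ w := hvw
  rw [← Matrix.one_mulVec v, ← Matrix.one_mulVec w, ← h, ← Matrix.mulVec_mulVec, h1,
    Matrix.mulVec_mulVec]

/-- By the vanishing, the sums in the `P`-part of `B * C = 1` run over `Q` only, so the
corresponding block of `B` has a right inverse. -/
lemma card_le_of_eq_zero {A p q : Type} [CommRing A] [Nontrivial A] [Fintype p] [Fintype q]
    [DecidableEq p] {B : Matrix p q A} {C : Matrix q p A} (h : B * C = 1) (P : p → Prop) (Q : q → Prop)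
    [DecidablePred P] [DecidablePred Q] (h0 : ∀ i j, P i → ¬ Q j → C j i = 0) :
    Fintype.card {i // P i} ≤ Fintype.card {j // Q j} := by
  refine card_le_of_mul_eq_one (A := A) (B := of fun i j => B i.1 j.1) (C := of fun j i => C j.1 i.1) ?_
  ext i i'
  have h1 := congrFun (congrFun h i.1) i'.1
  rw [Matrix.mul_apply, ← Fintype.sum_subtype_add_sum_subtype Q] at h1
  rw [Matrix.mul_apply]
  rw [Finset.sum_eq_zero (s := (Finset.univ : Finset {j // ¬ Q j})), add_zero] at h1
  · refine h1.trans ?_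
    simp [Matrix.one_apply, Subtype.ext_iff]
  · intro j _
    rw [h0 _ _ i'.2 j.2, mul_zero]

section Uniqueness

variable {α β α' β' : Type} [Fintype α] [Fintype β] [Fintype α'] [Fintype β'] [DecidableEq α]
  [DecidableEq β] [DecidableEq α'] [DecidableEq β'] {r : α → ℤ} {s : β → ℤ} {r' : α' → ℤ} {s' : β' → ℤ}

/-- The change of frame on `U₁` carries the blocks of index at most d into blocks of index at most
d, and it is invertible. -/
lemma card_blockDeg_le_of_transEquiv (h : TransEquiv ι₁ ι₂ (blockMatrix r s) (blockMatrix r' s'))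
    (d : ℤ) : Fintype.card {i // blockDeg r s i ≤ d} ≤ Fintype.card {i // blockDeg r' s' i ≤ d} := by
  obtain ⟨L, L', S, S', hL, hL', hS, hS', h⟩ := h
  have h1 : L.map ι₂ * blockMatrix r s = blockMatrix r' s' * S'.map ι₁ := by
    rw [← h, Matrix.mul_assoc _ (S.map ι₁), ← Matrix.map_mul, hS,
      Matrix.map_one _ (map_zero _) (map_one _), Matrix.mul_one]
  exact card_le_of_eq_zero hS _ _ fun i j hi hj =>
    eq_zero_of_blockDeg_lt h1 (hi.trans_lt (not_le.mp hj))

lemma card_blockDeg_eq_of_transEquiv (h : TransEquiv ι₁ ι₂ (blockMatrix r s) (blockMatrix r' s'))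
    (d : ℤ) : Fintype.card {i // blockDeg r s i = d} = Fintype.card {i // blockDeg r' s' i = d} := by
  have key : ∀ {I : Type} [Fintype I] (g : I → ℤ), Fintype.card {i // g i ≤ d} =
      Fintype.card {i // g i = d} + Fintype.card {i // g i ≤ d - 1} := by
    intro I _ g
    rw [← Fintype.card_subtype_or_disjoint]
    · exact Fintype.card_congr (Equiv.subtypeEquivRight fun i => by omega)
    · rw [Pi.disjoint_iff]
      intro i
      refine disjoint_iff_inf_le.mpr fun ⟨h1, h2⟩ => ?_
      omega
  have h1 := le_antisymm (card_blockDeg_le_of_transEquiv h d) (card_blockDeg_le_of_transEquiv h.symm d)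
  have h2 := le_antisymm (card_blockDeg_le_of_transEquiv h (d - 1))
    (card_blockDeg_le_of_transEquiv h.symm (d - 1))
  rw [key, key (blockDeg r' s'), h2] at h1
  exact Nat.add_right_cancel h1

end Uniqueness

lemma card_blockDeg_even (m : ℤ →₀ ℕ) (k : ℤ) :
    Fintype.card {i : MatIdx m // blockDeg (fun p : LineIdx m => p.1) (fun p : QuillenIdx m => p.1) i =
      2 * k} = m (2 * k) := by
  rw [← Fintype.card_fin (m (2 * k))]
  refine (Fintype.card_congr (Equiv.ofBijective (fun j => ⟨Sum.inl ⟨k, j⟩, rfl⟩) ⟨fun j j' h => ?_, ?_⟩)).symm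
  · simpa using congrArg Subtype.val h
  · rintro ⟨⟨k', j⟩ | ⟨l, k', j⟩, h⟩
    · obtain rfl : k' = k := by
        have : 2 * k' = 2 * k := h
        omega
      exact ⟨j, rfl⟩
    · have : 2 * k' + 1 = 2 * k := h
      omega

lemma card_blockDeg_odd (m : ℤ →₀ ℕ) (k : ℤ) :
    Fintype.card {i : MatIdx m // blockDeg (fun p : LineIdx m => p.1) (fun p : QuillenIdx m => p.1) i =
      2 * k + 1} = 2 * m (2 * k + 1) := by
  have : Fintype.card (Fin 2 × Fin (m (2 * k + 1))) = 2 * m (2 * k + 1) := by simp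
  rw [← this]
  refine (Fintype.card_congr (Equiv.ofBijective (fun j => ⟨Sum.inr (j.1, ⟨k, j.2⟩), rfl⟩)
    ⟨fun j j' h => ?_, ?_⟩)).symm
  · have h1 := congrArg Subtype.val h
    simp only [Sum.inr.injEq, Prod.mk.injEq, Sigma.mk.injEq, heq_eq_eq, true_and] at h1
    exact Prod.ext h1.1 h1.2
  · rintro ⟨⟨k', j⟩ | ⟨l, k', j⟩, h⟩
    · have : 2 * k' = 2 * k + 1 := h
      omega
    · obtain rfl : k' = k := by
        have : 2 * k' + 1 = 2 * k + 1 := h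
        omega
      exact ⟨(l, j), rfl⟩

lemma eq_of_transEquiv_canonicalMatrix {m m' : ℤ →₀ ℕ}
    (h : TransEquiv ι₁ ι₂ (canonicalMatrix m) (canonicalMatrix m')) : m = m' := by
  have h' : TransEquiv ι₁ ι₂ (blockMatrix (fun p : LineIdx m => p.1) (fun p : QuillenIdx m => p.1))
    (blockMatrix (fun p : LineIdx m' => p.1) (fun p : QuillenIdx m' => p.1)) := h
  have key := card_blockDeg_eq_of_transEquiv h'
  ext i
  obtain ⟨k, rfl | rfl⟩ := Int.even_or_odd' i
  · have := key (2 * k)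
    rwa [card_blockDeg_even, card_blockDeg_even] at this
  · have := key (2 * k + 1)
    rw [card_blockDeg_odd, card_blockDeg_odd] at this
    omega

lemma transEquiv_of_clutchEquiv {n : ℕ} {κ : Type} [Fintype κ] [DecidableEq κ]
    {M : Matrix (Fin n) (Fin n) R₁₂} {D : Matrix κ κ R₁₂} (h : ClutchEquiv M D) :
    TransEquiv ι₁ ι₂ M D := by
  obtain ⟨e, L, S, h⟩ := h
  have h1 : TransEquiv ι₁ ι₂ M (D.submatrix e e) :=
    ⟨L.1, L⁻¹.1, S.1, S⁻¹.1, L.mul_inv, L.inv_mul, S.mul_inv, S.inv_mul, h⟩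
  exact h1.trans (transEquiv_submatrix D e).symm

lemma TransEquiv.card_eq {κ κ' : Type} [Fintype κ] [Fintype κ'] [DecidableEq κ] [DecidableEq κ']
    {M : Matrix κ κ R₁₂} {D : Matrix κ' κ' R₁₂} (h : TransEquiv ι₁ ι₂ M D) :
    Fintype.card κ = Fintype.card κ' := by
  obtain ⟨L, L', S, S', hL, hL', hS, hS', h⟩ := h
  exact le_antisymm (card_le_of_mul_eq_one hS) (card_le_of_mul_eq_one hS')

/-- Any enumeration of the indices will do, since a simultaneous permutation is itself an
equivalence. -/
lemma TransEquiv.clutchEquiv {n : ℕ} {κ : Type} [Fintype κ] [DecidableEq κ]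
    {M : Matrix (Fin n) (Fin n) R₁₂} {D : Matrix κ κ R₁₂} (h : TransEquiv ι₁ ι₂ M D) :
    ClutchEquiv M D := by
  let e : Fin n ≃ κ := Fintype.equivOfCardEq h.card_eq
  obtain ⟨L, L', S, S', hL, hL', hS, hS', h'⟩ := h.trans (transEquiv_submatrix D e)
  exact ⟨e, ⟨L, L', hL, hL'⟩, ⟨S, S', hS, hS'⟩, h'⟩

lemma exists_transEquiv_canonicalMatrix {κ : Type} [Fintype κ] [DecidableEq κ] {M P : Matrix κ κ R₁₂}
    (h : M * P = 1) : ∃ m : ℤ →₀ ℕ, TransEquiv ι₁ ι₂ M (canonicalMatrix m) := by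
  obtain ⟨a, b, r, s, hrs⟩ := exists_transEquiv_blockMatrix _ rfl h
  exact ⟨_, hrs.trans (transEquiv_canonicalMatrix r s)⟩

/-- The classification of invertible matrices over `R₁₂` up to changes of frames. -/
theorem existsUnique_clutchEquiv (n : ℕ) (M : GL (Fin n) R₁₂) :
    ∃! m : ℤ →₀ ℕ, ClutchEquiv M.1 (canonicalMatrix m) := by
  obtain ⟨m, hm⟩ := exists_transEquiv_canonicalMatrix M.mul_inv
  exact ⟨m, hm.clutchEquiv, fun m' hm' => eq_of_transEquiv_canonicalMatrix
    ((transEquiv_of_clutchEquiv hm').symm.trans hm)⟩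

end

/-! ### Differential forms on the charts -/

section

open KaehlerDifferential

section RotationForm

variable {B : Type} [CommRing B] [Algebra ℝ B]

/-- The differential form `a db - b da`. -/
def rotForm (a b : B) : Ω[B⁄ℝ] := a • D ℝ B b - b • D ℝ B a

variable {a b : B}

lemma smul_D_add_smul_D (h : a ^ 2 + b ^ 2 + 1 = 0) : a • D ℝ B a + b • D ℝ B b = 0 := by
  have h1 := congrArg (D ℝ B) h
  simp only [map_add, Derivation.leibniz_pow, Derivation.map_one_eq_zero, map_zero] at h1
  have h2 : (2 : ℝ) • (a • D ℝ B a + b • D ℝ B b) = 0 := by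
    rw [← h1, two_smul]
    simp only [two_smul, pow_one, Nat.add_one_sub_one]
    abel
  exact (smul_eq_zero_iff_right two_ne_zero).mp h2

/-- With its companion for b, this exhibits a db - b da as dual to the infinitesimal rotation a ↦ b,
b ↦ -a. -/
lemma D_fst_eq (h : a ^ 2 + b ^ 2 + 1 = 0) : D ℝ B a = b • rotForm a b := by
  have h1 : b • rotForm a b = a • (a • D ℝ B a + b • D ℝ B b) - (a ^ 2 + b ^ 2 + 1) • D ℝ B a +
      D ℝ B a := by
    rw [rotForm]
    module
  rw [h1, smul_D_add_smul_D h, h, smul_zero, zero_smul, sub_zero, zero_add]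

lemma D_snd_eq (h : a ^ 2 + b ^ 2 + 1 = 0) : D ℝ B b = (-a) • rotForm a b := by
  have h1 : (-a) • rotForm a b = b • (a • D ℝ B a + b • D ℝ B b) - (a ^ 2 + b ^ 2 + 1) • D ℝ B b +
      D ℝ B b := by
    rw [rotForm]
    module
  rw [h1, smul_D_add_smul_D h, h, smul_zero, zero_smul, sub_zero, zero_add]

/-- The functions whose differential is a multiple of the form are a subalgebra closed under
inverses and containing a and b; the hypothesis `hS` says that there is only one such subalgebra. -/
lemma span_rotForm_eq_top (h : a ^ 2 + b ^ 2 + 1 = 0)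
    (hS : ∀ S : Subalgebra ℝ B, a ∈ S → b ∈ S → (∀ s ∈ S, ∀ s', s * s' = 1 → s' ∈ S) → S = ⊤) :
    Submodule.span B {rotForm a b} = ⊤ := by
  let S : Subalgebra ℝ B :=
    { carrier := {f | D ℝ B f ∈ Submodule.span B {rotForm a b}}
      add_mem' := fun {f g} hf hg => by
        change D ℝ B _ ∈ Submodule.span B {rotForm a b}
        rw [map_add]
        exact Submodule.add_mem _ hf hg
      mul_mem' := fun {f g} hf hg => by
        change D ℝ B _ ∈ Submodule.span B {rotForm a b}
        rw [Derivation.leibniz]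
        exact Submodule.add_mem _ (Submodule.smul_mem _ _ hg) (Submodule.smul_mem _ _ hf)
      algebraMap_mem' := fun r => by
        change D ℝ B _ ∈ Submodule.span B {rotForm a b}
        rw [Derivation.map_algebraMap]
        exact Submodule.zero_mem _ }
  have hmem := Submodule.mem_span_singleton_self (R := B) (rotForm a b)
  have ht : S = ⊤ := by
    refine hS S ?_ ?_ fun s hs s' hss => ?_
    · change D ℝ B a ∈ Submodule.span B {rotForm a b}
      rw [D_fst_eq h]
      exact Submodule.smul_mem _ _ hmem
    · change D ℝ B b ∈ Submodule.span B {rotForm a b}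
      rw [D_snd_eq h]
      exact Submodule.smul_mem _ _ hmem
    · change D ℝ B s' ∈ Submodule.span B {rotForm a b}
      have h1 := congrArg (D ℝ B) hss
      rw [Derivation.leibniz, Derivation.map_one_eq_zero] at h1
      have h2 : D ℝ B s' = -(s' * s') • D ℝ B s := by
        have h3 := congrArg (s' • ·) h1
        simp only [smul_add, smul_smul, smul_zero] at h3
        rw [mul_comm s' s, hss, one_smul] at h3
        rw [neg_smul]
        exact eq_neg_of_add_eq_zero_left h3
      rw [h2]
      exact Submodule.smul_mem _ _ hs
  rw [eq_top_iff, ← KaehlerDifferential.span_range_derivation, Submodule.span_le]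
  rintro _ ⟨f, rfl⟩
  have : f ∈ S := ht ▸ trivial
  exact this

/-- The rotation pairs with the form to -(a² + b²) = 1. -/
lemma smul_rotForm_injective (h : a ^ 2 + b ^ 2 + 1 = 0) (δ : Derivation ℝ B B) (ha : δ a = b)
    (hb : δ b = -a) : Function.Injective fun f : B => f • rotForm a b := by
  intro f g hfg
  have h1 := congrArg δ.liftKaehlerDifferential hfg
  have h2 : δ.liftKaehlerDifferential (rotForm a b) = 1 := by
    simp only [rotForm, map_sub, map_smul, Derivation.liftKaehlerDifferential_comp_D, ha, hb,
      smul_eq_mul]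
    linear_combination -h
  simpa only [map_smul, h2, smul_eq_mul, mul_one] using h1

end RotationForm

/-! ### The infinitesimal rotation on basic open subsets. -/

section Derivations

variable {U V : conic.Opens}

open DualNumber in
-- Over the dual numbers (a + bε, b - aε) again satisfies the equation of the conic, so it defines a
-- ring homomorphism lifting the restriction map. It extends to the localisation because a dual
-- number with invertible constant term is invertible, and its ε-part is the derivation.
lemma exists_derivation {j k : Fin 3} (hjk : j = 2 ∧ k = 1 ∨ j = 1 ∧ k = 2)
    (g : Γ(conic, Proj.basicOpen grading (coord j))) :
    ∃ δ : Derivation ℝ Γ(conic, conic.basicOpen g) Γ(conic, conic.basicOpen g),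
      δ (res (conic.basicOpen_le g) (coordDiv 0 j)) = res (conic.basicOpen_le g) (coordDiv k j) ∧
      δ (res (conic.basicOpen_le g) (coordDiv k j)) = -res (conic.basicOpen_le g) (coordDiv 0 j) := by
  have hU : IsAffineOpen (Proj.basicOpen grading (coord j)) :=
    Proj.isAffineOpen_basicOpen grading (coord j) (coord_mem j) one_pos
  have hloc := hU.isLocalization_basicOpen g
  set ρ : Γ(conic, Proj.basicOpen grading (coord j)) →+* Γ(conic, conic.basicOpen g) :=
    res (conic.basicOpen_le g) with hρ
  set a := ρ (coordDiv 0 j)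
  set b := ρ (coordDiv k j)
  have hrel : a ^ 2 + b ^ 2 + 1 = 0 := by
    have := congrArg ρ (isConicRing_coordDiv hjk).rel
    simpa using this
  let w : Fin 3 → Γ(conic, conic.basicOpen g)[ε] := fun i =>
    if i = 0 then TrivSqZeroExt.inl a + TrivSqZeroExt.inr b else
      if i = k then TrivSqZeroExt.inl b - TrivSqZeroExt.inr a else 1
  have hsq : ∀ c d : Γ(conic, conic.basicOpen g),
      (TrivSqZeroExt.inl c + TrivSqZeroExt.inr d : Γ(conic, conic.basicOpen g)[ε]) ^ 2 =
        TrivSqZeroExt.inl (c ^ 2) + TrivSqZeroExt.inr (2 * c * d) := by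
    intro c d
    ext <;> simp [pow_two]
    ring
  have hw : w 0 ^ 2 + w 1 ^ 2 + w 2 ^ 2 = 0 := by
    have h0 : (TrivSqZeroExt.inl a + TrivSqZeroExt.inr b : Γ(conic, conic.basicOpen g)[ε]) ^ 2 +
        (TrivSqZeroExt.inl b - TrivSqZeroExt.inr a) ^ 2 + 1 = 0 := by
      have e : (TrivSqZeroExt.inl b - TrivSqZeroExt.inr a : Γ(conic, conic.basicOpen g)[ε]) =
        TrivSqZeroExt.inl b + TrivSqZeroExt.inr (-a) := by
        ext <;> simp
      rw [e, hsq, hsq]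
      ext
      · simpa using hrel
      · simp
        ring
    rcases hjk with ⟨rfl, rfl⟩ | ⟨rfl, rfl⟩
    · simpa [w] using h0
    · rw [← h0]
      change _ ^ 2 + (1 : Γ(conic, conic.basicOpen g)[ε]) ^ 2 + _ ^ 2 = _
      rw [one_pow]
      exact add_right_comm _ _ _
  obtain ⟨φ, hφ, hφ'⟩ := exists_evaluation j
    ((TrivSqZeroExt.inlHom Γ(conic, conic.basicOpen g) Γ(conic, conic.basicOpen g)).comp (const _)) w hw
    (by rcases hjk with ⟨rfl, rfl⟩ | ⟨rfl, rfl⟩ <;> simp [w])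
  have h0 : φ (coordDiv 0 j) = TrivSqZeroExt.inl a + TrivSqZeroExt.inr b := by rw [hφ']; simp [w]
  have hk : φ (coordDiv k j) = TrivSqZeroExt.inl b - TrivSqZeroExt.inr a := by
    rw [hφ']
    rcases hjk with ⟨rfl, rfl⟩ | ⟨rfl, rfl⟩ <;> simp [w]
  have hfst : ∀ f, (φ f).fst = ρ f := by
    intro f
    let S : Subalgebra ℝ Γ(conic, Proj.basicOpen grading (coord j)) :=
      { RingHom.eqLocus ((TrivSqZeroExt.fstHom ℝ Γ(conic, conic.basicOpen g)
          Γ(conic, conic.basicOpen g)).toRingHom.comp φ) ρ with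
        algebraMap_mem' := fun r => by
          change (φ (const _ r)).fst = ρ (const _ r)
          rw [hφ, hρ, res_const]
          rfl }
    refine (isConicRing_coordDiv hjk).mem_subalgebra S ?_ ?_ f
    · change (φ _).fst = _
      rw [h0]
      simp [a]
    · change (φ _).fst = _
      rw [hk]
      simp [b]
  have hu : IsUnit (φ g) := by
    rw [TrivSqZeroExt.isUnit_iff_isUnit_fst, hfst]
    exact isUnit_res_basicOpen g
  let ψ : Γ(conic, conic.basicOpen g) →+* Γ(conic, conic.basicOpen g)[ε] := IsLocalization.Away.lift g hu
  have hψ : ∀ f, ψ (ρ f) = φ f := IsLocalization.Away.lift_eq g hu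
  have hψfst : ∀ f, (ψ f).fst = f := by
    have : (TrivSqZeroExt.fstHom ℝ Γ(conic, conic.basicOpen g)
          Γ(conic, conic.basicOpen g)).toRingHom.comp ψ = RingHom.id _ := by
      refine IsLocalization.ringHom_ext (Submonoid.powers g) (RingHom.ext fun f => ?_)
      change (ψ (ρ f)).fst = ρ f
      rw [hψ, hfst]
    exact fun f => RingHom.congr_fun this f
  refine ⟨Derivation.mk' { toFun := fun f => (ψ f).snd, map_add' := ?_, map_smul' := ?_ } ?_, ?_, ?_⟩
  · intro f f'
    simp
  · intro r f
    have h1 : ψ (algebraMap ℝ _ r) = TrivSqZeroExt.inl (algebraMap ℝ _ r) := by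
      rw [algebraMap_eq_const, ← res_const (conic.basicOpen_le g) r]
      exact (hψ _).trans (hφ r)
    rw [Algebra.smul_def, map_mul, h1, TrivSqZeroExt.snd_mul]
    simp [Algebra.smul_def]
  · intro f f'
    change (ψ (f * f')).snd = f • (ψ f').snd + f' • (ψ f).snd
    rw [map_mul, TrivSqZeroExt.snd_mul, hψfst, hψfst]
    simp [mul_comm]
  · change (ψ (ρ _)).snd = _
    rw [hψ, h0]
    simp [b]
  · change (ψ (ρ _)).snd = _
    rw [hψ, hk]
    simp [a]

lemma eq_top_of_mem_basicOpen {j k : Fin 3} (hjk : j = 2 ∧ k = 1 ∨ j = 1 ∧ k = 2)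
    (g : Γ(conic, Proj.basicOpen grading (coord j)))
    (S : Subalgebra ℝ Γ(conic, conic.basicOpen g))
    (h0 : res (conic.basicOpen_le g) (coordDiv 0 j) ∈ S)
    (hk : res (conic.basicOpen_le g) (coordDiv k j) ∈ S)
    (hinv : ∀ s ∈ S, ∀ s', s * s' = 1 → s' ∈ S) : S = ⊤ := by
  have hU : IsAffineOpen (Proj.basicOpen grading (coord j)) :=
    Proj.isAffineOpen_basicOpen grading (coord j) (coord_mem j) one_pos
  let ρ : Γ(conic, Proj.basicOpen grading (coord j)) →ₐ[ℝ] Γ(conic, conic.basicOpen g) :=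
    { res (conic.basicOpen_le g) with commutes' := res_algebraMap _ }
  have hres : ∀ f, res (conic.basicOpen_le g) f ∈ S :=
    (isConicRing_coordDiv hjk).mem_subalgebra (S.comap ρ) h0 hk
  refine eq_top_iff.mpr fun f _ => ?_
  obtain ⟨N, hN⟩ := exists_res_eq_pow_mul hU g f
  obtain ⟨s, hs⟩ := hN N le_rfl
  obtain ⟨u, hu⟩ := (isUnit_res_basicOpen g).exists_right_inv
  have h1 : f = u ^ N * res (conic.basicOpen_le g) s := by
    rw [hs, ← mul_assoc, ← mul_pow, mul_comm u, hu, one_pow, one_mul]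
  rw [h1]
  exact S.mul_mem (S.pow_mem (hinv _ (hres g) u hu) N) (hres s)

end Derivations

end

/-! ### The cotangent bundle -/

section

open KaehlerDifferential

/-- The presheaf `U ↦ Ω_{𝒪(U)/ℝ}` on the conic. -/
def kaehlerPresheaf : conic.PresheafOfModules :=
  PresheafOfModules.DifferentialsConstruction.relativeDifferentials'
    (S' := (Functor.const _).obj (CommRingCat.of ℝ)) (R := conic.presheaf)
    { app := fun U => (Scheme.ΓSpecIso (.of ℝ)).inv ≫ conicToSpec.appTop ≫
        conic.presheaf.map (homOfLE le_top : U.unop ⟶ ⊤).op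
      naturality := by
        intro U V g
        simp only [Functor.const_obj_map, Category.assoc, ← Functor.map_comp]
        rfl }

/-- The sections of `kaehlerPresheaf` are the Kähler differentials. -/
def kaehlerEquiv (U : conic.Opens) : Ω[Γ(conic, U)⁄ℝ] ≃ₗ[Γ(conic, U)] PSec kaehlerPresheaf U :=
  LinearEquiv.refl _ Ω[Γ(conic, U)⁄ℝ]

lemma resP_kaehlerEquiv_D {U V : conic.Opens} (h : V ≤ U) (f : Γ(conic, U)) :
    resP kaehlerPresheaf h (kaehlerEquiv U (D ℝ _ f)) = kaehlerEquiv V (D ℝ _ (res h f)) :=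
  PresheafOfModules.DifferentialsConstruction.relativeDifferentials'_map_d _ (homOfLE h).op f

lemma kaehlerEquiv_rotForm {U V : conic.Opens} (h : V ≤ U) (f g : Γ(conic, U)) :
    resP kaehlerPresheaf h (kaehlerEquiv U (rotForm f g)) =
      kaehlerEquiv V (rotForm (res h f) (res h g)) := by
  simp only [rotForm, map_sub, map_smul, resP_smul, resP_kaehlerEquiv_D]

/-- The section `f dg - g df` of the cotangent bundle. -/
def rotSection {U : conic.Opens} (f g : Γ(conic, U)) : Γ(Omega, U) :=
  toShf kaehlerPresheaf U (kaehlerEquiv U (rotForm f g))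

lemma resM_rotSection {U V : conic.Opens} (h : V ≤ U) (f g : Γ(conic, U)) :
    resM Omega h (rotSection f g) = rotSection (res h f) (res h g) :=
  (resM_toShf kaehlerPresheaf h _).trans (congrArg _ (kaehlerEquiv_rotForm h f g))

lemma isFrame_rotSection {j k : Fin 3} (hjk : j = 2 ∧ k = 1 ∨ j = 1 ∧ k = 2) :
    IsFrame Omega (Proj.basicOpen grading (coord j))
      fun _ : Unit => rotSection (coordDiv 0 j) (coordDiv k j) := by
  have hU : IsAffineOpen (Proj.basicOpen grading (coord j)) :=
    Proj.isAffineOpen_basicOpen grading (coord j) (coord_mem j) one_pos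
  refine isFrame_sheafify kaehlerPresheaf _ fun W hW x hx => ?_
  obtain ⟨g, hg, hxg⟩ := hU.exists_basicOpen_le ⟨x, hx⟩ (hW hx)
  refine ⟨conic.basicOpen g, hg, conic.basicOpen_le g, hxg, ?_⟩
  have hrel : res (conic.basicOpen_le g) (coordDiv 0 j) ^ 2 +
      res (conic.basicOpen_le g) (coordDiv k j) ^ 2 + 1 = 0 := by
    simpa using congrArg (res (conic.basicOpen_le g)) (isConicRing_coordDiv hjk).rel
  obtain ⟨δ, h0, hk⟩ := exists_derivation hjk g
  have e : (fun f : Unit → Γ(conic, conic.basicOpen g) => ∑ i, f i •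
      resP kaehlerPresheaf (conic.basicOpen_le g)
        (kaehlerEquiv _ (rotForm (coordDiv 0 j) (coordDiv k j)))) =
      kaehlerEquiv _ ∘ (fun f => f • rotForm (res (conic.basicOpen_le g) (coordDiv 0 j))
        (res (conic.basicOpen_le g) (coordDiv k j))) ∘ Equiv.funUnique Unit _ := by
    funext f
    rw [Finset.univ_unique, Finset.sum_singleton, kaehlerEquiv_rotForm, ← map_smul]
    rfl
  rw [e]
  refine (kaehlerEquiv _).bijective.comp
    (Function.Bijective.comp ⟨smul_rotForm_injective hrel δ h0 hk, fun s => ?_⟩ (Equiv.bijective _))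
  have hs : s ∈ Submodule.span Γ(conic, conic.basicOpen g)
      {rotForm (res (conic.basicOpen_le g) (coordDiv 0 j))
        (res (conic.basicOpen_le g) (coordDiv k j))} := by
    rw [span_rotForm_eq_top hrel fun S => eq_top_of_mem_basicOpen hjk g S]
    trivial
  exact Submodule.mem_span_singleton.mp hs

/-- With c = a/b and d = 1/b one has a db - b da = -b² dc, and dc is d times the form c dd - d dc.
-/
lemma rotForm_eq_smul {B : Type} [CommRing B] [Algebra ℝ B] {a b c d : B}
    (h : c ^ 2 + d ^ 2 + 1 = 0) (hd : b * d = 1) (ha : a = c * b) :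
    rotForm a b = (-b) • rotForm c d := by
  have h1 : rotForm a b = (-(b * b)) • D ℝ B c := by
    rw [rotForm, ha, Derivation.leibniz]
    module
  rw [h1, D_fst_eq h, smul_smul]
  congr 1
  linear_combination (-b) * hd

lemma isTransitionMatrix_Omega :
    IsTransitionMatrix U₁ U₂ Omega (Matrix.diagonal fun _ : Unit => ((t : R₁₂ˣ) : R₁₂)) := by
  refine ⟨_, _, isFrame_rotSection (.inl ⟨rfl, rfl⟩), isFrame_rotSection (.inr ⟨rfl, rfl⟩),
    fun j => ?_⟩
  rw [Finset.univ_unique, Finset.sum_singleton, resM_rotSection, resM_rotSection]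
  have hrel : ι₂ (coordDiv 0 1) ^ 2 + ι₂ (coordDiv 2 1) ^ 2 + 1 = 0 := by
    simpa using congrArg ι₂ isConicRing_R₂.rel
  have h := rotForm_eq_smul hrel yz_mul_zy xy_mul_yz.symm
  have h2 := congrArg (fun s => toShf kaehlerPresheaf (U₁ ⊓ U₂) (kaehlerEquiv _ s)) h
  simp only [map_smul, toShf_smul] at h2
  exact h2

end

/-! ### Endomorphisms of the Quillen bundle -/

section

open Matrix

/-- The intersection of R₁ and tR₂ is the space of sections of a line bundle of degree two: the
exponents leave only 1, t and x/z. -/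
lemma exists_eq_of_ι₁_eq_t_mul {c : R₁} {r : R₂} (h : ι₁ c = (t : R₁₂) * ι₂ r) :
    ∃ c₀ c₁ c₂ : ℝ, c = algebraMap ℝ R₁ c₀ + t₁ * algebraMap ℝ R₁ c₁ + x₁ * algebraMap ℝ R₁ c₂ ∧
      r = t₂ * algebraMap ℝ R₂ c₀ + algebraMap ℝ R₂ c₁ + x₂ * algebraMap ℝ R₂ c₂ := by
  have h1 : ι₁ c = algebraMap ℝ R₁₂ (coeffA 0 (ι₁ c)) +
      ((t ^ (1 : ℤ) : R₁₂ˣ) : R₁₂) * algebraMap ℝ R₁₂ (coeffA 1 (ι₁ c)) +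
      xz * algebraMap ℝ R₁₂ (coeffB 0 (ι₁ c)) := by
    have hA : ∀ k > 1, coeffA k (ι₁ c) = 0 := fun k hk => by
      rw [h, ← t_zpow_one, coeffA_t_mul, coeffA_ι₂ (by omega)]
    have hB : ∀ k > 0, coeffB k (ι₁ c) = 0 := fun k hk => by
      rw [h, ← t_zpow_one, coeffB_t_mul, coeffB_ι₂ (by omega)]
    refine ext_coeff (fun k => ?_) fun k => ?_
    · simp only [map_add, coeffA_t_mul, coeffA_xz_mul, coeffA_algebraMap, coeffB_algebraMap]
      rcases lt_trichotomy k 0 with hk | rfl | hk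
      · rw [coeffA_ι₁ hk, if_neg (by omega), if_neg (by omega)]
        simp
      · simp
      · rcases (show 1 ≤ k by omega).eq_or_lt with rfl | hk'
        · simp
        · rw [hA k hk', if_neg (by omega), if_neg (by omega)]
          simp
    · simp only [map_add, coeffB_t_mul, coeffB_xz_mul, coeffA_algebraMap, coeffB_algebraMap]
      rcases lt_trichotomy k 0 with hk | rfl | hk
      · rw [coeffB_ι₁ hk, if_neg (by omega)]
        simp
      · simp
      · rw [hB k hk, if_neg (by omega)]
        simp
  rw [t_zpow_one] at h1
  refine ⟨coeffA 0 (ι₁ c), coeffA 1 (ι₁ c), coeffB 0 (ι₁ c), ι₁_injective ?_, ι₂_injective ?_⟩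
  · simp only [map_add, map_mul, ι₁_t₁, ι₁_x₁, ι₁_algebraMap]
    exact h1
  · simp only [map_add, map_mul, ι₂_t₂, ι₂_x₂, ι₂_algebraMap]
    rw [h1] at h
    linear_combination ((t⁻¹ : R₁₂ˣ) : R₁₂) * (-h) +
      (algebraMap ℝ R₁₂ (coeffA 1 (ι₁ c)) - ι₂ r) * t_mul_t_inv

/-- The endomorphisms of the Quillen bundle are quaternions. -/
lemma exists_eq_of_quillenMatrix_mul {A : Matrix (Fin 2) (Fin 2) R₁} {B : Matrix (Fin 2) (Fin 2) R₂}
    (h : quillenMatrix * A.map ι₁ = B.map ι₂ * quillenMatrix) :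
    ∃ a c₀ c₁ c₂ : ℝ, A =
      !![algebraMap ℝ R₁ a + t₁ * algebraMap ℝ R₁ c₂ - x₁ * algebraMap ℝ R₁ c₁,
        -algebraMap ℝ R₁ c₀ + t₁ * algebraMap ℝ R₁ c₁ + x₁ * algebraMap ℝ R₁ c₂;
        algebraMap ℝ R₁ c₀ + t₁ * algebraMap ℝ R₁ c₁ + x₁ * algebraMap ℝ R₁ c₂,
        algebraMap ℝ R₁ a - t₁ * algebraMap ℝ R₁ c₂ + x₁ * algebraMap ℝ R₁ c₁] := by
  have h00 := congrFun (congrFun h 0) 0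
  have h01 := congrFun (congrFun h 0) 1
  have h10 := congrFun (congrFun h 1) 0
  have h11 := congrFun (congrFun h 1) 1
  simp only [quillenMatrix, Matrix.mul_apply, Fin.sum_univ_two, Matrix.map_apply, Matrix.of_apply,
    Matrix.cons_val', Matrix.cons_val_zero, Matrix.cons_val_one, Matrix.cons_val_fin_one, zero_mul,
    mul_zero, one_mul, mul_one, zero_add, add_zero] at h00 h01 h10 h11
  -- The lower left entry is the map from the subbundle t to the quotient 1, a linear form with
  -- three real parameters.
  obtain ⟨c₀, c₁, c₂, hc, hr⟩ := exists_eq_of_ι₁_eq_t_mul (h10.trans (mul_comm _ _))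
  have hιc := congrArg ι₁ hc
  have hιr := congrArg ι₂ hr
  simp only [map_add, map_mul, ι₁_t₁, ι₁_x₁, ι₁_algebraMap] at hιc
  simp only [map_add, map_mul, ι₂_t₂, ι₂_x₂, ι₂_algebraMap] at hιr
  have hxt : xz * xz * ((t⁻¹ : R₁₂ˣ) : R₁₂) = -((t⁻¹ : R₁₂ˣ) : R₁₂) - t := by
    rw [xz_mul_xz]
    linear_combination (-(t : R₁₂)) * t_mul_t_inv
  have e₁ : ι₂ (B 0 0) = ι₁ (A 0 0) + xz * ι₂ (B 1 0) := by
    linear_combination (-((t⁻¹ : R₁₂ˣ) : R₁₂)) * h00 + xz * ((t⁻¹ : R₁₂ˣ) : R₁₂) * h10 +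
      (ι₁ (A 0 0) - ι₂ (B 0 0) + xz * ι₂ (B 1 0)) * t_mul_t_inv
  -- Corrected by the terms that this linear form dictates, each diagonal entry is regular on both
  -- charts, hence constant.
  obtain ⟨a, -, ha⟩ := exists_eq_algebraMap (l := B 0 0 - x₂ * algebraMap ℝ R₂ c₀ +
    t₂ * algebraMap ℝ R₂ c₂) (s := A 0 0 + x₁ * algebraMap ℝ R₁ c₁ - t₁ * algebraMap ℝ R₁ c₂) (by
      simp only [map_add, map_sub, map_mul, ι₁_t₁, ι₁_x₁, ι₁_algebraMap, ι₂_t₂, ι₂_x₂, ι₂_algebraMap]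
      linear_combination e₁ + xz * hιr + algebraMap ℝ R₁₂ c₂ * hxt)
  obtain ⟨d, -, hd⟩ := exists_eq_algebraMap (l := B 1 1 + x₂ * algebraMap ℝ R₂ c₀ -
    t₂ * algebraMap ℝ R₂ c₂) (s := A 1 1 - x₁ * algebraMap ℝ R₁ c₁ + t₁ * algebraMap ℝ R₁ c₂) (by
      simp only [map_add, map_sub, map_mul, ι₁_t₁, ι₁_x₁, ι₁_algebraMap, ι₂_t₂, ι₂_x₂, ι₂_algebraMap]
      linear_combination -h11 - xz * hιr - algebraMap ℝ R₁₂ c₂ * hxt)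
  have hιa := congrArg ι₁ ha
  have hιd := congrArg ι₁ hd
  simp only [map_add, map_sub, map_mul, ι₁_t₁, ι₁_x₁, ι₁_algebraMap] at hιa hιd
  -- Nonsplitness forces the two diagonal constants to agree and determines the upper right entry.
  obtain ⟨h0, hb⟩ := eq_zero_of_xz_add (c := d - a)
    (s := A 0 1 - t₁ * algebraMap ℝ R₁ c₁ - x₁ * algebraMap ℝ R₁ c₂ + algebraMap ℝ R₁ c₀)
    (l := B 0 1 + algebraMap ℝ R₂ c₁ - t₂ * algebraMap ℝ R₂ c₀ - x₂ * algebraMap ℝ R₂ c₂) (by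
      simp only [map_add, map_sub, map_mul, ι₁_t₁, ι₁_x₁, ι₁_algebraMap, ι₂_t₂, ι₂_x₂, ι₂_algebraMap]
      linear_combination h01 + xz * e₁ + xz * hιa - xz * hιd + xz * xz * hιr +
        (algebraMap ℝ R₁₂ c₀ + xz * algebraMap ℝ R₁₂ c₂) * hxt -
        algebraMap ℝ R₁₂ c₁ * xz_mul_xz)
  obtain rfl : d = a := sub_eq_zero.mp h0
  refine ⟨d, c₀, c₁, c₂, ?_⟩
  ext i j
  fin_cases i <;> fin_cases j
  · change A 0 0 = _ + _ - _
    linear_combination ha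
  · change A 0 1 = _ + _ + _
    linear_combination hb
  · exact hc
  · change A 1 1 = _ - _ + _
    linear_combination hd

/-- By the relation on the chart, the determinant is the quaternion norm a² + c₀² + c₁² + c₂², a
real constant. -/
lemma eq_zero_of_det_eq_zero {A : Matrix (Fin 2) (Fin 2) R₁} {B : Matrix (Fin 2) (Fin 2) R₂}
    (h : quillenMatrix * A.map ι₁ = B.map ι₂ * quillenMatrix) (hA : A.det = 0) : A = 0 := by
  obtain ⟨a, c₀, c₁, c₂, rfl⟩ := exists_eq_of_quillenMatrix_mul h
  rw [Matrix.det_fin_two_of] at hA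
  have h1 : algebraMap ℝ R₁ (a ^ 2 + c₀ ^ 2 + c₁ ^ 2 + c₂ ^ 2) = 0 := by
    simp only [map_add, map_pow]
    linear_combination hA + (algebraMap ℝ R₁ c₁ ^ 2 + algebraMap ℝ R₁ c₂ ^ 2) * isConicRing_t₁.rel
  have h2 : a ^ 2 + c₀ ^ 2 + c₁ ^ 2 + c₂ ^ 2 = 0 := (map_eq_zero _).mp h1
  obtain rfl : a = 0 := by nlinarith [sq_nonneg a, sq_nonneg c₀, sq_nonneg c₁, sq_nonneg c₂]
  obtain rfl : c₀ = 0 := by nlinarith [sq_nonneg c₀, sq_nonneg c₁, sq_nonneg c₂]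
  obtain rfl : c₁ = 0 := by nlinarith [sq_nonneg c₁, sq_nonneg c₂]
  obtain rfl : c₂ = 0 := by nlinarith [sq_nonneg c₂]
  ext i j
  fin_cases i <;> fin_cases j <;> simp

/-- The inverse of the transition matrix of the Quillen bundle. -/
def quillenMatrixInv : Matrix (Fin 2) (Fin 2) R₁₂ :=
  !![((t⁻¹ : R₁₂ˣ) : R₁₂), -xz * ((t⁻¹ : R₁₂ˣ) : R₁₂); 0, 1]

lemma quillenMatrix_mul_inv : quillenMatrix * quillenMatrixInv = 1 := by
  rw [quillenMatrix, quillenMatrixInv, Matrix.mul_fin_two, Matrix.one_fin_two]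
  congr 1
  simp only [mul_zero, zero_mul, mul_one, add_zero, zero_add, t_mul_t_inv]
  have : (t : R₁₂) * (-xz * ((t⁻¹ : R₁₂ˣ) : R₁₂)) + xz = 0 := by
    linear_combination -xz * t_mul_t_inv
  rw [this]

lemma isTransitionMatrix_quillen : IsTransitionMatrix U₁ U₂ quillen quillenMatrix :=
  isTransitionMatrix_clutch quillenMatrix_mul_inv

lemma isVectorBundle_of_isTransitionMatrix {κ : Type} [Fintype κ] {F : conic.Modules}
    {M : Matrix κ κ R₁₂} (h : IsTransitionMatrix U₁ U₂ F M) : IsVectorBundle F := by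
  obtain ⟨v, w, hv, hw, -⟩ := h
  exact isVectorBundle_of_isFrame hv hw U₁_sup_U₂

section Endomorphisms

variable {κ : Type} [Fintype κ] {F G : conic.Modules}

lemma eq_zero_of_appL_eq_zero {v : κ → Γ(F, U₁)} {w : κ → Γ(F, U₂)} (hv : IsFrame F U₁ v)
    (hw : IsFrame F U₂ w) (φ : F ⟶ G) (h₁ : ∀ j, appL φ U₁ (v j) = 0)
    (h₂ : ∀ j, appL φ U₂ (w j) = 0) : φ = 0 := by
  have key : ∀ {U : conic.Opens} {u : κ → Γ(F, U)} (hu : IsFrame F U u)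
      (h : ∀ j, appL φ U (u j) = 0) (W : conic.Opens) (hW : W ≤ U) (s : Γ(F, W)),
      appL φ W s = 0 := by
    intro U u hu h W hW s
    obtain ⟨f, rfl⟩ := (hu W hW).2 s
    rw [map_sum]
    refine Finset.sum_eq_zero fun k _ => ?_
    rw [map_smul, appL_resM, h, map_zero, smul_zero]
  refine hom_ext_appL fun U s => ?_
  rw [appL_zero]
  refine section_ext G fun x hx => ?_
  have hx' : x ∈ U₁ ⊔ U₂ := U₁_sup_U₂ ▸ trivial
  rcases hx' with hx' | hx'
  · refine ⟨U ⊓ U₁, inf_le_left, ⟨hx, hx'⟩, ?_⟩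
    rw [← appL_resM, key hv h₁ _ inf_le_right, map_zero]
  · refine ⟨U ⊓ U₂, inf_le_left, ⟨hx, hx'⟩, ?_⟩
    rw [← appL_resM, key hw h₂ _ inf_le_right, map_zero]

end Endomorphisms

lemma exists_matrix_of_hom {v : Fin 2 → Γ(quillen, U₁)} {w : Fin 2 → Γ(quillen, U₂)}
    (hv : IsFrame quillen U₁ v) (hw : IsFrame quillen U₂ w)
    (hvw : ∀ j, resM quillen inf_le_left (v j) =
      ∑ i, quillenMatrix i j • resM quillen inf_le_right (w i)) (φ : quillen ⟶ quillen) :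
    ∃ A : Matrix (Fin 2) (Fin 2) R₁, (∀ j, appL φ U₁ (v j) = ∑ i, A i j • v i) ∧
      (A.det = 0 → φ = 0) := by
  obtain ⟨A, hA⟩ := hv.exists_matrix fun j => appL φ U₁ (v j)
  obtain ⟨B, hB⟩ := hw.exists_matrix fun j => appL φ U₂ (w j)
  have key : quillenMatrix * A.map ι₁ = B.map ι₂ * quillenMatrix := by
    ext i j
    refine congrFun ((hw.mono inf_le_right).eq_of_sum_eq
      (f := fun i => (quillenMatrix * A.map ι₁) i j)
      (g := fun i => (B.map ι₂ * quillenMatrix) i j) ?_) i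
    have e1 := congrArg (resM quillen (inf_le_left : U₁ ⊓ U₂ ≤ U₁)) (hA j)
    have e2 := congrArg (appL φ (U₁ ⊓ U₂)) (hvw j)
    rw [appL_resM, e1, resM_sum_smul] at e2
    simp only [hvw, map_sum, map_smul, appL_resM, hB, resM_smul] at e2
    exact (sum_smul_sum quillenMatrix (fun i => ι₁ (A i j)) _).symm.trans
      (e2.trans (sum_smul_sum (B.map ι₂) (fun i => quillenMatrix i j) _))
  refine ⟨A, hA, fun h0 => ?_⟩
  obtain rfl := eq_zero_of_det_eq_zero key h0
  have hB0 : B = 0 := by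
    have h1 : B.map ι₂ = 0 := by
      rw [← Matrix.mul_one (B.map ι₂), ← quillenMatrix_mul_inv, ← Matrix.mul_assoc, ← key,
        Matrix.map_zero _ (map_zero _), Matrix.mul_zero, Matrix.zero_mul]
    ext i j
    exact ι₂_injective ((congrFun (congrFun h1 i) j).trans (map_zero _).symm)
  refine eq_zero_of_appL_eq_zero hv hw φ (fun j => ?_) fun j => ?_
  · rw [hA]
    simp
  · rw [hB, hB0]
    simp

/-- Composition becomes a matrix product over the domain `R₁`, and a nonzero endomorphism has
nonzero determinant. -/
lemma eq_zero_or_eq_zero_of_comp (φ ψ : quillen ⟶ quillen) (h : φ ≫ ψ = 0) : φ = 0 ∨ ψ = 0 := by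
  obtain ⟨v, w, hv, hw, hvw⟩ := isTransitionMatrix_quillen
  obtain ⟨A, hA, hA0⟩ := exists_matrix_of_hom hv hw hvw φ
  obtain ⟨B, hB, hB0⟩ := exists_matrix_of_hom hv hw hvw ψ
  have hBA : B * A = 0 := by
    ext i j
    refine congrFun (hv.eq_of_sum_eq (f := fun i => (B * A) i j) (g := fun _ => 0) ?_) i
    have e : appL (φ ≫ ψ) U₁ (v j) = ∑ i, (B * A) i j • v i := by
      rw [appL_comp, hA, map_sum]
      simp only [map_smul, hB]
      exact sum_smul_sum B (fun i => A i j) v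
    rw [← e, h]
    simp [appL_zero]
  have hdet := congrArg Matrix.det hBA
  rw [Matrix.det_mul, Matrix.det_zero] at hdet
  exact (mul_eq_zero.mp hdet).elim (fun h => .inr (hB0 h)) fun h => .inl (hA0 h)

/-- The two projectors of a direct sum decomposition compose to zero, so one of them vanishes. -/
lemma indecomposable_quillen : Indecomposable quillen := by
  refine ⟨fun hz => ?_, fun Y Z e => ?_⟩
  · obtain ⟨v, w, hv, -, -⟩ := isTransitionMatrix_quillen
    have hs : ∀ s : Γ(quillen, U₁), s = 0 := fun s => by
      rw [← appL_id U₁ s, (IsZero.iff_id_eq_zero _).mp hz, appL_zero]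
    have := congrFun (hv.eq_of_sum_eq (f := fun _ => 1) (g := fun _ => 0)
      ((hs _).trans (hs _).symm)) 0
    exact one_ne_zero this
  · have h := eq_zero_or_eq_zero_of_comp (e.hom ≫ biprod.fst ≫ biprod.inl ≫ e.inv)
      (e.hom ≫ biprod.snd ≫ biprod.inr ≫ e.inv) (by simp)
    refine h.imp (fun h => ?_) fun h => ?_
    · have h1 : biprod.inl ≫ e.inv ≫ (e.hom ≫ biprod.fst ≫ biprod.inl ≫ e.inv) ≫ e.hom ≫ biprod.fst =
        𝟙 Y := by simp
      rw [IsZero.iff_id_eq_zero, ← h1, h]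
      simp
    · have h1 : biprod.inr ≫ e.inv ≫ (e.hom ≫ biprod.snd ≫ biprod.inr ≫ e.inv) ≫ e.hom ≫ biprod.snd =
        𝟙 Z := by simp
      rw [IsZero.iff_id_eq_zero, ← h1, h]
      simp

end

/-! ### Canonical bundles -/

section Powers

variable {L : conic.Modules} {f : R₁₂}

/-- The `1 × 1` matrix with a given entry. -/
abbrev scalarMatrix (f : R₁₂) : Matrix Unit Unit R₁₂ := Matrix.diagonal fun _ => f

lemma isTransitionMatrix_tensorPow (h : IsTransitionMatrix U₁ U₂ L (scalarMatrix f)) (n : ℕ) :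
    IsTransitionMatrix U₁ U₂ (tensorPow L n) (scalarMatrix (f ^ n)) := by
  induction n with
  | zero =>
    have := isTransitionMatrix_structureSheaf (X := conic) U₁ U₂
    rw [pow_zero]
    exact this
  | succ n ih =>
    have e : scalarMatrix (f ^ (n + 1)) = (Matrix.kroneckerMap (· * ·) (scalarMatrix (f ^ n))
        (scalarMatrix f)).submatrix (Equiv.punitProd Unit).symm (Equiv.punitProd Unit).symm := by
      ext i j
      simp [pow_succ]
    rw [e]
    exact (isTransitionMatrix_tensor ih h).reindex _

lemma isTransitionMatrix_tensorZPow {u : R₁₂ˣ}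
    (h : IsTransitionMatrix U₁ U₂ L (scalarMatrix u)) (n : ℤ) :
    IsTransitionMatrix U₁ U₂ (tensorZPow L n) (scalarMatrix (u ^ n : R₁₂ˣ)) := by
  cases n with
  | ofNat n =>
    have := isTransitionMatrix_tensorPow h n
    rw [Int.ofNat_eq_natCast, zpow_natCast, Units.val_pow_eq_pow_val]
    exact this
  | negSucc n =>
    have hd : IsTransitionMatrix U₁ U₂ (dual L) (scalarMatrix (u⁻¹ : R₁₂ˣ)) := by
      have := isTransitionMatrix_dual h (N := scalarMatrix (u⁻¹ : R₁₂ˣ)) (by simp)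
      rwa [Matrix.diagonal_transpose] at this
    have := isTransitionMatrix_tensorPow hd (n + 1)
    rw [zpow_negSucc, ← inv_pow, Units.val_pow_eq_pow_val]
    exact this

end Powers

lemma isTransitionMatrix_tensorZPow_Omega (r : ℤ) :
    IsTransitionMatrix U₁ U₂ (tensorZPow Omega r) (scalarMatrix (evenBlock r)) :=
  isTransitionMatrix_tensorZPow isTransitionMatrix_Omega r

lemma isTransitionMatrix_quillen_tensor (s : ℤ) :
    IsTransitionMatrix U₁ U₂ (tensor quillen (tensorZPow Omega s)) (oddBlock s) := by
  have e : oddBlock s = (Matrix.kroneckerMap (· * ·) quillenMatrix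
      (scalarMatrix (evenBlock s))).submatrix (Equiv.prodPUnit (Fin 2)).symm
        (Equiv.prodPUnit (Fin 2)).symm := by
    have h1 : ((t ^ (s + 1) : R₁₂ˣ) : R₁₂) = t * ((t ^ s : R₁₂ˣ) : R₁₂) := by
      rw [zpow_add_one, mul_comm, Units.val_mul]
    ext i j
    have h2 : scalarMatrix (evenBlock s) () () = evenBlock s := Matrix.diagonal_apply_eq _ _
    change oddBlock s i j = quillenMatrix i j * scalarMatrix (evenBlock s) () ()
    rw [h2]
    fin_cases i <;> fin_cases j
    · exact h1
    · rfl
    · exact (zero_mul _).symm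
    · exact (one_mul _).symm
  rw [e]
  exact (isTransitionMatrix_tensor isTransitionMatrix_quillen
    (isTransitionMatrix_tensorZPow_Omega s)).reindex _

lemma isTransitionMatrix_canonicalBundle (m : ℤ →₀ ℕ) :
    IsTransitionMatrix U₁ U₂ (canonicalBundle m) (canonicalMatrix m) := by
  refine isTransitionMatrix_biprod ?_
    (isTransitionMatrix_biproduct _ fun p => isTransitionMatrix_quillen_tensor p.1)
  have e : (Matrix.diagonal fun p : LineIdx m => evenBlock p.1) =
      (Matrix.blockDiagonal fun p : LineIdx m => scalarMatrix (evenBlock p.1)).submatrix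
        (Equiv.punitProd _).symm (Equiv.punitProd _).symm := by
    ext p q
    by_cases h : p = q
    · subst h
      simp
    · simp [h]
  rw [e]
  exact (isTransitionMatrix_biproduct _ fun p : LineIdx m => isTransitionMatrix_tensorZPow_Omega p.1).reindex _

instance : Nontrivial R₁₂ := ι₁_injective.nontrivial

lemma exists_isTransitionMatrix_canonicalMatrix {V : conic.Modules} (hV : IsVectorBundle V) :
    ∃ m, IsTransitionMatrix U₁ U₂ V (canonicalMatrix m) := by
  have h₁ : IsAffineOpen U₁ := Proj.isAffineOpen_basicOpen grading (coord 2) (coord_mem 2) one_pos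
  have h₂ : IsAffineOpen U₂ := Proj.isAffineOpen_basicOpen grading (coord 1) (coord_mem 1) one_pos
  have hne₁₂ := nonempty_U₁_inf_U₂
  obtain ⟨n, v, hv⟩ := exists_isFrame_of_isPrincipalIdealRing hV h₁ (hne₁₂.mono inf_le_left)
  obtain ⟨n', w, hw⟩ := exists_isFrame_of_isPrincipalIdealRing hV h₂ (hne₁₂.mono inf_le_right)
  obtain ⟨A, B, hAB, hBA, -⟩ := exists_change_of_frame (hv.mono (inf_le_left : U₁ ⊓ U₂ ≤ U₁))
    (hw.mono inf_le_right)
  -- Over the nonempty overlap both frames are frames of the same bundle, so the ranks on the two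
  -- charts agree and the transition matrix is square.
  have hn : n' = n := by
    simpa using le_antisymm (card_le_of_mul_eq_one hAB) (card_le_of_mul_eq_one hBA)
  subst hn
  obtain ⟨M, P, hMP, -, hM⟩ := exists_change_of_frame (hv.mono (inf_le_left : U₁ ⊓ U₂ ≤ U₁))
    (hw.mono inf_le_right)
  obtain ⟨m, hm⟩ := exists_transEquiv_canonicalMatrix hMP
  exact ⟨m, IsTransitionMatrix.of_transEquiv ⟨v, w, hv, hw, hM⟩ hm⟩

end AnisotropicConic

end

open AnisotropicConic in
/-- Vector bundles on the real anisotropic conic, and their transition matrices. -/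
theorem theorem3p4 :
    (IsVectorBundle quillen ∧ IsTransitionMatrix U₁ U₂ quillen quillenMatrix ∧
      Indecomposable quillen) ∧
    (∀ V : conic.Modules, IsVectorBundle V → ∃ m : ℤ →₀ ℕ,
      (∀ m' : ℤ →₀ ℕ, Nonempty (V ≅ canonicalBundle m') ↔ m' = m) ∧
      (∀ m' : ℤ →₀ ℕ, IsTransitionMatrix U₁ U₂ V (canonicalMatrix m') ↔ m' = m)) ∧
    (∀ (n : ℕ) (M : GL (Fin n) R₁₂), ∃! m : ℤ →₀ ℕ, ClutchEquiv M.1 (canonicalMatrix m)) := by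
  refine ⟨⟨isVectorBundle_of_isTransitionMatrix isTransitionMatrix_quillen,
    isTransitionMatrix_quillen, indecomposable_quillen⟩, fun V hV => ?_, existsUnique_clutchEquiv⟩
  obtain ⟨m, hm⟩ := exists_isTransitionMatrix_canonicalMatrix hV
  have key : ∀ m', IsTransitionMatrix U₁ U₂ V (canonicalMatrix m') → m' = m := fun m' hm' =>
    eq_of_transEquiv_canonicalMatrix (transEquiv_of_isTransitionMatrix hm' hm)
  refine ⟨m, fun m' => ⟨fun ⟨e⟩ => key m' ((isTransitionMatrix_canonicalBundle m').of_iso e.symm), ?_⟩,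
    fun m' => ⟨key m', ?_⟩⟩
  · rintro rfl
    exact nonempty_iso_of_isTransitionMatrix U₁_sup_U₂ hm (isTransitionMatrix_canonicalBundle m')
  · rintro rfl
    exact hm
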